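/- Let $n\ge 1$, $\rho>0$ and $1\le p\le\infty$. Put $\gamma_p=\left|\frac2p-1\right|$ (with $\gamma_\infty=1$) and $c_p=\rho^2(1-\gamma_p^2)$. For $\nu>0$ and $z>0$ let $$K_\nu(z)=\tfrac12\left(\tfrac z2\right)^\nu\int_0^\infty e^{-(t+\frac{z^2}{4t})}\,t^{-\nu-1}\,dt,\qquad \tilde K_\nu(z)=z^\nu K_\nu(z)$$ be the Macdonald function and its normalization. For $1\le p<\infty$ let $L^p_\rho(\mathbb R^n)=L^p\big(\mathbb R^n,(\tilde K_{n/2}(\rho|x|))^{\gamma_p p}\,dx\big)$, and let $L^\infty_\rho(\mathbb R^n)=L^\infty(\mathbb R^n)$ (complex-valued functions). For $c\in\mathbb R$ let $T^c_t=e^{-t(\Delta+\rho^2-c)}$, where $\Delta=-\sum_{j=1}^n\partial^2/\partial x_j^2$; that is, $T_0^c$ is the identity and, for $t>0$, $$T^c_tf(x)=e^{-t(\rho^2-c)}\int_{\mathbb R^n}h_t(x-y)f(y)\,dy,\qquad h_t(x)=(4\pi t)^{-n/2}e^{-|x|^2/(4t)}.$$ A semigroup $(T_t)_{t\ge0}$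 of bounded operators on a Banach space $B$ is *hypercyclic* if $\{T_tv:t\ge0\}$ is dense in $B$ for some $v\in B$; a vector $v$ is *periodic* if $T_tv=v$ for some $t>0$; and the semigroup is *chaotic* if it is hypercyclic and its periodic points are dense in $B$. The above formula (with an absolutely convergent integral) defines a semigroup of bounded operators $T^c_t$ on $L^p_\rho(\mathbb R^n)$ for every $1\le p\le\infty$ and $c\in\mathbb R$, which is strongly continuous if $p<\infty$. Moreover: 1. For $1\le p<\infty$, $p\ne2$, $T^c_t$ is chaotic on $L^p_\rho(\mathbb R^n)$ if $c>c_p$. 2. $T^c_t$ is not chaotic on $L^\infty_\rho(\mathbb R^n)$ for any $c\in\mathbb R$. 3. For $1\le p<\infty$ and $c\le c_p$, $T^c_t$ is not chaotic on $L^p_\rho(\mathbb R^n)$, and for $c<c_p$ it is not even hypercyclic. -/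

import Mathlib

open MeasureTheory
open scoped ENNReal NNReal

/-- A one-parameter semigroup `(T_t)_{t ≥ 0}` of bounded operators on a complex normed space. -/
structure OperatorSemigroup (X : Type*) [NormedAddCommGroup X] [NormedSpace ℂ X] where
  /-- The operator at time `t`. -/
  op : ℝ≥0 → X →L[ℂ] X
  op_zero : op 0 = ContinuousLinearMap.id ℂ X
  op_add : ∀ s t : ℝ≥0, op (s + t) = (op s).comp (op t)

namespace OperatorSemigroup

variable {X : Type*} [NormedAddCommGroup X] [NormedSpace ℂ X]

/-- Strong continuity: every orbit map `t ↦ T_t v` is norm continuous on `[0, ∞)`. -/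
def IsStronglyContinuous (T : OperatorSemigroup X) : Prop :=
  ∀ v : X, Continuous fun t : ℝ≥0 => T.op t v

/-- Some orbit `{T_t v : t ≥ 0}` is dense. -/
def IsHypercyclic (T : OperatorSemigroup X) : Prop :=
  ∃ v : X, Dense (Set.range fun t : ℝ≥0 => T.op t v)

/-- The set of periodic points: those `v` with `T_t v = v` for some `t > 0`. -/
def periodicPoints (T : OperatorSemigroup X) : Set X :=
  {v | ∃ t : ℝ≥0, 0 < t ∧ T.op t v = v}

/-- Chaotic: hypercyclic with a dense set of periodic points. -/
def IsChaotic (T : OperatorSemigroup X) : Prop :=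
  T.IsHypercyclic ∧ Dense T.periodicPoints

end OperatorSemigroup

noncomputable section

/-- The Macdonald function
`K_ν(z) = (1/2) (z/2)^ν ∫_0^∞ exp(-(t + z²/(4t))) t^(-ν-1) dt`, for `z > 0`. -/
def macdonaldK (ν z : ℝ) : ℝ :=
  1 / 2 * (z / 2) ^ ν *
    ∫ t in Set.Ioi (0 : ℝ), Real.exp (-(t + z ^ 2 / (4 * t))) * t ^ (-ν - 1)

/-- `K̃_ν(z) = z^ν K_ν(z)`, for `z > 0`. -/
def macdonaldKTilde (ν z : ℝ) : ℝ := z ^ ν * macdonaldK ν z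

/-- `γ_p = |2/p - 1|` for `1 ≤ p ≤ ∞`. For `p = ∞` one has `p.toReal = 0`, so that the value
is `1`, as it should be since `2/∞ = 0`. -/
def gammaExp (p : ℝ≥0∞) : ℝ := |2 / p.toReal - 1|

/-- `c_p = ρ² (1 - γ_p²)`. -/
def criticalConst (ρ : ℝ) (p : ℝ≥0∞) : ℝ := ρ ^ 2 * (1 - gammaExp p ^ 2)

/-- The measure `(K̃_{n/2}(ρ|x|))^{γ_p p} dx` on `ℝⁿ` for `1 ≤ p < ∞`. (The value of the density
at the single point `x = 0` is irrelevant.) For `p = ∞` we have `p.toReal = 0` and this is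
Lebesgue measure; any measure with the same null sets yields the same `L^∞` space. -/
def weightedMeasure (n : ℕ) (ρ : ℝ) (p : ℝ≥0∞) : Measure (EuclideanSpace ℝ (Fin n)) :=
  volume.withDensity fun x =>
    ENNReal.ofReal (macdonaldKTilde ((n : ℝ) / 2) (ρ * ‖x‖) ^ (gammaExp p * p.toReal))

/-- The space `L^p_ρ(ℝⁿ) = L^p(ℝⁿ, (K̃_{n/2}(ρ|x|))^{γ_p p} dx)` of complex-valued functions;
`L^∞_ρ(ℝⁿ) = L^∞(ℝⁿ)`. -/
abbrev WeightedLp (n : ℕ) (ρ : ℝ) (p : ℝ≥0∞) : Type :=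
  Lp ℂ p (weightedMeasure n ρ p)

/-- The heat kernel `h_t(x) = (4πt)^{-n/2} exp(-|x|²/(4t))` on `ℝⁿ`. -/
def heatKernel (n : ℕ) (t : ℝ) (x : EuclideanSpace ℝ (Fin n)) : ℝ :=
  (4 * Real.pi * t) ^ (-((n : ℝ) / 2)) * Real.exp (-(‖x‖ ^ 2 / (4 * t)))

/-- `T` is the semigroup `T_t^c = e^{-t(Δ + ρ² - c)}`, `Δ = -∑ ∂²/∂x_j²`, on `L^p_ρ(ℝⁿ)`:
for `t > 0` the operator `T_t^c` is `e^{-t(ρ² - c)}` times convolution with the heat kernel, given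
by an absolutely convergent integral. (At `t = 0` it is the identity, by `op_zero`.) -/
def IsHeatSemigroup (n : ℕ) (ρ : ℝ) (p : ℝ≥0∞) [Fact (1 ≤ p)] (c : ℝ)
    (T : OperatorSemigroup (WeightedLp n ρ p)) : Prop :=
  ∀ t : ℝ≥0, 0 < t → ∀ f : WeightedLp n ρ p,
    (∀ x, Integrable (fun y => (heatKernel n t (x - y) : ℂ) * f y) volume) ∧
    ∀ᵐ x ∂volume, T.op t f x =
      (Real.exp (-(t * (ρ ^ 2 - c))) : ℂ) * ∫ y, (heatKernel n t (x - y) : ℂ) * f y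

end

/-!
The density `W = K̃_{n/2}(ρ|x|)^{γp}` of the measure is continuous and positive and satisfies
`W x ≤ exp (κ|x - y|) W y` with `κ = ρ γ p`, because `K̃_ν` is decreasing while `e^z K̃_ν(z)` is
increasing (`besselV_le_exp_abs_mul`, `isModerateWeight_besselWeight`). A Gaussian absorbs the factor
`exp (κ|x - y|)`, so Jensen's inequality shows that convolution with `h_t` is bounded on `L^p(W dx)`
(`IsModerateWeight.eLpNorm_heatConv_le`). Together with `h_s * h_t = h_{s+t}` this gives the semigroup;
it is determined by the formula, and for `p < ∞` strong continuity is checked on continuous functions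
of compact support. Write `b = ρ² - c` and `a = ρ γ_p`, so that `c ≤ c_p` means `a² ≤ b`.

* If `c > c_p` and `p ≠ 2`, `p ≠ ∞`, then `a > 0` and `K̃_{n/2}(ρ|x|) ≤ C_θ e^{-θρ|x|}` for all `θ < 1`,
  so the plane waves `exp (i z ⟨ω, x⟩)`, `|ω| = 1`, belong to the space for `|Im z| < a`. They are
  eigenvectors of `T_t` with eigenvalue `exp (-t (z² + b))` and depend holomorphically on `z`. By the
  identity theorem, the waves with `z` in any set that accumulates in the strip span a dense subspace:
  a functional vanishing on them vanishes on all characters, hence by Fourier inversion on all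
  Schwartz functions (`dense_span_planeWaves`). As `b < a²`, there are such sets with
  `Re (z² + b) > 0`, with `Re (z² + b) < 0`, and with `z² + b = 2πi / k`, `k ≥ 1`. The
  Godefroy–Shapiro criterion (`OperatorSemigroup.isChaotic_of_eigenvectors`) gives
  chaos.
* If `c ≤ c_p` and `p ≠ ∞`, no orbit is dense, because the nonzero functional `f ↦ (h_1 * f)(0)` is
  bounded on every orbit. Indeed `e^{-τa²} h_τ(x) e^{a|x|}` is a Gaussian of width `√τ` concentrated at
  the sphere `|x| = 2τa`, while `K̃_{n/2}(ρ|x|)` is bounded below by a multiple of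
  `(1 + |x|)^{(n-1)/2} e^{-ρ|x|}`; the power of `|x|` just compensates the size of this sphere
  (`exists_exp_mul_lintegral_heatKernel_le`). This covers the equality `c = c_p` as well.
* If `p = ∞`, then `T_t v` is continuous for `t > 0`, and the continuous functions stay at a positive
  distance from the indicator function of a half-space (`not_isHypercyclic_heatSemigroup_top`).
-/

/-! ### The Macdonald function -/

/-- The function `V_ν(z) = ∫_0^∞ exp(-(s + z²/(4s))) s^(ν-1) ds`. For `z > 0` it is
`2^(1-ν) z^ν K_ν(z)`; unlike the latter expression it is also continuous at `z = 0`. -/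
noncomputable def besselV (ν z : ℝ) : ℝ :=
  ∫ s in Set.Ioi (0 : ℝ), Real.exp (-(s + z ^ 2 / (4 * s))) * s ^ (ν - 1)

/-- The substitution `s ↦ b / s` on the half-line. -/
theorem integral_Ioi_comp_div (F : ℝ → ℝ) {b : ℝ} (hb : 0 < b) :
    ∫ s in Set.Ioi (0 : ℝ), b / s ^ 2 * F (b / s) = ∫ s in Set.Ioi (0 : ℝ), F s := by
  have h1 := integral_comp_rpow_Ioi (fun s => b * F (b * s)) (p := -1) (by norm_num)
  have h2 := integral_comp_mul_left_Ioi F 0 hb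
  rw [mul_zero] at h2
  rw [integral_const_mul, h2, smul_eq_mul, mul_inv_cancel_left₀ hb.ne'] at h1
  rw [← h1]
  refine setIntegral_congr_fun measurableSet_Ioi fun s hs => ?_
  have hs : 0 < s := hs
  simp only [smul_eq_mul, Real.rpow_neg_one, abs_neg, abs_one, one_mul]
  rw [show (-1 - 1 : ℝ) = -(2 : ℕ) by norm_num, Real.rpow_neg hs.le, Real.rpow_natCast]
  rw [div_eq_mul_inv b s]
  field_simp

theorem integrableOn_Ioi_comp_div (F : ℝ → ℝ) {b : ℝ} (hb : 0 < b)
    (hF : IntegrableOn F (Set.Ioi 0)) :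
    IntegrableOn (fun s => b / s ^ 2 * F (b / s)) (Set.Ioi (0 : ℝ)) := by
  have h2 : IntegrableOn (fun s => F (b * s)) (Set.Ioi 0) :=
    (integrableOn_Ioi_comp_mul_left_iff F 0 hb).2 (by simpa using hF)
  have h1 := ((integrableOn_Ioi_comp_rpow_iff' (fun s => F (b * s)) (p := -1)
    (by norm_num)).2 h2).const_mul b
  refine IntegrableOn.congr_fun h1 (fun s hs => ?_) measurableSet_Ioi
  have hs : 0 < s := hs
  simp only [smul_eq_mul, Real.rpow_neg_one]
  rw [show (-1 - 1 : ℝ) = -(2 : ℕ) by norm_num, Real.rpow_neg hs.le, Real.rpow_natCast]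
  rw [div_eq_mul_inv b s]
  field_simp

theorem macdonaldKTilde_eq {ν z : ℝ} (hz : 0 < z) :
    macdonaldKTilde ν z = 2 ^ (ν - 1) * besselV ν z := by
  have hb : 0 < z ^ 2 / 4 := by positivity
  unfold macdonaldKTilde macdonaldK besselV
  rw [← integral_Ioi_comp_div _ hb, ← integral_const_mul, ← integral_const_mul,
    ← integral_const_mul]
  refine setIntegral_congr_fun measurableSet_Ioi fun s hs => ?_
  have hs : 0 < s := hs
  have e1 : z ^ 2 / 4 / s + z ^ 2 / (4 * (z ^ 2 / 4 / s)) = s + z ^ 2 / (4 * s) := by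
    field_simp
    ring
  have e2 : (z ^ 2 / 4 / s) ^ (-ν - 1) = z ^ (-ν - ν) * (2 : ℝ) ^ (2 * ν) * s ^ (ν - 1)
      * (4 * s ^ 2 / z ^ 2) := by
    have : z ^ 2 / 4 / s = (z / 2) ^ (2 : ℝ) / s := by
      rw [Real.rpow_two]; ring
    rw [this, Real.div_rpow (by positivity) hs.le, ← Real.rpow_mul (by positivity),
      Real.div_rpow hz.le (by norm_num)]
    rw [show 2 * (-ν - 1) = (-ν - ν) - (2 : ℕ) by push_cast; ring,
      show -ν - 1 = -(ν - 1) - (2 : ℕ) by push_cast; ring, Real.rpow_sub_natCast hz.ne',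
      Real.rpow_sub_natCast (by norm_num), Real.rpow_sub_natCast hs.ne', Real.rpow_neg hs.le,
      show -ν - ν = -(2 * ν) by ring, Real.rpow_neg (by norm_num : (0 : ℝ) ≤ 2)]
    have : (2 : ℝ) ^ (2 * ν) ≠ 0 := by positivity
    have : s ^ (ν - 1) ≠ 0 := by positivity
    field_simp
    norm_num
  rw [e1, e2, Real.div_rpow hz.le (by norm_num), Real.rpow_sub hz, Real.rpow_neg hz.le,
    Real.rpow_sub_one (two_ne_zero : (2 : ℝ) ≠ 0), show 2 * ν = ν + ν by ring,
    Real.rpow_add (by norm_num)]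
  have : (2 : ℝ) ^ ν ≠ 0 := by positivity
  have : z ^ ν ≠ 0 := by positivity
  field_simp

theorem integrableOn_besselV {ν : ℝ} (hν : 0 < ν) (z : ℝ) :
    IntegrableOn (fun s => Real.exp (-(s + z ^ 2 / (4 * s))) * s ^ (ν - 1)) (Set.Ioi 0) := by
  refine (Real.GammaIntegral_convergent hν).mono' ?_ ?_
  · exact (Measurable.aestronglyMeasurable (by fun_prop))
  · refine (ae_restrict_iff' measurableSet_Ioi).2 (Filter.Eventually.of_forall fun s hs => ?_)
    have hs : 0 < s := hs
    rw [Real.norm_of_nonneg (by positivity)]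
    gcongr
    have : 0 ≤ z ^ 2 / (4 * s) := by positivity
    linarith

theorem integrableOn_besselV_sub_one {ν z : ℝ} (hν : 0 < ν) (hz : 0 < z) :
    IntegrableOn (fun s => Real.exp (-(s + z ^ 2 / (4 * s))) * s ^ (ν - 2)) (Set.Ioi 0) := by
  refine ((Real.GammaIntegral_convergent hν).const_mul (4 / z ^ 2)).mono' ?_ ?_
  · exact (Measurable.aestronglyMeasurable (by fun_prop))
  · refine (ae_restrict_iff' measurableSet_Ioi).2 (Filter.Eventually.of_forall fun s hs => ?_)
    have hs : 0 < s := hs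
    rw [Real.norm_of_nonneg (by positivity), neg_add, Real.exp_add,
      show ν - 2 = (ν - 1) - (1 : ℕ) by push_cast; ring, Real.rpow_sub_natCast hs.ne', pow_one]
    have h : Real.exp (-(z ^ 2 / (4 * s))) ≤ 4 * s / z ^ 2 := by
      rw [Real.exp_neg]
      have h1 := Real.add_one_le_exp (z ^ 2 / (4 * s))
      have h2 : 0 < z ^ 2 / (4 * s) := by positivity
      calc (Real.exp (z ^ 2 / (4 * s)))⁻¹ ≤ (z ^ 2 / (4 * s))⁻¹ := by gcongr; linarith
        _ = 4 * s / z ^ 2 := by rw [inv_div]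
    calc Real.exp (-s) * Real.exp (-(z ^ 2 / (4 * s))) * (s ^ (ν - 1) / s)
        ≤ Real.exp (-s) * (4 * s / z ^ 2) * (s ^ (ν - 1) / s) := by gcongr
      _ = 4 / z ^ 2 * (Real.exp (-s) * s ^ (ν - 1)) := by field_simp

theorem besselV_pos {ν : ℝ} (hν : 0 < ν) (z : ℝ) : 0 < besselV ν z := by
  refine (setIntegral_pos_iff_support_of_nonneg_ae ?_ (integrableOn_besselV hν z)).2 ?_
  · refine (ae_restrict_iff' measurableSet_Ioi).2 (Filter.Eventually.of_forall fun s hs => ?_)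
    have hs : 0 < s := hs
    simp only [Pi.zero_apply]; positivity
  · rw [Set.inter_eq_right.2 fun s hs => ?_, Real.volume_Ioi]
    · simp
    · have hs : 0 < s := hs
      rw [Function.mem_support]; positivity

theorem continuous_besselV {ν : ℝ} (hν : 0 < ν) : Continuous (besselV ν) := by
  refine continuous_of_dominated (fun z => (integrableOn_besselV hν z).aestronglyMeasurable)
    (bound := fun s => Real.exp (-s) * s ^ (ν - 1)) (fun z => ?_)
    (Real.GammaIntegral_convergent hν) (Filter.Eventually.of_forall fun s => by fun_prop)
  refine (ae_restrict_iff' measurableSet_Ioi).2 (Filter.Eventually.of_forall fun s hs => ?_)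
  have hs : 0 < s := hs
  rw [Real.norm_of_nonneg (by positivity)]
  gcongr
  have : 0 ≤ z ^ 2 / (4 * s) := by positivity
  linarith

theorem besselV_antitoneOn {ν : ℝ} (hν : 0 < ν) : AntitoneOn (besselV ν) (Set.Ici 0) := by
  intro y hy z hz hyz
  have hy : 0 ≤ y := hy
  refine setIntegral_mono_on (integrableOn_besselV hν z) (integrableOn_besselV hν y)
    measurableSet_Ioi fun s hs => ?_
  have hs : 0 < s := hs
  gcongr

/-- Under the measure `exp(-(s + c²/s)) ds/s`, which is invariant under `s ↦ c²/s`, the integral of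
`s^ν (1 - c/s)` is nonnegative: add it to its image under this involution. This is the
inequality `K_{ν-1} ≤ K_ν`. -/
theorem besselV_sub_one_le {ν z : ℝ} (hν : 1 / 2 ≤ ν) (hz : 0 < z) :
    z / 2 * ∫ s in Set.Ioi (0 : ℝ), Real.exp (-(s + z ^ 2 / (4 * s))) * s ^ (ν - 2)
      ≤ besselV ν z := by
  have hν0 : 0 < ν := by linarith
  have hb : 0 < z ^ 2 / 4 := by positivity
  have i1 := integrableOn_besselV hν0 z
  have i2 := integrableOn_besselV_sub_one hν0 hz
  set F : ℝ → ℝ := fun s => Real.exp (-(s + z ^ 2 / (4 * s))) * s ^ (ν - 1) -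
    z / 2 * (Real.exp (-(s + z ^ 2 / (4 * s))) * s ^ (ν - 2)) with hF
  have iF : IntegrableOn F (Set.Ioi 0) := i1.sub (i2.const_mul _)
  have hint : ∫ s in Set.Ioi (0 : ℝ), F s = besselV ν z -
      z / 2 * ∫ s in Set.Ioi (0 : ℝ), Real.exp (-(s + z ^ 2 / (4 * s))) * s ^ (ν - 2) := by
    rw [hF, integral_sub i1 (i2.const_mul _), integral_const_mul, besselV]
  have hsum : 0 ≤ ∫ s in Set.Ioi (0 : ℝ), (F s + z ^ 2 / 4 / s ^ 2 * F (z ^ 2 / 4 / s)) := by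
    refine setIntegral_nonneg measurableSet_Ioi fun s hs => ?_
    have hs : 0 < s := hs
    set c := z / 2 with hc
    have hc0 : 0 < c := by positivity
    have hzc : z = 2 * c := by rw [hc]; ring
    have e1 : z ^ 2 / 4 / s + z ^ 2 / (4 * (z ^ 2 / 4 / s)) = s + z ^ 2 / (4 * s) := by
      field_simp
      ring
    have e0 : z ^ 2 / 4 / s = c ^ 2 / s := by rw [hzc]; ring
    have p1 : s ^ (ν - 1) = s ^ (ν - 2) * s := by
      rw [show ν - 1 = (ν - 2) + (1 : ℕ) by push_cast; ring, Real.rpow_add_natCast hs.ne', pow_one]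
    have p2 : (c ^ 2 / s) ^ (ν - 1) = (c ^ 2 / s) ^ (ν - 2) * (c ^ 2 / s) := by
      rw [show ν - 1 = (ν - 2) + (1 : ℕ) by push_cast; ring,
        Real.rpow_add_natCast (by positivity), pow_one]
    have e3 : F s + z ^ 2 / 4 / s ^ 2 * F (z ^ 2 / 4 / s) =
        Real.exp (-(s + z ^ 2 / (4 * s))) * ((s - c) *
          (s ^ (ν - 2) - (c / s) ^ 3 * (c ^ 2 / s) ^ (ν - 2))) := by
      simp only [hF]
      rw [e1, e0, p1, p2]
      rw [show z ^ 2 / 4 / s ^ 2 = c ^ 2 / s ^ 2 by rw [hzc]; ring]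
      field_simp
      ring
    have e4 : s ^ (ν - 2) - (c / s) ^ 3 * (c ^ 2 / s) ^ (ν - 2) =
        s ^ (-ν - 1) * (s ^ (2 * ν - 1) - c ^ (2 * ν - 1)) := by
      rw [Real.div_rpow (by positivity) hs.le, ← Real.rpow_natCast c 2,
        ← Real.rpow_mul hc0.le, mul_sub (s ^ (-ν - 1)), ← Real.rpow_add hs (-ν - 1)]
      congr 1
      · congr 1; ring
      · rw [show 2 * ν - 1 = ((2 : ℕ) : ℝ) * (ν - 2) + (3 : ℕ) by push_cast; ring,
          Real.rpow_add_natCast hc0.ne', show -ν - 1 = -(ν - 2) - (3 : ℕ) by push_cast; ring,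
          Real.rpow_sub_natCast hs.ne', Real.rpow_neg hs.le]
        have : s ^ (ν - 2) ≠ 0 := by positivity
        field_simp
    rw [e3, e4]
    refine mul_nonneg (Real.exp_pos _).le ?_
    have hk : 0 ≤ 2 * ν - 1 := by linarith
    rcases le_total c s with h | h
    · exact mul_nonneg (by linarith) (mul_nonneg (by positivity)
        (sub_nonneg.2 (Real.rpow_le_rpow hc0.le h hk)))
    · exact mul_nonneg_of_nonpos_of_nonpos (by linarith) (mul_nonpos_of_nonneg_of_nonpos
        (by positivity) (sub_nonpos.2 (Real.rpow_le_rpow hs.le h hk)))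
  rw [integral_add iF (integrableOn_Ioi_comp_div F hb iF), integral_Ioi_comp_div F hb, hint] at hsum
  linarith

/-- The formula `V_ν'(z) = -(z/2) V_{ν-1}(z)`; the integral on the right-hand side converges for
all `ν` because `z > 0`. -/
theorem hasDerivAt_besselV {ν z : ℝ} (hν : 0 < ν) (hz : 0 < z) :
    HasDerivAt (besselV ν) (-(z / 2 * ∫ s in Set.Ioi (0 : ℝ),
      Real.exp (-(s + z ^ 2 / (4 * s))) * s ^ (ν - 2))) z := by
  have key := (hasDerivAt_integral_of_dominated_loc_of_deriv_le (𝕜 := ℝ)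
    (μ := volume.restrict (Set.Ioi (0 : ℝ)))
    (F := fun z s => Real.exp (-(s + z ^ 2 / (4 * s))) * s ^ (ν - 1))
    (F' := fun z s => -(z / 2) * (Real.exp (-(s + z ^ 2 / (4 * s))) * s ^ (ν - 2)))
    (x₀ := z) (s := Set.Ioo (z / 2) (2 * z))
    (bound := fun s => z * (Real.exp (-(s + (z / 2) ^ 2 / (4 * s))) * s ^ (ν - 2)))
    (Ioo_mem_nhds (by linarith) (by linarith))
    (Filter.Eventually.of_forall fun y => (integrableOn_besselV hν y).aestronglyMeasurable)
    (integrableOn_besselV hν z)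
    ((integrableOn_besselV_sub_one hν hz).const_mul _).aestronglyMeasurable
    ?_ ((integrableOn_besselV_sub_one hν (by positivity)).const_mul z) ?_).2
  · refine key.congr_deriv ?_
    rw [integral_const_mul, neg_mul]
  · refine (ae_restrict_iff' measurableSet_Ioi).2 (Filter.Eventually.of_forall fun s hs y hy => ?_)
    have hs : 0 < s := hs
    have hy0 : 0 < y := lt_trans (by positivity) hy.1
    rw [norm_mul, norm_neg, Real.norm_of_nonneg (by positivity), Real.norm_of_nonneg (by positivity)]
    gcongr
    · linarith [hy.2]
    · exact hy.1.le
  · refine (ae_restrict_iff' measurableSet_Ioi).2 (Filter.Eventually.of_forall fun s hs y _ => ?_)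
    have hs : 0 < s := hs
    have h1 : HasDerivAt (fun y : ℝ => -(s + y ^ 2 / (4 * s))) (-(2 * y / (4 * s))) y := by
      have := (((hasDerivAt_pow 2 y).div_const (4 * s)).const_add s).neg
      exact this.congr_deriv (by simp)
    refine (h1.exp.mul_const (s ^ (ν - 1))).congr_deriv ?_
    rw [show ν - 2 = (ν - 1) - (1 : ℕ) by push_cast; ring, Real.rpow_sub_natCast hs.ne', pow_one]
    field_simp
    ring

/-- The function `e^z V_ν(z)` is increasing, since its derivative is `e^z` times the difference in
`besselV_sub_one_le`. -/
theorem besselV_le_exp_mul {ν y z : ℝ} (hν : 1 / 2 ≤ ν) (hy : 0 ≤ y) (hyz : y ≤ z) :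
    besselV ν y ≤ Real.exp (z - y) * besselV ν z := by
  have hν0 : 0 < ν := by linarith
  have hd : ∀ x, 0 < x → HasDerivAt (fun x => Real.exp x * besselV ν x)
      (Real.exp x * besselV ν x + Real.exp x * (-(x / 2 * ∫ s in Set.Ioi (0 : ℝ),
      Real.exp (-(s + x ^ 2 / (4 * s))) * s ^ (ν - 2)))) x := fun x hx =>
    (Real.hasDerivAt_exp x).mul (hasDerivAt_besselV hν0 hx)
  have hm : MonotoneOn (fun x => Real.exp x * besselV ν x) (Set.Ici 0) := by
    refine monotoneOn_of_deriv_nonneg (convex_Ici 0)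
      (Real.continuous_exp.mul (continuous_besselV hν0)).continuousOn ?_ ?_
    · rw [interior_Ici]
      exact fun x hx => (hd x hx).differentiableAt.differentiableWithinAt
    · rw [interior_Ici]
      intro x hx
      rw [(hd x hx).deriv, ← mul_add]
      exact mul_nonneg (Real.exp_pos _).le (by linarith [besselV_sub_one_le hν hx])
  have := hm (Set.mem_Ici.2 hy) (Set.mem_Ici.2 (hy.trans hyz)) hyz
  simp only at this
  rw [Real.exp_sub, div_mul_eq_mul_div, le_div_iff₀ (Real.exp_pos _)]
  linarith

theorem besselV_le_exp_abs_mul {ν y z : ℝ} (hν : 1 / 2 ≤ ν) (hy : 0 ≤ y) (hz : 0 ≤ z) :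
    besselV ν y ≤ Real.exp |y - z| * besselV ν z := by
  have hν0 : 0 < ν := by linarith
  rcases le_total y z with h | h
  · rw [abs_sub_comm, abs_of_nonneg (sub_nonneg.2 h)]
    exact besselV_le_exp_mul hν hy h
  · calc besselV ν y ≤ besselV ν z := besselV_antitoneOn hν0 hz hy h
      _ ≤ Real.exp |y - z| * besselV ν z := le_mul_of_one_le_left (besselV_pos hν0 z).le
        (Real.one_le_exp (abs_nonneg _))

/-- Since `(1 - δ) s + z²/(4s) ≥ √(1 - δ) z`, the function `V_ν` decays faster than
`exp (-θ z)` for every `θ < 1`. -/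
theorem exists_besselV_le {ν θ : ℝ} (hν : 0 < ν) (hθ0 : 0 ≤ θ) (hθ : θ < 1) :
    ∃ C, 0 < C ∧ ∀ z, besselV ν z ≤ C * Real.exp (-(θ * z)) := by
  have hδ : 0 < 1 - θ ^ 2 := by nlinarith
  have hi : IntegrableOn (fun s => Real.exp (-((1 - θ ^ 2) * s)) * s ^ (ν - 1)) (Set.Ioi 0) := by
    have := (integrableOn_Ioi_comp_mul_left_iff (fun x => Real.exp (-x) * x ^ (ν - 1)) 0 hδ).2
      (by simpa using Real.GammaIntegral_convergent hν)
    refine IntegrableOn.congr_fun (this.const_mul ((1 - θ ^ 2) ^ (-(ν - 1)))) (fun s hs => ?_)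
      measurableSet_Ioi
    have hs : 0 < s := hs
    rw [Real.mul_rpow hδ.le hs.le, Real.rpow_neg hδ.le]
    field_simp
  have hnn : 0 ≤ ∫ s in Set.Ioi (0 : ℝ), Real.exp (-((1 - θ ^ 2) * s)) * s ^ (ν - 1) :=
    setIntegral_nonneg measurableSet_Ioi fun s hs => by
      have hs : 0 < s := hs
      positivity
  refine ⟨(∫ s in Set.Ioi (0 : ℝ), Real.exp (-((1 - θ ^ 2) * s)) * s ^ (ν - 1)) + 1,
    by linarith, fun z => ?_⟩
  have h1 : besselV ν z ≤ (∫ s in Set.Ioi (0 : ℝ), Real.exp (-((1 - θ ^ 2) * s)) * s ^ (ν - 1))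
      * Real.exp (-(θ * z)) := by
    rw [← integral_mul_const]
    refine setIntegral_mono_on (integrableOn_besselV hν z) (hi.mul_const _)
      measurableSet_Ioi fun s hs => ?_
    have hs : 0 < s := hs
    rw [mul_right_comm, ← Real.exp_add]
    gcongr
    have : θ ^ 2 * s + z ^ 2 / (4 * s) - θ * z = (2 * θ * s - z) ^ 2 / (4 * s) := by
      field_simp
      ring
    have h2 : 0 ≤ (2 * θ * s - z) ^ 2 / (4 * s) := by positivity
    linarith
  exact h1.trans (by gcongr; linarith)

/-- The exact order of decay of `V_ν`, as a lower bound. For `z ≥ 1` and `ν ≥ 1` it is enough to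
integrate over `z/2 ≤ s ≤ z/2 + √z`, where the exponent `-(s + z²/(4s))` is at least `-z - 2`. -/
theorem exists_le_besselV {ν : ℝ} (hν : ν = 1 / 2 ∨ 1 ≤ ν) :
    ∃ C, 0 < C ∧ ∀ z, 0 ≤ z → C * ((1 + z) ^ (ν - 1 / 2) * Real.exp (-z)) ≤ besselV ν z := by
  rcases hν with rfl | hν
  -- For `ν = 1/2` the claim is just that `e^z V_ν(z)` is increasing.
  · refine ⟨besselV (1 / 2) 0, besselV_pos (by norm_num) 0, fun z hz => ?_⟩
    have := besselV_le_exp_mul (ν := 1 / 2) le_rfl le_rfl hz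
    rw [sub_self, Real.rpow_zero, one_mul, Real.exp_neg, ← div_eq_mul_inv,
      div_le_iff₀ (Real.exp_pos _)]
    simpa [mul_comm] using this
  have hν0 : 0 < ν := by linarith
  have h1 : ∀ z : ℝ, 1 ≤ z →
      Real.exp (-2) * (Real.exp (-z) * (√z * (z / 2) ^ (ν - 1))) ≤ besselV ν z := by
    intro z hz
    have hz0 : 0 < z := by linarith
    have hsub : Set.Icc (z / 2) (z / 2 + √z) ⊆ Set.Ioi 0 := fun s hs => lt_of_lt_of_le
      (by positivity) hs.1
    calc Real.exp (-2) * (Real.exp (-z) * (√z * (z / 2) ^ (ν - 1)))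
        = ∫ s in Set.Icc (z / 2) (z / 2 + √z), Real.exp (-2) * Real.exp (-z) *
            (z / 2) ^ (ν - 1) := by
          rw [setIntegral_const]
          simp only [Real.volume_real_Icc, add_sub_cancel_left, smul_eq_mul,
            max_eq_left (Real.sqrt_nonneg z)]
          ring
      _ ≤ ∫ s in Set.Icc (z / 2) (z / 2 + √z),
            Real.exp (-(s + z ^ 2 / (4 * s))) * s ^ (ν - 1) := by
          refine setIntegral_mono_on (integrableOn_const (by simp))
            ((integrableOn_besselV hν0 z).mono_set hsub) measurableSet_Icc fun s hs => ?_
          have hs0 : 0 < s := hsub hs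
          have h3 : (s - z / 2) ^ 2 ≤ z := by
            calc (s - z / 2) ^ 2 ≤ √z ^ 2 := by
                  gcongr
                  · linarith [hs.1]
                  · linarith [hs.2]
              _ = z := Real.sq_sqrt hz0.le
          rw [← Real.exp_add]
          gcongr ?_ * ?_
          · refine Real.exp_le_exp.2 ?_
            -- The exponent has its maximum at `s = z/2`.
            have e : s + z ^ 2 / (4 * s) = z + (s - z / 2) ^ 2 / s := by
              field_simp
              ring
            have h4 : (s - z / 2) ^ 2 / s ≤ 2 := by
              rw [div_le_iff₀ hs0]; linarith [hs.1]
            linarith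
          · exact Real.rpow_le_rpow (by positivity) hs.1 (by linarith)
      _ ≤ besselV ν z := by
          refine setIntegral_mono_set (integrableOn_besselV hν0 z) ?_ hsub.eventuallyLE
          refine (ae_restrict_iff' measurableSet_Ioi).2 (Filter.Eventually.of_forall fun s hs => ?_)
          have hs : 0 < s := hs
          simp only [Pi.zero_apply]; positivity
  have hC : ∀ z : ℝ, 1 ≤ z → Real.exp (-2) * (4 ^ (-(ν - 1 / 2)) *
      ((1 + z) ^ (ν - 1 / 2) * Real.exp (-z))) ≤ besselV ν z := by
    intro z hz
    have hz0 : 0 < z := by linarith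
    refine le_trans ?_ (h1 z hz)
    have : (4 : ℝ) ^ (-(ν - 1 / 2)) * (1 + z) ^ (ν - 1 / 2) ≤ √z * (z / 2) ^ (ν - 1) := by
      calc (4 : ℝ) ^ (-(ν - 1 / 2)) * (1 + z) ^ (ν - 1 / 2) = ((1 + z) / 4) ^ (ν - 1 / 2) := by
            rw [Real.div_rpow (by positivity) (by norm_num), Real.rpow_neg (by norm_num)]
            field_simp
        _ ≤ (z / 2) ^ (ν - 1 / 2) := by
            refine Real.rpow_le_rpow (by positivity) (by linarith) (by linarith)
        _ = √(z / 2) * (z / 2) ^ (ν - 1) := by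
            rw [Real.sqrt_eq_rpow, ← Real.rpow_add (by positivity)]
            congr 1; ring
        _ ≤ √z * (z / 2) ^ (ν - 1) := by
            gcongr; linarith
    calc _ = Real.exp (-2) * (Real.exp (-z) * ((4 : ℝ) ^ (-(ν - 1 / 2)) * (1 + z) ^ (ν - 1 / 2))) := by
          ring
      _ ≤ _ := by gcongr
  have hV1 := besselV_pos hν0 1
  refine ⟨min (Real.exp (-2) * 4 ^ (-(ν - 1 / 2))) (besselV ν 1 * 2 ^ (-(ν - 1 / 2))),
    by positivity, fun z hz => ?_⟩
  rcases le_total 1 z with h | h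
  · refine le_trans ?_ (hC z h)
    rw [← mul_assoc (Real.exp (-2))]
    exact mul_le_mul_of_nonneg_right (min_le_left _ _) (by positivity)
  · refine le_trans ?_ (besselV_antitoneOn hν0 hz (Set.mem_Ici.2 (zero_le_one' ℝ)) h)
    calc _ ≤ besselV ν 1 * 2 ^ (-(ν - 1 / 2)) * (2 ^ (ν - 1 / 2) * 1) := by
          gcongr
          · exact min_le_right _ _
          · linarith
          · linarith
          · exact Real.exp_le_one_iff.2 (by linarith)
      _ = besselV ν 1 := by
          rw [Real.rpow_neg (by norm_num)]
          have : (2 : ℝ) ^ (ν - 1 / 2) ≠ 0 := by positivity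
          field_simp

/-! ### Weights of moderate growth -/

/-- A continuous positive weight that varies at most by the factor `exp (κ |x - y|)` between two
points `x` and `y`. -/
structure IsModerateWeight {n : ℕ} (W : EuclideanSpace ℝ (Fin n) → ℝ) (κ : ℝ) : Prop where
  continuous : Continuous W
  pos : ∀ x, 0 < W x
  le : ∀ x y, W x ≤ Real.exp (κ * ‖x - y‖) * W y

/-- The function `K̃_{n/2}(ρ|x|)`, extended continuously to `x = 0`. -/
noncomputable def besselBase (n : ℕ) (ρ : ℝ) (x : EuclideanSpace ℝ (Fin n)) : ℝ :=
  2 ^ ((n : ℝ) / 2 - 1) * besselV ((n : ℝ) / 2) (ρ * ‖x‖)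

/-- The density of `weightedMeasure n ρ p`, with its continuous value at `x = 0`. -/
noncomputable def besselWeight (n : ℕ) (ρ : ℝ) (p : ℝ≥0∞) (x : EuclideanSpace ℝ (Fin n)) : ℝ :=
  besselBase n ρ x ^ (gammaExp p * p.toReal)

theorem gammaExp_nonneg (p : ℝ≥0∞) : 0 ≤ gammaExp p := abs_nonneg _

section

variable {n : ℕ} {ρ : ℝ}

theorem besselBase_pos (hn : 1 ≤ n) (x : EuclideanSpace ℝ (Fin n)) : 0 < besselBase n ρ x :=
  mul_pos (by positivity) (besselV_pos (by positivity) _)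

theorem continuous_besselBase (hn : 1 ≤ n) : Continuous (besselBase n ρ) :=
  ((continuous_besselV (by positivity)).comp (by fun_prop)).const_mul _

theorem besselBase_le (hn : 1 ≤ n) (hρ : 0 < ρ) (x y : EuclideanSpace ℝ (Fin n)) :
    besselBase n ρ x ≤ Real.exp (ρ * ‖x - y‖) * besselBase n ρ y := by
  have hν : (1 : ℝ) / 2 ≤ n / 2 := by
    have : (1 : ℝ) ≤ n := by exact_mod_cast hn
    linarith
  have hV := besselV_le_exp_abs_mul hν (y := ρ * ‖x‖) (z := ρ * ‖y‖) (by positivity) (by positivity)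
  have hV0 := besselV_pos (ν := (n : ℝ) / 2) (by linarith) (ρ * ‖y‖)
  have h1 : |ρ * ‖x‖ - ρ * ‖y‖| ≤ ρ * ‖x - y‖ := by
    rw [← mul_sub, abs_mul, abs_of_pos hρ]
    gcongr
    exact abs_norm_sub_norm_le x y
  unfold besselBase
  calc _ ≤ (2 : ℝ) ^ ((n : ℝ) / 2 - 1) *
        (Real.exp (ρ * ‖x - y‖) * besselV ((n : ℝ) / 2) (ρ * ‖y‖)) := by
        gcongr
        exact hV.trans (by gcongr)
    _ = _ := by ring

theorem isModerateWeight_besselWeight (hn : 1 ≤ n) (hρ : 0 < ρ) (p : ℝ≥0∞) :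
    IsModerateWeight (besselWeight n ρ p) (ρ * (gammaExp p * p.toReal)) where
  continuous := (continuous_besselBase hn).rpow_const fun x => Or.inl (besselBase_pos hn x).ne'
  pos x := Real.rpow_pos_of_pos (besselBase_pos hn x) _
  le x y := by
    have h0 : 0 ≤ gammaExp p * p.toReal := mul_nonneg (gammaExp_nonneg p) ENNReal.toReal_nonneg
    unfold besselWeight
    calc _ ≤ (Real.exp (ρ * ‖x - y‖) * besselBase n ρ y) ^ (gammaExp p * p.toReal) :=
          Real.rpow_le_rpow (besselBase_pos hn x).le (besselBase_le hn hρ x y) h0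
      _ = _ := by
          rw [Real.mul_rpow (Real.exp_pos _).le (besselBase_pos hn y).le, ← Real.exp_mul]
          congr 2; ring

theorem weightedMeasure_eq (hn : 1 ≤ n) (hρ : 0 < ρ) (p : ℝ≥0∞) :
    weightedMeasure n ρ p = volume.withDensity fun x => ENNReal.ofReal (besselWeight n ρ p x) := by
  have : Nonempty (Fin n) := ⟨⟨0, hn⟩⟩
  refine withDensity_congr_ae ?_
  have h0 : ∀ᵐ x : EuclideanSpace ℝ (Fin n), x ≠ 0 := by
    simp [ae_iff]
  filter_upwards [h0] with x hx
  have hx : 0 < ‖x‖ := norm_pos_iff.2 hx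
  rw [macdonaldKTilde_eq (mul_pos hρ hx), besselWeight, besselBase]

end

/-! ### The heat kernel -/

section

variable {n : ℕ} {s t : ℝ}

theorem heatKernel_pos (ht : 0 < t) (x : EuclideanSpace ℝ (Fin n)) : 0 < heatKernel n t x := by
  unfold heatKernel; positivity

theorem continuous_heatKernel (n : ℕ) (t : ℝ) : Continuous (heatKernel n t) := by
  unfold heatKernel; fun_prop

theorem heatKernel_neg (x : EuclideanSpace ℝ (Fin n)) : heatKernel n t (-x) = heatKernel n t x := by
  simp [heatKernel]

theorem heatKernel_sub_comm (x y : EuclideanSpace ℝ (Fin n)) :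
    heatKernel n t (x - y) = heatKernel n t (y - x) := by
  rw [← heatKernel_neg, neg_sub]

theorem heatKernel_le (ht : 0 < t) (x : EuclideanSpace ℝ (Fin n)) :
    heatKernel n t x ≤ (4 * Real.pi * t) ^ (-((n : ℝ) / 2)) := by
  unfold heatKernel
  refine mul_le_of_le_one_right (by positivity) (Real.exp_le_one_iff.2 ?_)
  have : 0 ≤ ‖x‖ ^ 2 / (4 * t) := by positivity
  linarith

theorem integral_heatKernel (ht : 0 < t) :
    ∫ x : EuclideanSpace ℝ (Fin n), heatKernel n t x = 1 := by
  have h := GaussianFourier.integral_rexp_neg_mul_sq_norm (V := EuclideanSpace ℝ (Fin n))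
    (b := 1 / (4 * t)) (by positivity)
  unfold heatKernel
  rw [integral_const_mul]
  have e : ∀ x : EuclideanSpace ℝ (Fin n), -(‖x‖ ^ 2 / (4 * t)) = -(1 / (4 * t)) * ‖x‖ ^ 2 := by
    intro x; ring
  simp_rw [e]
  rw [h, finrank_euclideanSpace_fin, Real.rpow_neg (by positivity),
    show Real.pi / (1 / (4 * t)) = 4 * Real.pi * t by field_simp]
  exact inv_mul_cancel₀ (by positivity)

theorem integrable_heatKernel (ht : 0 < t) : Integrable (heatKernel n t) :=
  Integrable.of_integral_ne_zero (by rw [integral_heatKernel ht]; norm_num)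

theorem integrable_heatKernel_sub (ht : 0 < t) (x : EuclideanSpace ℝ (Fin n)) :
    Integrable fun y => heatKernel n t (x - y) :=
  (integrable_heatKernel ht).comp_sub_left x

theorem integral_heatKernel_sub (ht : 0 < t) (x : EuclideanSpace ℝ (Fin n)) :
    ∫ y, heatKernel n t (x - y) = 1 := by
  rw [integral_sub_left_eq_self (heatKernel n t), integral_heatKernel ht]

theorem lintegral_heatKernel_sub (ht : 0 < t) (x : EuclideanSpace ℝ (Fin n)) :
    ∫⁻ y, ENNReal.ofReal (heatKernel n t (x - y)) = 1 := by
  rw [← ofReal_integral_eq_lintegral_ofReal (integrable_heatKernel_sub ht x)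
    (Filter.Eventually.of_forall fun y => (heatKernel_pos ht _).le), integral_heatKernel_sub ht,
    ENNReal.ofReal_one]

theorem lintegral_heatKernel_sub' (ht : 0 < t) (y : EuclideanSpace ℝ (Fin n)) :
    ∫⁻ x, ENNReal.ofReal (heatKernel n t (x - y)) = 1 := by
  simp_rw [heatKernel_sub_comm _ y]
  exact lintegral_heatKernel_sub ht y

/-- Completing the square in a product of two Gaussians. -/
theorem heatKernel_mul_heatKernel (hs : 0 < s) (ht : 0 < t) (x y z : EuclideanSpace ℝ (Fin n)) :
    heatKernel n s (x - y) * heatKernel n t (y - z) =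
      heatKernel n (s + t) (x - z) *
        heatKernel n (s * t / (s + t)) ((s + t)⁻¹ • (t • x + s • z) - y) := by
  have hst : 0 < s + t := by linarith
  have hv : (s + t)⁻¹ • (t • x + s • z) - y = (s + t)⁻¹ • (t • (x - y) - s • (y - z)) := by
    have : y = (s + t)⁻¹ • ((s + t) • y) := by rw [smul_smul, inv_mul_cancel₀ hst.ne', one_smul]
    nth_rewrite 1 [this]
    rw [← smul_sub]
    congr 1
    module
  have hxz : x - z = (x - y) + (y - z) := by abel
  rw [hv, hxz]
  generalize x - y = u
  generalize y - z = w
  unfold heatKernel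
  rw [mul_mul_mul_comm ((4 * Real.pi * s) ^ (-((n : ℝ) / 2))),
    mul_mul_mul_comm ((4 * Real.pi * (s + t)) ^ (-((n : ℝ) / 2))), ← Real.mul_rpow (by positivity) (by positivity),
    ← Real.mul_rpow (by positivity) (by positivity), ← Real.exp_add, ← Real.exp_add]
  congr 2
  · field_simp
  · rw [norm_smul, mul_pow, norm_inv, Real.norm_of_nonneg hst.le, norm_sub_sq_real,
      norm_add_sq_real, inner_smul_left, inner_smul_right, norm_smul, norm_smul, mul_pow, mul_pow,
      Real.norm_of_nonneg hs.le, Real.norm_of_nonneg ht.le]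
    simp only [conj_trivial]
    field_simp
    ring

theorem integral_heatKernel_mul_heatKernel (hs : 0 < s) (ht : 0 < t)
    (x z : EuclideanSpace ℝ (Fin n)) :
    ∫ y, heatKernel n s (x - y) * heatKernel n t (y - z) = heatKernel n (s + t) (x - z) := by
  simp_rw [heatKernel_mul_heatKernel hs ht]
  rw [integral_const_mul, integral_heatKernel_sub (by positivity), mul_one]

theorem lintegral_heatKernel_mul_heatKernel (hs : 0 < s) (ht : 0 < t)
    (x z : EuclideanSpace ℝ (Fin n)) :
    ∫⁻ y, ENNReal.ofReal (heatKernel n s (x - y)) * ENNReal.ofReal (heatKernel n t (y - z)) =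
      ENNReal.ofReal (heatKernel n (s + t) (x - z)) := by
  have h : ∀ y, ENNReal.ofReal (heatKernel n s (x - y)) * ENNReal.ofReal (heatKernel n t (y - z)) =
      ENNReal.ofReal (heatKernel n (s + t) (x - z)) * ENNReal.ofReal
        (heatKernel n (s * t / (s + t)) ((s + t)⁻¹ • (t • x + s • z) - y)) := fun y => by
    rw [← ENNReal.ofReal_mul (heatKernel_pos hs _).le, heatKernel_mul_heatKernel hs ht,
      ENNReal.ofReal_mul (heatKernel_pos (by positivity) _).le]
  simp_rw [h]
  rw [lintegral_const_mul _ (by have := continuous_heatKernel n (s * t / (s + t)); fun_prop),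
    lintegral_heatKernel_sub (by positivity), mul_one]

/-- A bound on the norm of the heat operator at time `t` for a weight of growth rate `κ`. -/
noncomputable def heatBound (n : ℕ) (κ t : ℝ) : ℝ := 2 ^ ((n : ℝ) / 2) * Real.exp (2 * κ ^ 2 * t)

theorem one_le_heatBound (n : ℕ) (κ : ℝ) (ht : 0 ≤ t) : 1 ≤ heatBound n κ t :=
  one_le_mul_of_one_le_of_one_le (Real.one_le_rpow (by norm_num) (by positivity))
    (Real.one_le_exp (by positivity))

theorem heatKernel_two_mul (ht : 0 < t) (x : EuclideanSpace ℝ (Fin n)) :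
    2 ^ ((n : ℝ) / 2) * heatKernel n (2 * t) x =
      (4 * Real.pi * t) ^ (-((n : ℝ) / 2)) * Real.exp (-(‖x‖ ^ 2 / (8 * t))) := by
  unfold heatKernel
  rw [show 4 * Real.pi * (2 * t) = 2 * (4 * Real.pi * t) by ring,
    Real.mul_rpow (by norm_num) (by positivity), Real.rpow_neg (by norm_num : (0 : ℝ) ≤ 2),
    show 4 * (2 * t) = 8 * t by ring]
  have : (2 : ℝ) ^ ((n : ℝ) / 2) ≠ 0 := by positivity
  field_simp

/-- An exponential factor is absorbed by doubling the time. -/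
theorem exp_mul_heatKernel_le (κ : ℝ) (ht : 0 < t) (x : EuclideanSpace ℝ (Fin n)) :
    Real.exp (κ * ‖x‖) * heatKernel n t x ≤ heatBound n κ t * heatKernel n (2 * t) x := by
  unfold heatBound
  rw [mul_right_comm, heatKernel_two_mul ht]
  unfold heatKernel
  rw [mul_left_comm, mul_assoc ((4 * Real.pi * t) ^ (-((n : ℝ) / 2))), ← Real.exp_add, ← Real.exp_add]
  refine mul_le_mul_of_nonneg_left (Real.exp_le_exp.2 ?_) (by positivity)
  have : 0 ≤ (‖x‖ - 4 * κ * t) ^ 2 / (8 * t) := by positivity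
  have e : (‖x‖ - 4 * κ * t) ^ 2 / (8 * t) =
    ‖x‖ ^ 2 / (4 * t) - ‖x‖ ^ 2 / (8 * t) - κ * ‖x‖ + 2 * κ ^ 2 * t := by field_simp; ring
  linarith

/-- The kernels `h_t(x - ·)` with `x` near `x'` are dominated by a multiple of `h_{2t}(x' - ·)`. -/
theorem heatKernel_sub_le (ht : 0 < t) (x x' y : EuclideanSpace ℝ (Fin n)) :
    heatKernel n t (x - y) ≤
      2 ^ ((n : ℝ) / 2) * Real.exp (‖x - x'‖ ^ 2 / (4 * t)) * heatKernel n (2 * t) (x' - y) := by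
  rw [mul_right_comm, heatKernel_two_mul ht]
  unfold heatKernel
  rw [mul_assoc ((4 * Real.pi * t) ^ (-((n : ℝ) / 2))), ← Real.exp_add]
  gcongr
  have h1 : ‖x' - y‖ ≤ ‖x - y‖ + ‖x - x'‖ := by
    calc ‖x' - y‖ = ‖(x - y) - (x - x')‖ := by congr 1; abel
      _ ≤ _ := norm_sub_le _ _
  have h2 : ‖x' - y‖ ^ 2 ≤ 2 * ‖x - y‖ ^ 2 + 2 * ‖x - x'‖ ^ 2 := by
    nlinarith [norm_nonneg (x' - y), sq_nonneg (‖x - y‖ - ‖x - x'‖)]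
  have h3 : ‖x' - y‖ ^ 2 / (8 * t) ≤ (2 * ‖x - y‖ ^ 2 + 2 * ‖x - x'‖ ^ 2) / (8 * t) := by gcongr
  have e : (2 * ‖x - y‖ ^ 2 + 2 * ‖x - x'‖ ^ 2) / (8 * t) =
    ‖x - y‖ ^ 2 / (4 * t) + ‖x - x'‖ ^ 2 / (4 * t) := by field_simp; ring
  linarith

end

/-! ### The heat operators on weighted Lebesgue spaces -/

/-- The measure `W dx` on `ℝⁿ`. -/
noncomputable def weightMeasure {n : ℕ} (W : EuclideanSpace ℝ (Fin n) → ℝ) :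
    Measure (EuclideanSpace ℝ (Fin n)) :=
  volume.withDensity fun x => ENNReal.ofReal (W x)

/-- The convolution `h_t * f`. -/
noncomputable def heatConv (n : ℕ) (t : ℝ) (f : EuclideanSpace ℝ (Fin n) → ℂ)
    (x : EuclideanSpace ℝ (Fin n)) : ℂ :=
  ∫ y, (heatKernel n t (x - y) : ℂ) * f y

section

variable {n : ℕ} {W : EuclideanSpace ℝ (Fin n) → ℝ} {κ : ℝ} {s t : ℝ} {p : ℝ≥0∞}

theorem weightMeasure_ac : weightMeasure W ≪ volume := withDensity_absolutelyContinuous _ _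

theorem IsModerateWeight.ac (hW : IsModerateWeight W κ) : volume ≪ weightMeasure W := by
  refine withDensity_absolutelyContinuous' hW.continuous.measurable.ennreal_ofReal.aemeasurable
    (Filter.Eventually.of_forall fun x => ?_)
  simpa using hW.pos x

theorem IsModerateWeight.lintegral (hW : IsModerateWeight W κ)
    (g : EuclideanSpace ℝ (Fin n) → ℝ≥0∞) :
    ∫⁻ x, g x ∂weightMeasure W = ∫⁻ x, ENNReal.ofReal (W x) * g x :=
  lintegral_withDensity_eq_lintegral_mul_non_measurable _
    hW.continuous.measurable.ennreal_ofReal (Filter.Eventually.of_forall fun x => by simp) g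

theorem measurable_ofReal_heatKernel (n : ℕ) (t : ℝ) :
    Measurable fun x : EuclideanSpace ℝ (Fin n) => ENNReal.ofReal (heatKernel n t x) :=
  (continuous_heatKernel n t).measurable.ennreal_ofReal

theorem enorm_heatKernel_mul (ht : 0 < t) (x : EuclideanSpace ℝ (Fin n)) (z : ℂ) :
    ‖(heatKernel n t x : ℂ) * z‖ₑ = ENNReal.ofReal (heatKernel n t x) * ‖z‖ₑ := by
  rw [enorm_mul, ← ofReal_norm, Complex.norm_of_nonneg (heatKernel_pos ht x).le]

theorem enorm_heatConv_le (ht : 0 < t) (f : EuclideanSpace ℝ (Fin n) → ℂ)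
    (x : EuclideanSpace ℝ (Fin n)) :
    ‖heatConv n t f x‖ₑ ≤ ∫⁻ y, ENNReal.ofReal (heatKernel n t (x - y)) * ‖f y‖ₑ := by
  refine (enorm_integral_le_lintegral_enorm _).trans_eq ?_
  simp_rw [enorm_heatKernel_mul ht]

/-- Jensen's inequality for the probability density `h_t(x - ·)`. -/
theorem lintegral_heatKernel_mul_rpow_le (ht : 0 < t) {q : ℝ} (hq : 1 ≤ q)
    {g : EuclideanSpace ℝ (Fin n) → ℝ≥0∞} (hg : AEMeasurable g) (x : EuclideanSpace ℝ (Fin n)) :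
    (∫⁻ y, ENNReal.ofReal (heatKernel n t (x - y)) * g y) ^ q ≤
      ∫⁻ y, ENNReal.ofReal (heatKernel n t (x - y)) * g y ^ q := by
  have hq0 : 0 < q := by linarith
  have hm : AEMeasurable (fun y => ENNReal.ofReal (heatKernel n t (x - y))) :=
    ((measurable_ofReal_heatKernel n t).comp (measurable_const.sub measurable_id)).aemeasurable
  have h := ENNReal.lintegral_mul_norm_pow_le (μ := volume) hm
    (hm.mul (hg.pow_const q)) (p := 1 - 1 / q) (q := 1 / q)
    (by rw [sub_nonneg, div_le_one hq0]; exact hq) (by positivity) (by ring)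
  rw [lintegral_heatKernel_sub ht, ENNReal.one_rpow, one_mul] at h
  have e : ∀ y, ENNReal.ofReal (heatKernel n t (x - y)) ^ (1 - 1 / q) *
      (ENNReal.ofReal (heatKernel n t (x - y)) * g y ^ q) ^ (1 / q) =
      ENNReal.ofReal (heatKernel n t (x - y)) * g y := by
    intro y
    have h0 : ENNReal.ofReal (heatKernel n t (x - y)) ≠ 0 := by
      simpa using heatKernel_pos ht (x - y)
    rw [ENNReal.mul_rpow_of_nonneg _ _ (by positivity), ← mul_assoc,
      ← ENNReal.rpow_add _ _ h0 ENNReal.ofReal_ne_top, ← ENNReal.rpow_mul, mul_one_div_cancel hq0.ne']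
    simp
  simp only [Pi.mul_apply] at h
  simp_rw [e] at h
  calc _ ≤ ((∫⁻ y, ENNReal.ofReal (heatKernel n t (x - y)) * g y ^ q) ^ (1 / q)) ^ q :=
        ENNReal.rpow_le_rpow h hq0.le
    _ = _ := by rw [← ENNReal.rpow_mul, one_div_mul_cancel hq0.ne', ENNReal.rpow_one]

theorem IsModerateWeight.heatKernel_mul_le (hW : IsModerateWeight W κ) (ht : 0 < t)
    (x y : EuclideanSpace ℝ (Fin n)) :
    heatKernel n t (x - y) * W x ≤ heatBound n κ t * heatKernel n (2 * t) (x - y) * W y := by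
  calc _ ≤ heatKernel n t (x - y) * (Real.exp (κ * ‖x - y‖) * W y) :=
        mul_le_mul_of_nonneg_left (hW.le x y) (heatKernel_pos ht _).le
    _ = (Real.exp (κ * ‖x - y‖) * heatKernel n t (x - y)) * W y := by ring
    _ ≤ _ := mul_le_mul_of_nonneg_right (exp_mul_heatKernel_le κ ht _) (hW.pos y).le

theorem IsModerateWeight.lintegral_heatKernel_mul_le (hW : IsModerateWeight W κ) (ht : 0 < t)
    (y : EuclideanSpace ℝ (Fin n)) :
    ∫⁻ x, ENNReal.ofReal (heatKernel n t (x - y)) * ENNReal.ofReal (W x) ≤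
      ENNReal.ofReal (heatBound n κ t) * ENNReal.ofReal (W y) := by
  have hB : 0 ≤ heatBound n κ t := zero_le_one.trans (one_le_heatBound n κ ht.le)
  calc _ ≤ ∫⁻ x, ENNReal.ofReal (heatBound n κ t) * ENNReal.ofReal (W y) *
        ENNReal.ofReal (heatKernel n (2 * t) (x - y)) := by
        refine lintegral_mono fun x => ?_
        rw [← ENNReal.ofReal_mul (heatKernel_pos ht _).le, ← ENNReal.ofReal_mul hB,
          ← ENNReal.ofReal_mul (mul_nonneg hB (hW.pos y).le)]
        refine ENNReal.ofReal_le_ofReal ((hW.heatKernel_mul_le ht x y).trans_eq (by ring))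
    _ = _ := by
        rw [lintegral_const_mul, lintegral_heatKernel_sub' (by positivity), mul_one]
        exact (measurable_ofReal_heatKernel n (2 * t)).comp (measurable_id.sub measurable_const)

theorem IsModerateWeight.lintegral_rpow_heat_le (hW : IsModerateWeight W κ) (ht : 0 < t) {q : ℝ}
    (hq : 1 ≤ q) {g : EuclideanSpace ℝ (Fin n) → ℝ≥0∞} (hg : AEMeasurable g) :
    ∫⁻ x, (∫⁻ y, ENNReal.ofReal (heatKernel n t (x - y)) * g y) ^ q ∂weightMeasure W ≤
      ENNReal.ofReal (heatBound n κ t) * ∫⁻ y, g y ^ q ∂weightMeasure W := by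
  rw [hW.lintegral, hW.lintegral, ← lintegral_const_mul' _ _ ENNReal.ofReal_ne_top]
  have hh : Measurable fun z : EuclideanSpace ℝ (Fin n) × EuclideanSpace ℝ (Fin n) =>
      ENNReal.ofReal (heatKernel n t (z.1 - z.2)) :=
    (measurable_ofReal_heatKernel n t).comp (measurable_fst.sub measurable_snd)
  have hm : AEMeasurable (fun z : EuclideanSpace ℝ (Fin n) × EuclideanSpace ℝ (Fin n) =>
      ENNReal.ofReal (W z.1) * (ENNReal.ofReal (heatKernel n t (z.1 - z.2)) * g z.2 ^ q))
      (volume.prod volume) :=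
    (hW.continuous.measurable.comp measurable_fst).ennreal_ofReal.aemeasurable.mul
      (hh.aemeasurable.mul ((hg.pow_const q).comp_snd))
  calc _ ≤ ∫⁻ x, ∫⁻ y, ENNReal.ofReal (W x) *
        (ENNReal.ofReal (heatKernel n t (x - y)) * g y ^ q) := by
        refine lintegral_mono fun x => ?_
        rw [lintegral_const_mul' _ _ ENNReal.ofReal_ne_top]
        gcongr
        exact lintegral_heatKernel_mul_rpow_le ht hq hg x
    _ = ∫⁻ y, ∫⁻ x, ENNReal.ofReal (W x) *
        (ENNReal.ofReal (heatKernel n t (x - y)) * g y ^ q) := lintegral_lintegral_swap hm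
    _ ≤ _ := by
        refine lintegral_mono fun y => ?_
        have e : ∀ x, ENNReal.ofReal (W x) * (ENNReal.ofReal (heatKernel n t (x - y)) * g y ^ q) =
          (ENNReal.ofReal (heatKernel n t (x - y)) * ENNReal.ofReal (W x)) * g y ^ q :=
          fun x => by ring
        simp_rw [e]
        rw [lintegral_mul_const, ← mul_assoc]
        · gcongr
          exact hW.lintegral_heatKernel_mul_le ht y
        · exact ((measurable_ofReal_heatKernel n t).comp (measurable_id.sub measurable_const)).mul
            hW.continuous.measurable.ennreal_ofReal

theorem toReal_one_le [Fact (1 ≤ p)] (hp : p ≠ ∞) : 1 ≤ p.toReal :=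
  (ENNReal.dichotomy p).resolve_left hp

theorem eLpNormEssSup_weightMeasure (hW : IsModerateWeight W κ)
    (f : EuclideanSpace ℝ (Fin n) → ℂ) :
    eLpNormEssSup f (weightMeasure W) = eLpNormEssSup f volume :=
  le_antisymm (eLpNormEssSup_mono_measure f weightMeasure_ac)
    (eLpNormEssSup_mono_measure f hW.ac)

/-- At every point `x`, the integral defining `h_t * f (x)` converges absolutely and depends
continuously on `f` in the weighted norm. -/
theorem IsModerateWeight.exists_lintegral_le (hW : IsModerateWeight W κ) [Fact (1 ≤ p)]
    (ht : 0 < t) (x : EuclideanSpace ℝ (Fin n)) :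
    ∃ C : ℝ≥0, ∀ f : EuclideanSpace ℝ (Fin n) → ℂ, AEStronglyMeasurable f volume →
      ∫⁻ y, ENNReal.ofReal (heatKernel n t (x - y)) * ‖f y‖ₑ ≤ C * eLpNorm f p (weightMeasure W) := by
  by_cases hp : p = ∞
  · refine ⟨1, fun f _ => ?_⟩
    rw [hp, eLpNorm_exponent_top, eLpNormEssSup_weightMeasure hW, ENNReal.coe_one, one_mul]
    calc _ ≤ ∫⁻ y, ENNReal.ofReal (heatKernel n t (x - y)) * eLpNormEssSup f volume := by
          refine lintegral_mono_ae ?_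
          filter_upwards [ae_le_eLpNormEssSup (f := f) (μ := volume)] with y hy
          gcongr
      _ = _ := by
          rw [lintegral_mul_const, lintegral_heatKernel_sub ht, one_mul]
          exact (measurable_ofReal_heatKernel n t).comp (measurable_const.sub measurable_id)
  · have hq := toReal_one_le (p := p) hp
    have hq0 : 0 < p.toReal := by linarith
    set C : ℝ := heatBound n κ t * (4 * Real.pi * (2 * t)) ^ (-((n : ℝ) / 2)) / W x with hC
    have hB : 0 ≤ heatBound n κ t := zero_le_one.trans (one_le_heatBound n κ ht.le)
    -- A Gaussian is dominated by the weight, which decays at most exponentially.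
    have hCW : ∀ y, heatKernel n t (x - y) ≤ C * W y := by
      intro y
      rw [hC, div_mul_eq_mul_div, le_div_iff₀ (hW.pos x)]
      refine (hW.heatKernel_mul_le ht x y).trans ?_
      gcongr
      · exact (hW.pos y).le
      · exact heatKernel_le (by positivity) _
    refine ⟨(C ^ (1 / p.toReal)).toNNReal, fun f hf => ?_⟩
    have hC0 : 0 ≤ C := div_nonneg (by positivity) (hW.pos x).le
    have hp0 : p ≠ 0 := by rintro rfl; simp at hq0
    rw [eLpNorm_eq_lintegral_rpow_enorm_toReal hp0 hp, hW.lintegral]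
    change _ ≤ ENNReal.ofReal _ * _
    rw [← ENNReal.ofReal_rpow_of_nonneg hC0 (by positivity),
      ← ENNReal.mul_rpow_of_nonneg _ _ (by positivity),
      ← lintegral_const_mul' _ _ ENNReal.ofReal_ne_top, ← ENNReal.rpow_le_rpow_iff hq0,
      ← ENNReal.rpow_mul, one_div_mul_cancel hq0.ne', ENNReal.rpow_one]
    refine (lintegral_heatKernel_mul_rpow_le ht hq hf.enorm x).trans (lintegral_mono fun y => ?_)
    rw [← mul_assoc, ← ENNReal.ofReal_mul hC0]
    gcongr
    exact hCW y

theorem IsModerateWeight.integrable_heatKernel_mul (hW : IsModerateWeight W κ) [Fact (1 ≤ p)]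
    (ht : 0 < t) {f : EuclideanSpace ℝ (Fin n) → ℂ} (hf : MemLp f p (weightMeasure W))
    (x : EuclideanSpace ℝ (Fin n)) :
    Integrable fun y => (heatKernel n t (x - y) : ℂ) * f y := by
  have hfm : AEStronglyMeasurable f volume := hf.1.mono_ac hW.ac
  have := continuous_heatKernel n t
  refine ⟨AEStronglyMeasurable.mul (Continuous.aestronglyMeasurable (by fun_prop)) hfm, ?_⟩
  obtain ⟨C, hC⟩ := hW.exists_lintegral_le (p := p) ht x
  rw [hasFiniteIntegral_iff_enorm]
  simp_rw [enorm_heatKernel_mul ht]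
  exact (hC f hfm).trans_lt (ENNReal.mul_lt_top ENNReal.coe_lt_top hf.2)

theorem continuous_heatConv (ht : 0 < t) {f : EuclideanSpace ℝ (Fin n) → ℂ}
    (hf : ∀ s, 0 < s → ∀ x, Integrable fun y => (heatKernel n s (x - y) : ℂ) * f y) :
    Continuous (heatConv n t f) := by
  refine continuous_iff_continuousAt.2 fun x₀ => ?_
  -- Convergence at time `2t` provides the dominating function at time `t`.
  refine continuousAt_of_dominated (bound := fun y => 2 ^ ((n : ℝ) / 2) *
    Real.exp (1 / (4 * t)) * ‖(heatKernel n (2 * t) (x₀ - y) : ℂ) * f y‖)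
    (Filter.Eventually.of_forall fun x => (hf t ht x).aestronglyMeasurable) ?_
    ((hf (2 * t) (by positivity) x₀).norm.const_mul _) ?_
  · filter_upwards [Metric.ball_mem_nhds x₀ one_pos] with x hx
    refine Filter.Eventually.of_forall fun y => ?_
    rw [norm_mul, norm_mul, Complex.norm_of_nonneg (heatKernel_pos ht _).le,
      Complex.norm_of_nonneg (heatKernel_pos (by positivity) _).le, ← mul_assoc]
    gcongr
    refine (heatKernel_sub_le ht x x₀ y).trans ?_
    have h1 : ‖x - x₀‖ ^ 2 ≤ 1 := by
      rw [← dist_eq_norm]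
      exact pow_le_one₀ dist_nonneg (Metric.mem_ball.1 hx).le
    have := (heatKernel_pos (by positivity : 0 < 2 * t) (x₀ - y)).le
    gcongr
  · have := continuous_heatKernel n t
    exact Filter.Eventually.of_forall fun y => by fun_prop

theorem IsModerateWeight.continuous_heatConv (hW : IsModerateWeight W κ) [Fact (1 ≤ p)]
    (ht : 0 < t) {f : EuclideanSpace ℝ (Fin n) → ℂ} (hf : MemLp f p (weightMeasure W)) :
    Continuous (heatConv n t f) :=
  _root_.continuous_heatConv ht fun _ hs x => hW.integrable_heatKernel_mul hs hf x

theorem IsModerateWeight.eLpNorm_heatConv_le (hW : IsModerateWeight W κ) [Fact (1 ≤ p)]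
    (ht : 0 < t) {f : EuclideanSpace ℝ (Fin n) → ℂ} (hf : AEStronglyMeasurable f volume) :
    eLpNorm (heatConv n t f) p (weightMeasure W) ≤
      ENNReal.ofReal (heatBound n κ t) * eLpNorm f p (weightMeasure W) := by
  have hB1 := one_le_heatBound n κ ht.le
  by_cases hp : p = ∞
  · rw [hp, eLpNorm_exponent_top, eLpNorm_exponent_top, eLpNormEssSup_weightMeasure hW,
      eLpNormEssSup_weightMeasure hW]
    refine le_trans (essSup_le_of_ae_le _ (Filter.Eventually.of_forall fun x => ?_))
      (le_mul_of_one_le_left zero_le (by simpa using ENNReal.ofReal_le_ofReal hB1))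
    refine (enorm_heatConv_le ht f x).trans ?_
    calc _ ≤ ∫⁻ y, ENNReal.ofReal (heatKernel n t (x - y)) * eLpNormEssSup f volume := by
          refine lintegral_mono_ae ?_
          filter_upwards [ae_le_eLpNormEssSup (f := f) (μ := volume)] with y hy
          gcongr
      _ = _ := by
          rw [lintegral_mul_const, lintegral_heatKernel_sub ht, one_mul]
          exact (measurable_ofReal_heatKernel n t).comp (measurable_const.sub measurable_id)
  · have hq := toReal_one_le (p := p) hp
    have hq0 : 0 < p.toReal := by linarith
    have hp0 : p ≠ 0 := by rintro rfl; simp at hq0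
    rw [eLpNorm_eq_lintegral_rpow_enorm_toReal hp0 hp, eLpNorm_eq_lintegral_rpow_enorm_toReal hp0 hp,
      ← ENNReal.rpow_le_rpow_iff hq0, ENNReal.mul_rpow_of_nonneg _ _ hq0.le,
      ← ENNReal.rpow_mul, ← ENNReal.rpow_mul, one_div_mul_cancel hq0.ne', ENNReal.rpow_one,
      ENNReal.rpow_one]
    calc _ ≤ ∫⁻ x, (∫⁻ y, ENNReal.ofReal (heatKernel n t (x - y)) * ‖f y‖ₑ) ^ p.toReal
          ∂weightMeasure W := by
          refine lintegral_mono fun x => ?_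
          gcongr
          exact enorm_heatConv_le ht f x
      _ ≤ _ := hW.lintegral_rpow_heat_le ht hq hf.enorm
      _ ≤ _ := by
          gcongr
          calc ENNReal.ofReal (heatBound n κ t) = ENNReal.ofReal (heatBound n κ t) ^ (1 : ℝ) := by simp
            _ ≤ _ := ENNReal.rpow_le_rpow_of_exponent_le
              (by simpa using ENNReal.ofReal_le_ofReal hB1) hq

theorem IsModerateWeight.memLp_heatConv (hW : IsModerateWeight W κ) [Fact (1 ≤ p)]
    (ht : 0 < t) {f : EuclideanSpace ℝ (Fin n) → ℂ} (hf : MemLp f p (weightMeasure W)) :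
    MemLp (heatConv n t f) p (weightMeasure W) :=
  ⟨(hW.continuous_heatConv ht hf).aestronglyMeasurable,
    (hW.eLpNorm_heatConv_le ht (hf.1.mono_ac hW.ac)).trans_lt
      (ENNReal.mul_lt_top ENNReal.ofReal_lt_top hf.2)⟩

theorem heatConv_congr_ae {f g : EuclideanSpace ℝ (Fin n) → ℂ} (h : f =ᵐ[volume] g) (t : ℝ) :
    heatConv n t f = heatConv n t g := by
  funext x
  refine integral_congr_ae ?_
  filter_upwards [h] with y hy
  rw [hy]

/-- The semigroup law `h_s * (h_t * f) = h_{s+t} * f`, by Fubini. -/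
theorem heatConv_heatConv (hs : 0 < s) (ht : 0 < t) {f : EuclideanSpace ℝ (Fin n) → ℂ}
    (hfm : AEStronglyMeasurable f volume)
    (hf : ∀ s, 0 < s → ∀ x, Integrable fun y => (heatKernel n s (x - y) : ℂ) * f y) :
    heatConv n s (heatConv n t f) = heatConv n (s + t) f := by
  funext x
  have cs := continuous_heatKernel n s
  have ct := continuous_heatKernel n t
  have hst : 0 < s + t := by linarith
  have hm : AEStronglyMeasurable (Function.uncurry fun y z =>
      (heatKernel n s (x - y) : ℂ) * ((heatKernel n t (y - z) : ℂ) * f z))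
      (volume.prod volume) := by
    refine AEStronglyMeasurable.mul (Continuous.aestronglyMeasurable (by fun_prop))
      (AEStronglyMeasurable.mul (Continuous.aestronglyMeasurable (by fun_prop)) hfm.comp_snd)
  have hint : Integrable (Function.uncurry fun y z =>
      (heatKernel n s (x - y) : ℂ) * ((heatKernel n t (y - z) : ℂ) * f z))
      (volume.prod volume) := by
    refine ⟨hm, ?_⟩
    rw [hasFiniteIntegral_iff_enorm, lintegral_prod_symm _ hm.enorm]
    have e : ∀ z, ∫⁻ y, ‖Function.uncurry (fun y z =>
        (heatKernel n s (x - y) : ℂ) * ((heatKernel n t (y - z) : ℂ) * f z)) (y, z)‖ₑ =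
        ‖(heatKernel n (s + t) (x - z) : ℂ) * f z‖ₑ := by
      intro z
      simp only [Function.uncurry_apply_pair]
      simp_rw [enorm_heatKernel_mul hs, enorm_heatKernel_mul ht, enorm_heatKernel_mul hst]
      simp_rw [← mul_assoc]
      rw [lintegral_mul_const, lintegral_heatKernel_mul_heatKernel hs ht]
      exact ((measurable_ofReal_heatKernel n s).comp (measurable_const.sub measurable_id)).mul
        ((measurable_ofReal_heatKernel n t).comp (measurable_id.sub measurable_const))
    simp_rw [e]
    exact (hf _ hst x).2
  calc heatConv n s (heatConv n t f) x
      = ∫ y, ∫ z, (heatKernel n s (x - y) : ℂ) * ((heatKernel n t (y - z) : ℂ) * f z) := by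
        refine integral_congr_ae (Filter.Eventually.of_forall fun y => ?_)
        simp only [heatConv]
        rw [integral_const_mul]
    _ = ∫ z, ∫ y, (heatKernel n s (x - y) : ℂ) * ((heatKernel n t (y - z) : ℂ) * f z) :=
        integral_integral_swap hint
    _ = heatConv n (s + t) f x := by
        refine integral_congr_ae (Filter.Eventually.of_forall fun z => ?_)
        simp only
        simp_rw [← mul_assoc, ← Complex.ofReal_mul]
        rw [integral_mul_const, integral_complex_ofReal, integral_heatKernel_mul_heatKernel hs ht]

/-- Convolution with `h_t` as a bounded operator on `L^p(W dx)`. -/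
noncomputable def heatOp (hW : IsModerateWeight W κ) (p : ℝ≥0∞) [Fact (1 ≤ p)] (ht : 0 < t) :
    Lp ℂ p (weightMeasure W) →L[ℂ] Lp ℂ p (weightMeasure W) :=
  LinearMap.mkContinuous
    { toFun := fun f => (hW.memLp_heatConv ht (Lp.memLp f)).toLp (heatConv n t f)
      map_add' := fun f g => by
        rw [← MemLp.toLp_add, MemLp.toLp_eq_toLp_iff]
        refine Filter.Eventually.of_forall fun x => ?_
        rw [heatConv_congr_ae (hW.ac.ae_eq (Lp.coeFn_add f g)), Pi.add_apply, heatConv, heatConv,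
          heatConv, ← integral_add (hW.integrable_heatKernel_mul ht (Lp.memLp f) x)
            (hW.integrable_heatKernel_mul ht (Lp.memLp g) x)]
        simp only [Pi.add_apply, mul_add]
      map_smul' := fun c f => by
        rw [RingHom.id_apply, ← MemLp.toLp_const_smul, MemLp.toLp_eq_toLp_iff]
        refine Filter.Eventually.of_forall fun x => ?_
        rw [heatConv_congr_ae (hW.ac.ae_eq (Lp.coeFn_smul c f)), Pi.smul_apply, heatConv, heatConv,
          ← integral_smul]
        simp only [Pi.smul_apply, smul_eq_mul, mul_left_comm] }
    (heatBound n κ t) fun f => by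
      have hB : 0 ≤ heatBound n κ t := zero_le_one.trans (one_le_heatBound n κ ht.le)
      simp only [LinearMap.coe_mk, AddHom.coe_mk]
      rw [Lp.norm_toLp, Lp.norm_def, ← ENNReal.toReal_ofReal hB, ← ENNReal.toReal_mul]
      exact ENNReal.toReal_mono (ENNReal.mul_ne_top ENNReal.ofReal_ne_top (Lp.memLp f).2.ne)
        (hW.eLpNorm_heatConv_le ht ((Lp.memLp f).1.mono_ac hW.ac))

theorem coeFn_heatOp (hW : IsModerateWeight W κ) [Fact (1 ≤ p)] (ht : 0 < t)
    (f : Lp ℂ p (weightMeasure W)) :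
    heatOp hW p ht f =ᵐ[weightMeasure W] heatConv n t f :=
  (hW.memLp_heatConv ht (Lp.memLp f)).coeFn_toLp

/-- The semigroup `exp (-t b) h_t * ·` on `L^p(W dx)`. -/
noncomputable def heatSemigroup (hW : IsModerateWeight W κ) (p : ℝ≥0∞) [Fact (1 ≤ p)] (b : ℝ) :
    OperatorSemigroup (Lp ℂ p (weightMeasure W)) where
  -- `heatKernel n 0` is a junk value, so that the identity at `t = 0` has to be put in by hand.
  op t := if ht : 0 < t then
      (Real.exp (-(t * b)) : ℂ) • heatOp hW p (t := t) (by exact_mod_cast ht)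
    else ContinuousLinearMap.id ℂ _
  op_zero := by simp
  op_add s t := by
    rcases eq_or_lt_of_le (zero_le (a := s)) with rfl | hs
    · simp
    rcases eq_or_lt_of_le (zero_le (a := t)) with rfl | ht
    · simp
    have hst : 0 < s + t := by positivity
    rw [dif_pos hs, dif_pos ht, dif_pos hst]
    ext1 f
    simp only [smul_apply, ContinuousLinearMap.comp_apply, map_smul, smul_smul]
    congr 1
    · rw [← Complex.ofReal_mul, ← Real.exp_add, NNReal.coe_add]
      congr 2; ring
    · have hs' : 0 < (s : ℝ) := by exact_mod_cast hs
      have ht' : 0 < (t : ℝ) := by exact_mod_cast ht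
      refine Lp.ext ?_
      refine (coeFn_heatOp hW _ f).trans ((coeFn_heatOp hW hs' _).trans ?_).symm
      rw [heatConv_congr_ae (hW.ac.ae_eq (coeFn_heatOp hW ht' f)),
        heatConv_heatConv hs' ht' ((Lp.memLp f).1.mono_ac hW.ac)
          fun s hs x => hW.integrable_heatKernel_mul hs (Lp.memLp f) x, NNReal.coe_add]

end

/-! ### Strong continuity -/

/-- Dominated convergence in `L^p`. -/
theorem tendsto_eLpNorm_sub_of_dominated {α ι : Type*} [MeasurableSpace α] {μ : Measure α}
    {p : ℝ≥0∞} (hp0 : p ≠ 0) (hp : p ≠ ∞) {l : Filter ι} [l.IsCountablyGenerated]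
    {F : ι → α → ℂ} {f : α → ℂ} {bound : α → ℝ}
    (hF : ∀ᶠ i in l, AEStronglyMeasurable (F i) μ) (hf : AEStronglyMeasurable f μ)
    (hb : MemLp bound p μ) (hbound : ∀ᶠ i in l, ∀ᵐ a ∂μ, ‖F i a - f a‖ ≤ bound a)
    (hlim : ∀ᵐ a ∂μ, Filter.Tendsto (fun i => F i a) l (nhds (f a))) :
    Filter.Tendsto (fun i => eLpNorm (F i - f) p μ) l (nhds 0) := by
  have hq0 : 0 < p.toReal := ENNReal.toReal_pos hp0 hp
  have h1 : Filter.Tendsto (fun i => ∫⁻ a, ‖F i a - f a‖ₑ ^ p.toReal ∂μ) l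
      (nhds (∫⁻ _, 0 ∂μ)) := by
    refine tendsto_lintegral_filter_of_dominated_convergence' (fun a => ‖bound a‖ₑ ^ p.toReal)
      ?_ ?_ (lintegral_rpow_enorm_lt_top_of_eLpNorm_lt_top hp0 hp hb.2).ne ?_
    · filter_upwards [hF] with i hi using ((hi.sub hf).enorm.pow_const _)
    · filter_upwards [hbound] with i hi
      filter_upwards [hi] with a ha
      refine ENNReal.rpow_le_rpow ?_ hq0.le
      rw [← ofReal_norm, ← ofReal_norm]
      exact ENNReal.ofReal_le_ofReal (ha.trans (Real.le_norm_self _))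
    · filter_upwards [hlim] with a ha
      have h2 : Filter.Tendsto (fun i => ‖F i a - f a‖ₑ) l (nhds 0) := by
        simpa using (ha.sub_const (f a)).enorm
      simpa [ENNReal.zero_rpow_of_pos hq0] using h2.ennrpow_const p.toReal
  rw [lintegral_zero] at h1
  have h3 := h1.ennrpow_const (1 / p.toReal)
  rw [ENNReal.zero_rpow_of_pos (by positivity)] at h3
  refine h3.congr fun i => ?_
  rw [eLpNorm_eq_lintegral_rpow_enorm_toReal hp0 hp]
  rfl

namespace OperatorSemigroup

variable {X : Type*} [NormedAddCommGroup X] [NormedSpace ℂ X]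

/-- A semigroup that is bounded on bounded time intervals is strongly continuous as soon as the
orbits of a dense set of vectors are continuous at time zero. -/
theorem isStronglyContinuous_of_dense (T : OperatorSemigroup X)
    (hb : ∀ N : ℝ≥0, ∃ K : ℝ, ∀ t ≤ N, ‖T.op t‖ ≤ K) {D : Set X} (hD : Dense D)
    (h : ∀ v ∈ D, Filter.Tendsto (fun t => T.op t v) (nhds 0) (nhds v)) :
    T.IsStronglyContinuous := by
  have h0 : ∀ v, Filter.Tendsto (fun t => T.op t v) (nhds 0) (nhds v) := by
    intro v
    obtain ⟨K, hK⟩ := hb 1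
    have hK0 : 0 ≤ K := (norm_nonneg _).trans (hK 0 zero_le_one)
    rw [Metric.tendsto_nhds]
    intro ε hε
    obtain ⟨w, hwD, hw⟩ := Metric.mem_closure_iff.1 (hD v) (ε / (2 * (K + 2))) (by positivity)
    have h1 : ∀ᶠ t : ℝ≥0 in nhds 0, t ≤ 1 :=
      (eventually_lt_nhds (show (0 : ℝ≥0) < 1 by norm_num)).mono fun t ht => ht.le
    filter_upwards [h1, (Metric.tendsto_nhds.1 (h w hwD)) (ε / 2) (by positivity)] with t ht1 ht
    rw [dist_eq_norm] at hw ht ⊢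
    have e : T.op t v - v = T.op t (v - w) + (T.op t w - w) - (v - w) := by
      rw [map_sub]; abel
    have h2 : ‖T.op t (v - w)‖ ≤ K * ‖v - w‖ := (T.op t).le_of_opNorm_le (hK t ht1) _
    have h3 : (K + 1) * ‖v - w‖ ≤ ε / 2 := by
      calc (K + 1) * ‖v - w‖ ≤ (K + 2) * (ε / (2 * (K + 2))) := by gcongr; linarith
        _ = ε / 2 := by field_simp
    calc ‖T.op t v - v‖ ≤ ‖T.op t (v - w)‖ + ‖T.op t w - w‖ + ‖v - w‖ := by
          rw [e]; exact (norm_sub_le _ _).trans (by gcongr; exact norm_add_le _ _)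
      _ < ε := by linarith
  intro v
  refine continuous_iff_continuousAt.2 fun t => ?_
  obtain ⟨K, hK⟩ := hb (t + 1)
  have hK0 : 0 ≤ K := (norm_nonneg _).trans (hK 0 zero_le)
  -- Both for `s ≤ t` and for `t ≤ s` the difference of orbits factors through `T_{|s-t|} v - v`.
  have hd : ∀ s ≤ t + 1, ‖T.op s v - T.op t v‖ ≤ K * ‖T.op (max s t - min s t) v - v‖ := by
    intro s hs
    have key : ∀ a b : ℝ≥0, a ≤ b → a ≤ t + 1 →
        ‖T.op b v - T.op a v‖ ≤ K * ‖T.op (b - a) v - v‖ := by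
      intro a b hab ha
      have : T.op b v = T.op a (T.op (b - a) v) := by
        rw [← ContinuousLinearMap.comp_apply, ← T.op_add, add_tsub_cancel_of_le hab]
      rw [this, ← map_sub]
      exact (T.op a).le_of_opNorm_le (hK a ha) _
    rcases le_total s t with hst | hst
    · rw [max_eq_right hst, min_eq_left hst, norm_sub_rev]
      exact key s t hst hs
    · rw [max_eq_left hst, min_eq_right hst]
      exact key t s hst le_self_add
  have hm : Filter.Tendsto (fun s : ℝ≥0 => max s t - min s t) (nhds t) (nhds 0) := by
    have : Continuous fun s : ℝ≥0 => max s t - min s t := by fun_prop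
    simpa using this.tendsto t
  have hlim : Filter.Tendsto (fun s => K * ‖T.op (max s t - min s t) v - v‖) (nhds t) (nhds 0) := by
    have := (((h0 v).comp hm).sub_const v).norm.const_mul K
    simpa using this
  refine tendsto_iff_norm_sub_tendsto_zero.2 (squeeze_zero' (Filter.Eventually.of_forall
    fun _ => norm_nonneg _) ?_ hlim)
  filter_upwards [eventually_lt_nhds (show t < t + 1 from lt_add_of_pos_right t one_pos)] with s hs
    using hd s hs.le

end OperatorSemigroup

/-- The semigroup `T` on `L^p(μ)` is `exp (-t b) h_t * ·`. -/
def IsHeatSemigroupOn {n : ℕ} {p : ℝ≥0∞} [Fact (1 ≤ p)] (μ : Measure (EuclideanSpace ℝ (Fin n)))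
    (b : ℝ) (T : OperatorSemigroup (Lp ℂ p μ)) : Prop :=
  ∀ t : ℝ≥0, 0 < t → ∀ f : Lp ℂ p μ,
    (∀ x, Integrable (fun y => (heatKernel n t (x - y) : ℂ) * f y) volume) ∧
    ∀ᵐ x ∂volume, T.op t f x =
      (Real.exp (-(t * b)) : ℂ) * ∫ y, (heatKernel n t (x - y) : ℂ) * f y

theorem integrable_exp_neg_mul_norm (n : ℕ) {b : ℝ} (hb : 0 < b) :
    Integrable fun x : EuclideanSpace ℝ (Fin n) => Real.exp (-(b * ‖x‖)) := by
  have h := (integrable_one_add_norm (E := EuclideanSpace ℝ (Fin n)) (μ := volume)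
    (r := ((n + 1 : ℕ) : ℝ)) (by simp)).const_mul
      (Real.exp b * ((n + 1).factorial : ℝ) * (b ^ (n + 1))⁻¹)
  refine h.mono' (Continuous.aestronglyMeasurable (by fun_prop))
    (Filter.Eventually.of_forall fun x => ?_)
  have h1 := Real.pow_div_factorial_le_exp (x := b * (1 + ‖x‖)) (by positivity) (n + 1)
  rw [Real.norm_of_nonneg (Real.exp_pos _).le, Real.rpow_neg (by positivity), Real.rpow_natCast]
  have h2 : Real.exp (-(b * ‖x‖)) = Real.exp b * (Real.exp (b * (1 + ‖x‖)))⁻¹ := by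
    rw [← Real.exp_neg, ← Real.exp_add]; congr 1; ring
  rw [h2, mul_assoc (Real.exp b), mul_assoc (Real.exp b)]
  gcongr
  calc (Real.exp (b * (1 + ‖x‖)))⁻¹ ≤ ((b * (1 + ‖x‖)) ^ (n + 1) / (n + 1).factorial)⁻¹ := by
        gcongr
    _ = _ := by rw [mul_pow]; field_simp

section

variable {n : ℕ} {W : EuclideanSpace ℝ (Fin n) → ℝ} {κ : ℝ} {s t b : ℝ} {p : ℝ≥0∞}

theorem IsModerateWeight.isLocallyFiniteMeasure (hW : IsModerateWeight W κ) :
    IsLocallyFiniteMeasure (weightMeasure W) :=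
  IsLocallyFiniteMeasure.withDensity_ofReal hW.continuous

section

variable [Fact (1 ≤ p)]

theorem isHeatSemigroupOn_heatSemigroup (hW : IsModerateWeight W κ) (b : ℝ) :
    IsHeatSemigroupOn (weightMeasure W) b (heatSemigroup hW p b) := by
  intro t ht f
  have ht' : 0 < (t : ℝ) := by exact_mod_cast ht
  refine ⟨hW.integrable_heatKernel_mul ht' (Lp.memLp f), ?_⟩
  have e : (heatSemigroup hW p b).op t f = (Real.exp (-(t * b)) : ℂ) • heatOp hW p ht' f := by
    simp [heatSemigroup, dif_pos ht]
  rw [e]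
  refine hW.ac.ae_eq ?_
  filter_upwards [Lp.coeFn_smul (Real.exp (-(t * b)) : ℂ) (heatOp hW p ht' f),
    coeFn_heatOp hW ht' f] with x h1 h2
  rw [h1, Pi.smul_apply, h2, smul_eq_mul, heatConv]

theorem IsHeatSemigroupOn.unique {μ : Measure (EuclideanSpace ℝ (Fin n))} (hμ : μ ≪ volume)
    {T T' : OperatorSemigroup (Lp ℂ p μ)}
    (h : IsHeatSemigroupOn μ b T) (h' : IsHeatSemigroupOn μ b T') : T = T' := by
  have hop : T.op = T'.op := by
    funext t
    rcases eq_or_lt_of_le (zero_le (a := t)) with rfl | ht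
    · rw [T.op_zero, T'.op_zero]
    · ext1 f
      refine Lp.ext (hμ.ae_eq ?_)
      filter_upwards [(h t ht f).2, (h' t ht f).2] with x h1 h2
      rw [h1, h2]
  cases T
  cases T'
  simpa using hop

theorem norm_heatSemigroup_op_le (hW : IsModerateWeight W κ) (b : ℝ) (t : ℝ≥0) :
    ‖(heatSemigroup hW p b).op t‖ ≤ Real.exp (-(t * b)) * heatBound n κ t := by
  rcases eq_or_lt_of_le (zero_le (a := t)) with rfl | ht
  · rw [OperatorSemigroup.op_zero]
    refine ContinuousLinearMap.norm_id_le.trans ?_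
    simpa using one_le_heatBound n κ le_rfl
  · have e : (heatSemigroup hW p b).op t =
        (Real.exp (-(t * b)) : ℂ) • heatOp hW p (t := t) (by exact_mod_cast ht) := by
      simp [heatSemigroup, dif_pos ht]
    rw [e, norm_smul, Complex.norm_of_nonneg (Real.exp_pos _).le]
    gcongr
    exact LinearMap.mkContinuous_norm_le _ (zero_le_one.trans (one_le_heatBound n κ t.2)) _

end

theorem isModerateWeight_exp_neg (n : ℕ) (M : ℝ) (hM : 0 ≤ M) :
    IsModerateWeight (fun x : EuclideanSpace ℝ (Fin n) => Real.exp (-(M * ‖x‖))) M where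
  continuous := by fun_prop
  pos x := Real.exp_pos _
  le x y := by
    rw [← Real.exp_add]
    refine Real.exp_le_exp.2 ?_
    have h := norm_sub_norm_le y x
    rw [norm_sub_rev] at h
    nlinarith

theorem norm_heatConv_le_of_decay (ht : 0 < t) {M D : ℝ} (hM : 0 ≤ M) (hD : 0 ≤ D)
    {f : EuclideanSpace ℝ (Fin n) → ℂ} (hf : ∀ y, ‖f y‖ ≤ D * Real.exp (-(M * ‖y‖)))
    (x : EuclideanSpace ℝ (Fin n)) :
    ‖heatConv n t f x‖ ≤ D * heatBound n M t * Real.exp (-(M * ‖x‖)) := by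
  have hE := isModerateWeight_exp_neg n M hM
  have h := hE.lintegral_heatKernel_mul_le ht x
  have hB : 0 ≤ heatBound n M t := zero_le_one.trans (one_le_heatBound n M ht.le)
  rw [← ENNReal.ofReal_le_ofReal_iff (by positivity), ofReal_norm]
  calc ‖heatConv n t f x‖ₑ ≤ ∫⁻ y, ENNReal.ofReal (heatKernel n t (x - y)) * ‖f y‖ₑ :=
        enorm_heatConv_le ht f x
    _ ≤ ∫⁻ y, ENNReal.ofReal D * (ENNReal.ofReal (heatKernel n t (y - x)) *
          ENNReal.ofReal (Real.exp (-(M * ‖y‖)))) := by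
        refine lintegral_mono fun y => ?_
        rw [heatKernel_sub_comm, mul_left_comm, ← ENNReal.ofReal_mul hD, ← ofReal_norm]
        gcongr
        exact hf y
    _ ≤ ENNReal.ofReal D * (ENNReal.ofReal (heatBound n M t) *
          ENNReal.ofReal (Real.exp (-(M * ‖x‖)))) := by
        rw [lintegral_const_mul' _ _ ENNReal.ofReal_ne_top]
        gcongr
    _ = _ := by rw [mul_assoc, ENNReal.ofReal_mul hD, ENNReal.ofReal_mul hB]

/-- The substitution `y = √t z`, which turns the limit `t → 0` into dominated convergence. -/
theorem heatConv_eq_integral_smul (ht : 0 < t) (f : EuclideanSpace ℝ (Fin n) → ℂ)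
    (x : EuclideanSpace ℝ (Fin n)) :
    heatConv n t f x = ∫ z, (heatKernel n 1 z : ℂ) * f (x - √t • z) := by
  have h := Measure.integral_comp_smul_of_nonneg (volume : Measure (EuclideanSpace ℝ (Fin n)))
    (fun y => (heatKernel n t y : ℂ) * f (x - y)) (√t) (hR := Real.sqrt_nonneg t)
  have e : heatConv n t f x = ∫ y, (heatKernel n t y : ℂ) * f (x - y) := by
    rw [heatConv, ← integral_sub_left_eq_self _ _ x]
    simp
  rw [finrank_euclideanSpace_fin] at h
  have hs : √t ^ n ≠ 0 := by positivity
  rw [e, ← smul_inv_smul₀ hs (∫ y, (heatKernel n t y : ℂ) * f (x - y)), ← h, ← integral_smul]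
  refine integral_congr_ae (Filter.Eventually.of_forall fun z => ?_)
  have hk : √t ^ n * heatKernel n t (√t • z) = heatKernel n 1 z := by
    unfold heatKernel
    rw [norm_smul, mul_pow, Real.norm_of_nonneg (Real.sqrt_nonneg t), Real.sq_sqrt ht.le, mul_one,
      Real.mul_rpow (by positivity) ht.le, mul_one, Real.sqrt_eq_rpow, ← Real.rpow_natCast,
      ← Real.rpow_mul ht.le]
    have e1 : t ^ (1 / 2 * (n : ℝ)) * t ^ (-((n : ℝ) / 2)) = 1 := by
      rw [← Real.rpow_add ht]
      ring_nf
      simp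
    rw [show t * ‖z‖ ^ 2 / (4 * t) = ‖z‖ ^ 2 / 4 by field_simp]
    linear_combination (4 * Real.pi) ^ (-((n : ℝ) / 2)) * Real.exp (-(‖z‖ ^ 2 / 4)) * e1
  simp only
  rw [Complex.real_smul, ← mul_assoc, ← Complex.ofReal_mul, hk]

theorem tendsto_heatConv {f : EuclideanSpace ℝ (Fin n) → ℂ} (hf : Continuous f) {D : ℝ}
    (hD : ∀ y, ‖f y‖ ≤ D) (x : EuclideanSpace ℝ (Fin n)) :
    Filter.Tendsto (fun t => heatConv n t f x) (nhdsWithin 0 (Set.Ioi 0)) (nhds (f x)) := by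
  have hk := continuous_heatKernel n 1
  have hlim : Filter.Tendsto (fun t : ℝ => ∫ z, (heatKernel n 1 z : ℂ) * f (x - √t • z))
      (nhds 0) (nhds (∫ z, (heatKernel n 1 z : ℂ) * f (x - √0 • z))) := by
    have hc : Continuous fun t : ℝ => ∫ z, (heatKernel n 1 z : ℂ) * f (x - √t • z) := by
      refine continuous_of_dominated (bound := fun z => heatKernel n 1 z * D)
        (fun t => Continuous.aestronglyMeasurable (by fun_prop)) (fun t => ?_)
        ((integrable_heatKernel one_pos).mul_const D)
        (Filter.Eventually.of_forall fun z => by fun_prop)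
      refine Filter.Eventually.of_forall fun z => ?_
      rw [norm_mul, Complex.norm_of_nonneg (heatKernel_pos one_pos _).le]
      have := (heatKernel_pos one_pos z).le
      gcongr
      exact hD _
    exact hc.tendsto 0
  have e0 : ∫ z, (heatKernel n 1 z : ℂ) * f (x - √0 • z) = f x := by
    simp only [Real.sqrt_zero, zero_smul, sub_zero]
    rw [integral_mul_const, integral_complex_ofReal, integral_heatKernel one_pos,
      Complex.ofReal_one, one_mul]
  rw [e0] at hlim
  refine (hlim.mono_left nhdsWithin_le_nhds).congr' ?_
  filter_upwards [self_mem_nhdsWithin] with t ht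
  rw [heatConv_eq_integral_smul ht]

theorem memLp_exp_neg (hW : IsModerateWeight W κ) (hp0 : p ≠ 0) (hp : p ≠ ∞) {M : ℝ}
    (hM : κ < M * p.toReal) (D : ℝ) :
    MemLp (fun x : EuclideanSpace ℝ (Fin n) => D * Real.exp (-(M * ‖x‖))) p (weightMeasure W) := by
  refine MemLp.const_mul ?_ D
  refine ⟨Continuous.aestronglyMeasurable (by fun_prop), ?_⟩
  rw [eLpNorm_lt_top_iff_lintegral_rpow_enorm_lt_top hp0 hp, hW.lintegral]
  have h := ((integrable_exp_neg_mul_norm n (sub_pos.2 hM)).const_mul (W 0)).lintegral_lt_top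
  refine lt_of_le_of_lt (lintegral_mono fun x => ?_) h
  rw [← ofReal_norm, Real.norm_of_nonneg (Real.exp_pos _).le,
    ENNReal.ofReal_rpow_of_nonneg (Real.exp_pos _).le ENNReal.toReal_nonneg,
    ← ENNReal.ofReal_mul (hW.pos x).le]
  refine ENNReal.ofReal_le_ofReal ?_
  calc _ ≤ (Real.exp (κ * ‖x - 0‖) * W 0) * Real.exp (-(M * ‖x‖)) ^ p.toReal := by
        gcongr; exact hW.le x 0
    _ = _ := by
        rw [sub_zero, ← Real.exp_mul, mul_right_comm, ← Real.exp_add, mul_comm]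
        congr 2; ring

theorem exists_norm_le_exp_of_hasCompactSupport {f : EuclideanSpace ℝ (Fin n) → ℂ}
    (hf : Continuous f) (hs : HasCompactSupport f) (M : ℝ) :
    ∃ D, 0 ≤ D ∧ ∀ y, ‖f y‖ ≤ D * Real.exp (-(M * ‖y‖)) := by
  have hc : Continuous fun y => Real.exp (M * ‖y‖) • f y := by fun_prop
  obtain ⟨D, hD⟩ := (hs.smul_left (f := fun y : EuclideanSpace ℝ (Fin n) =>
    Real.exp (M * ‖y‖))).exists_bound_of_continuous hc
  refine ⟨D, (norm_nonneg _).trans (hD 0), fun y => ?_⟩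
  have := hD y
  simp only [Pi.smul_apply', norm_smul, Real.norm_of_nonneg (Real.exp_pos _).le] at this
  rw [Real.exp_neg, ← div_eq_mul_inv, le_div_iff₀ (Real.exp_pos _), mul_comm]
  exact this

theorem isStronglyContinuous_heatSemigroup (hW : IsModerateWeight W κ) [Fact (1 ≤ p)] (hp : p ≠ ∞)
    (b : ℝ) : (heatSemigroup hW p b).IsStronglyContinuous := by
  have hq := toReal_one_le (p := p) hp
  have hp0 : p ≠ 0 := by rintro rfl; simp at hq; linarith
  have := hW.isLocallyFiniteMeasure
  have hT := isHeatSemigroupOn_heatSemigroup (p := p) hW b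
  refine OperatorSemigroup.isStronglyContinuous_of_dense _ (fun N => ?_)
    (D := {v | ∃ f : EuclideanSpace ℝ (Fin n) → ℂ, Continuous f ∧ HasCompactSupport f ∧
      ∃ hf : MemLp f p (weightMeasure W), v = hf.toLp f}) ?_ ?_
  · refine ⟨Real.exp (N * |b|) * heatBound n κ N, fun t ht =>
      (norm_heatSemigroup_op_le hW b t).trans ?_⟩
    have ht' : (t : ℝ) ≤ N := by exact_mod_cast ht
    unfold heatBound
    gcongr
    have h1 : -((t : ℝ) * b) ≤ t * |b| := by
      rw [← mul_neg]
      exact mul_le_mul_of_nonneg_left (neg_le_abs b) t.2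
    exact h1.trans (by gcongr)
  · intro v
    refine EMetric.mem_closure_iff.2 fun ε hε => ?_
    obtain ⟨g, hgs, hg, hgc, hgm⟩ := (Lp.memLp v).exists_hasCompactSupport_eLpNorm_sub_le hp
      (ε := ε / 2) (by simpa using hε.ne')
    by_cases hε' : ε = ∞
    · exact ⟨_, ⟨g, hgc, hgs, hgm, rfl⟩, hε' ▸ edist_lt_top _ _⟩
    refine ⟨_, ⟨g, hgc, hgs, hgm, rfl⟩, ?_⟩
    rw [← Lp.toLp_coeFn v (Lp.memLp v), Lp.edist_toLp_toLp]
    exact hg.trans_lt (ENNReal.half_lt_self hε.ne' hε')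
  · rintro _ ⟨f, hfc, hfs, hf, rfl⟩
    -- The decay rate `M` is large enough for `exp (-M|x|)` to belong to the weighted space.
    set M : ℝ := |κ| + 1 with hM
    have hM0 : 0 ≤ M := by positivity
    have hMp : κ < M * p.toReal := by
      calc κ ≤ |κ| := le_abs_self κ
        _ < M * 1 := by rw [hM]; linarith
        _ ≤ M * p.toReal := by gcongr
    obtain ⟨D, hD0, hD⟩ := exists_norm_le_exp_of_hasCompactSupport hfc hfs M
    have hlim : Filter.Tendsto (fun t : ℝ => eLpNorm
        ((fun x => (Real.exp (-(t * b)) : ℂ) * heatConv n t f x) - f) p (weightMeasure W))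
        (nhdsWithin 0 (Set.Ioi 0)) (nhds 0) := by
      refine tendsto_eLpNorm_sub_of_dominated hp0 hp ?_ hf.1
        (memLp_exp_neg hW hp0 hp hMp (Real.exp |b| * (D * heatBound n M 1) + D)) ?_ ?_
      · filter_upwards [self_mem_nhdsWithin] with t ht
        exact ((hW.continuous_heatConv ht hf).const_smul (Real.exp (-(t * b)) : ℂ)).aestronglyMeasurable
      · filter_upwards [Ioo_mem_nhdsGT (zero_lt_one' ℝ)] with t ht
        refine Filter.Eventually.of_forall fun x => (norm_sub_le _ _).trans ?_
        rw [norm_mul, Complex.norm_of_nonneg (Real.exp_pos _).le, add_mul, mul_assoc]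
        refine add_le_add ?_ (hD x)
        have h1 : -(t * b) ≤ |b| := by
          calc -(t * b) ≤ |t * b| := neg_le_abs _
            _ = t * |b| := by rw [abs_mul, abs_of_pos ht.1]
            _ ≤ |b| := mul_le_of_le_one_left (abs_nonneg b) ht.2.le
        gcongr
        refine (norm_heatConv_le_of_decay ht.1 hM0 hD0 hD x).trans ?_
        have : heatBound n M t ≤ heatBound n M 1 := by
          have := ht.2.le
          unfold heatBound
          gcongr
        gcongr
      · refine Filter.Eventually.of_forall fun x => ?_
        have h1 : Filter.Tendsto (fun t : ℝ => (Real.exp (-(t * b)) : ℂ))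
            (nhdsWithin 0 (Set.Ioi 0)) (nhds 1) := by
          have : Continuous fun t : ℝ => (Real.exp (-(t * b)) : ℂ) := by fun_prop
          simpa using (this.tendsto 0).mono_left nhdsWithin_le_nhds
        have hD' : ∀ y, ‖f y‖ ≤ D := fun y => (hD y).trans
          (mul_le_of_le_one_right hD0 (Real.exp_le_one_iff.2 (by
            have := mul_nonneg hM0 (norm_nonneg y); linarith)))
        simpa using h1.mul (tendsto_heatConv hfc hD' x)
    have hlim' : Filter.Tendsto (fun t : ℝ≥0 => (heatSemigroup hW p b).op t (hf.toLp f))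
        (nhdsWithin 0 (Set.Ioi 0)) (nhds (hf.toLp f)) := by
      rw [Lp.tendsto_Lp_iff_tendsto_eLpNorm]
      have hcoe : Filter.Tendsto (fun t : ℝ≥0 => (t : ℝ)) (nhdsWithin 0 (Set.Ioi 0))
          (nhdsWithin 0 (Set.Ioi 0)) := by
        refine tendsto_nhdsWithin_iff.2 ⟨?_, ?_⟩
        · exact (NNReal.continuous_coe.tendsto 0).mono_left nhdsWithin_le_nhds
        · filter_upwards [self_mem_nhdsWithin] with t ht
          exact_mod_cast ht
      refine (hlim.comp hcoe).congr' ?_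
      filter_upwards [self_mem_nhdsWithin] with t ht
      refine eLpNorm_congr_ae ?_
      refine Filter.EventuallyEq.sub ?_ Filter.EventuallyEq.rfl
      filter_upwards [weightMeasure_ac.ae_le ((hT t ht (hf.toLp f)).2)] with x hx
      rw [hx]
      congr 1
      exact (congrFun (heatConv_congr_ae (hW.ac.ae_eq hf.coeFn_toLp) t) x).symm
    have h0 : (nhds (0 : ℝ≥0)) = nhdsWithin 0 (Set.Ioi 0) ⊔ pure 0 := by
      have : (Set.univ : Set ℝ≥0) = Set.Ioi 0 ∪ {0} := by
        ext t; simp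
      rw [← nhdsWithin_univ, this, nhdsWithin_union, nhdsWithin_singleton]
    rw [h0]
    refine hlim'.sup ?_
    rw [Filter.tendsto_pure_left]
    intro s hs
    rw [OperatorSemigroup.op_zero]
    exact mem_of_mem_nhds hs

end

/-! ### The case `p = ∞` -/

section

variable {n : ℕ} {W : EuclideanSpace ℝ (Fin n) → ℝ} {κ b : ℝ}

/-- The indicator function of an open half-space has distance at least `1/2` from every
continuous function: look at both sides of a boundary point. -/
theorem half_le_norm_sub_indicator (hn : 1 ≤ n) (hW : IsModerateWeight W κ)
    {g : Lp ℂ ∞ (weightMeasure W)}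
    (hg : g =ᵐ[volume] Set.indicator {x : EuclideanSpace ℝ (Fin n) | 0 < x ⟨0, hn⟩} 1)
    {f : Lp ℂ ∞ (weightMeasure W)} {F : EuclideanSpace ℝ (Fin n) → ℂ} (hF : Continuous F)
    (hf : f =ᵐ[volume] F) : 1 / 2 ≤ ‖f - g‖ := by
  by_contra! hlt
  set d := ‖f - g‖ with hd
  have hae : ∀ᵐ x : EuclideanSpace ℝ (Fin n),
      ‖F x - Set.indicator {x : EuclideanSpace ℝ (Fin n) | 0 < x ⟨0, hn⟩} 1 x‖ ≤ d := by
    have h1 : ∀ᵐ x ∂weightMeasure W, ‖(f - g) x‖ₑ ≤ eLpNormEssSup (f - g : Lp ℂ ∞ _) _ :=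
      ae_le_eLpNormEssSup
    filter_upwards [hW.ac.ae_le h1, hf, hg, hW.ac.ae_eq (Lp.coeFn_sub f g)] with x h1 h2 h3 h4
    rw [h4, Pi.sub_apply, h2, h3, ← eLpNorm_exponent_top] at h1
    rw [hd, Lp.norm_def, ← toReal_enorm]
    exact ENNReal.toReal_mono (Lp.memLp (f - g)).2.ne h1
  set η : ℝ := (1 / 2 - d) / 2 with hη
  have hη0 : 0 < η := by linarith
  obtain ⟨r, hr, hball⟩ := Metric.continuous_iff.1 hF 0 η hη0
  have hc : Continuous fun x : EuclideanSpace ℝ (Fin n) => x ⟨0, hn⟩ := by fun_prop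
  have hex : ∀ U : Set (EuclideanSpace ℝ (Fin n)), IsOpen U → U.Nonempty → ∃ x ∈ U,
      ‖F x - Set.indicator {x : EuclideanSpace ℝ (Fin n) | 0 < x ⟨0, hn⟩} 1 x‖ ≤ d := by
    intro U hU hne
    obtain ⟨x, hx⟩ := ((frequently_ae_mem_iff.2 (hU.measure_pos volume hne).ne').and_eventually
      hae).exists
    exact ⟨x, hx.1, hx.2⟩
  obtain ⟨x, ⟨hx1, hx2⟩, hx⟩ := hex (Metric.ball 0 r ∩ {x | 0 < x ⟨0, hn⟩})
    (Metric.isOpen_ball.inter (isOpen_lt continuous_const hc))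
    ⟨EuclideanSpace.single ⟨0, hn⟩ (r / 2), by
      simp [abs_of_pos hr, hr]⟩
  obtain ⟨y, ⟨hy1, hy2⟩, hy⟩ := hex (Metric.ball 0 r ∩ {x | x ⟨0, hn⟩ < 0})
    (Metric.isOpen_ball.inter (isOpen_lt hc continuous_const))
    ⟨EuclideanSpace.single ⟨0, hn⟩ (-(r / 2)), by
      simp [abs_of_pos hr, hr]⟩
  rw [Set.indicator_of_mem hx2, Pi.one_apply] at hx
  rw [Set.indicator_of_notMem (by simpa using (le_of_lt hy2 : y ⟨0, hn⟩ ≤ 0)), sub_zero] at hy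
  have hx3 := hball x hx1
  have hy3 := hball y hy1
  rw [dist_eq_norm] at hx3 hy3
  have h1 : (1 : ℝ) ≤ ‖F x - F 0‖ + ‖F y - F 0‖ + ‖F x - 1‖ + ‖F y‖ := by
    have e : (1 : ℂ) = (F x - F 0) - (F y - F 0) - (F x - 1) + F y := by ring
    calc (1 : ℝ) = ‖(F x - F 0) - (F y - F 0) - (F x - 1) + F y‖ := by rw [← e, norm_one]
      _ ≤ _ := (norm_add_le _ _).trans (by
        gcongr
        exact (norm_sub_le _ _).trans (by gcongr; exact norm_sub_le _ _))
  linarith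

/-- For `t > 0` the functions `T_t v` are continuous. Hence the closure of an orbit in `L^∞` does
not contain both an indicator function `g` and `4 g`. -/
theorem not_isHypercyclic_heatSemigroup_top (hn : 1 ≤ n) (hW : IsModerateWeight W κ) :
    ¬ (heatSemigroup hW ∞ b).IsHypercyclic := by
  rintro ⟨v, hv⟩
  have hT := isHeatSemigroupOn_heatSemigroup (p := ∞) hW b
  have hHm : MeasurableSet {x : EuclideanSpace ℝ (Fin n) | 0 < x ⟨0, hn⟩} :=
    (isOpen_lt continuous_const (by fun_prop)).measurableSet
  have hgm : MemLp (Set.indicator {x : EuclideanSpace ℝ (Fin n) | 0 < x ⟨0, hn⟩}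
      (1 : EuclideanSpace ℝ (Fin n) → ℂ)) ∞ (weightMeasure W) := by
    refine memLp_top_of_bound (stronglyMeasurable_one.indicator hHm).aestronglyMeasurable 1
      (Filter.Eventually.of_forall fun x => ?_)
    refine (norm_indicator_le_norm_self _ _).trans (by simp)
  set g := hgm.toLp _ with hg_def
  have hg : g =ᵐ[volume] Set.indicator {x : EuclideanSpace ℝ (Fin n) | 0 < x ⟨0, hn⟩} 1 :=
    hW.ac.ae_eq hgm.coeFn_toLp
  have horb : ∀ t : ℝ≥0, 0 < t → ∀ a : ℂ, 1 / 2 ≤ ‖a • (heatSemigroup hW ∞ b).op t v - g‖ := by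
    intro t ht a
    have hc := hW.continuous_heatConv (t := t) (by exact_mod_cast ht) (Lp.memLp v)
    refine half_le_norm_sub_indicator hn hW hg
      (F := fun x => a * ((Real.exp (-(t * b)) : ℂ) * heatConv n t v x)) (by fun_prop) ?_
    filter_upwards [(hT t ht v).2, hW.ac.ae_eq (Lp.coeFn_smul a
      ((heatSemigroup hW ∞ b).op t v))] with x h1 h2
    rw [h2, Pi.smul_apply, h1, smul_eq_mul, heatConv]
  have h0 : 1 / 2 ≤ ‖(0 : Lp ℂ ∞ (weightMeasure W)) - g‖ :=
    half_le_norm_sub_indicator hn hW hg (F := fun _ => 0) continuous_const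
      (hW.ac.ae_eq (Lp.coeFn_zero ℂ ∞ _))
  rw [zero_sub, norm_neg] at h0
  obtain ⟨_, ⟨t, rfl⟩, ht⟩ := hv.exists_dist_lt g (show (0 : ℝ) < 1 / 4 by norm_num)
  obtain ⟨_, ⟨s, rfl⟩, hs⟩ := hv.exists_dist_lt ((4 : ℂ) • g) (show (0 : ℝ) < 1 / 4 by norm_num)
  rw [dist_eq_norm, norm_sub_rev] at ht hs
  rcases eq_or_lt_of_le (zero_le (a := t)) with rfl | ht0
  -- The only vector of the orbit that may fail to be continuous is `v` itself, and it cannot be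
  -- close to both `g` and `4 g`.
  · rcases eq_or_lt_of_le (zero_le (a := s)) with rfl | hs0
    · have h3 : ‖(3 : ℂ) • g‖ < 1 / 2 := by
        have e : (3 : ℂ) • g = ((heatSemigroup hW ∞ b).op 0 v - g) -
            ((heatSemigroup hW ∞ b).op 0 v - (4 : ℂ) • g) := by
          module
        rw [e]
        exact (norm_sub_le _ _).trans_lt (by linarith)
      rw [norm_smul] at h3
      norm_num at h3
      linarith
    · have h4 := horb s hs0 (1 / 4)
      have e : (4 : ℂ) • ((1 / 4 : ℂ) • (heatSemigroup hW ∞ b).op s v - g) =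
          (heatSemigroup hW ∞ b).op s v - (4 : ℂ) • g := by
        rw [smul_sub, smul_smul]; norm_num
      rw [← e, norm_smul] at hs
      norm_num at hs h4
      linarith
  · have := horb t ht0 1
    rw [one_smul] at this
    linarith

end

/-! ### No hypercyclicity for `c ≤ c_p` -/

/-- Moments of a Gaussian of variance `2τ` centred at `2τa`. -/
theorem exists_integral_rpow_mul_gaussian_le {k a : ℝ} (hk : 0 ≤ k) (ha : 0 ≤ a) :
    ∃ K, 0 ≤ K ∧ ∀ τ : ℝ, 1 ≤ τ →
      IntegrableOn (fun r => r ^ k * Real.exp (-((r - 2 * τ * a) ^ 2 / (4 * τ)))) (Set.Ioi 0) ∧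
      ∫ r in Set.Ioi 0, r ^ k * Real.exp (-((r - 2 * τ * a) ^ 2 / (4 * τ))) ≤
        K * τ ^ (k + 1 / 2) := by
  obtain ⟨N, hN⟩ := exists_nat_ge k
  set C : ℝ := 2 ^ N * N.factorial * Real.exp (1 / 2) with hC
  have hC1 : ∀ x : ℝ, 0 ≤ x → (1 + x) ^ k ≤ C * Real.exp (x / 2) := by
    intro x hx
    have h1 := Real.pow_div_factorial_le_exp (x := (1 + x) / 2) (by positivity) N
    calc (1 + x) ^ k ≤ (1 + x) ^ (N : ℝ) := Real.rpow_le_rpow_of_exponent_le (by linarith) hN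
      _ = 2 ^ N * N.factorial * (((1 + x) / 2) ^ N / N.factorial) := by
        rw [Real.rpow_natCast, div_pow]; field_simp
      _ ≤ 2 ^ N * N.factorial * Real.exp ((1 + x) / 2) := by gcongr
      _ = C * Real.exp (x / 2) := by rw [hC, add_div, Real.exp_add]; ring
  refine ⟨(2 * a + 1) ^ k * C * √(8 * Real.pi), by positivity, fun τ hτ => ?_⟩
  have hτ0 : 0 < τ := by linarith
  have hgi : Integrable fun r : ℝ => Real.exp (-(1 / (8 * τ)) * (r - 2 * τ * a) ^ 2) :=
    (integrable_exp_neg_mul_sq (b := 1 / (8 * τ)) (by positivity)).comp_sub_right (2 * τ * a)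
  have hg : ∫ r : ℝ, Real.exp (-(1 / (8 * τ)) * (r - 2 * τ * a) ^ 2) =
      √(8 * Real.pi) * τ ^ (1 / 2 : ℝ) := by
    rw [integral_sub_right_eq_self (fun r : ℝ => Real.exp (-(1 / (8 * τ)) * r ^ 2)),
      integral_gaussian, ← Real.sqrt_eq_rpow, ← Real.sqrt_mul (by positivity)]
    congr 1
    field_simp
  have hbd : ∀ r : ℝ, 0 < r → r ^ k * Real.exp (-((r - 2 * τ * a) ^ 2 / (4 * τ))) ≤
      (2 * a + 1) ^ k * C * τ ^ k * Real.exp (-(1 / (8 * τ)) * (r - 2 * τ * a) ^ 2) := by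
    intro r hr
    set x := (r - 2 * τ * a) ^ 2 / (4 * τ) with hx
    have hx0 : 0 ≤ x := by positivity
    have h1 : r ≤ (2 * a + 1) * τ * (1 + x) := by
      have h2 : r - 2 * τ * a ≤ τ + x := by
        have e : τ + x - (r - 2 * τ * a) = (r - 2 * τ * a - 2 * τ) ^ 2 / (4 * τ) := by
          rw [hx]; field_simp; ring
        have : 0 ≤ (r - 2 * τ * a - 2 * τ) ^ 2 / (4 * τ) := by positivity
        linarith
      have h3 : x ≤ τ * x := le_mul_of_one_le_left hx0 hτ
      have h4 : 0 ≤ a * (τ * x) := by positivity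
      nlinarith
    have h5 : -(1 / (8 * τ)) * (r - 2 * τ * a) ^ 2 = -x + x / 2 := by
      rw [hx]; field_simp; ring
    rw [h5, Real.exp_add]
    calc r ^ k * Real.exp (-x) ≤ ((2 * a + 1) * τ * (1 + x)) ^ k * Real.exp (-x) := by
          gcongr
      _ = (2 * a + 1) ^ k * τ ^ k * (1 + x) ^ k * Real.exp (-x) := by
          rw [Real.mul_rpow (by positivity) (by positivity), Real.mul_rpow (by positivity) hτ0.le]
      _ ≤ (2 * a + 1) ^ k * τ ^ k * (C * Real.exp (x / 2)) * Real.exp (-x) := by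
          gcongr
          exact hC1 x hx0
      _ = _ := by ring
  have hi : IntegrableOn (fun r => r ^ k * Real.exp (-((r - 2 * τ * a) ^ 2 / (4 * τ))))
      (Set.Ioi 0) := by
    refine ((hgi.const_mul ((2 * a + 1) ^ k * C * τ ^ k)).integrableOn).mono'
      (Measurable.aestronglyMeasurable (by fun_prop)) ?_
    refine (ae_restrict_iff' measurableSet_Ioi).2 (Filter.Eventually.of_forall fun r hr => ?_)
    have hr : 0 < r := hr
    rw [Real.norm_of_nonneg (by positivity)]
    exact hbd r hr
  refine ⟨hi, ?_⟩
  calc _ ≤ ∫ r in Set.Ioi 0, (2 * a + 1) ^ k * C * τ ^ k *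
        Real.exp (-(1 / (8 * τ)) * (r - 2 * τ * a) ^ 2) :=
        setIntegral_mono_on hi (hgi.const_mul _).integrableOn measurableSet_Ioi fun r hr => hbd r hr
    _ ≤ ∫ r, (2 * a + 1) ^ k * C * τ ^ k *
        Real.exp (-(1 / (8 * τ)) * (r - 2 * τ * a) ^ 2) :=
        setIntegral_le_integral (hgi.const_mul _)
          (Filter.Eventually.of_forall fun r => by simp only [Pi.zero_apply]; positivity)
    _ = _ := by
        rw [integral_const_mul, hg, Real.rpow_add hτ0]
        ring

theorem lintegral_fun_norm {n : ℕ} (hn : 1 ≤ n) {g : ℝ → ℝ} (hg : ∀ r, 0 ≤ r → 0 ≤ g r)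
    (hi : IntegrableOn (fun r => r ^ (n - 1) * g r) (Set.Ioi 0)) :
    ∫⁻ x : EuclideanSpace ℝ (Fin n), ENNReal.ofReal (g ‖x‖) =
      ENNReal.ofReal (n * volume.real (Metric.ball (0 : EuclideanSpace ℝ (Fin n)) 1) *
        ∫ r in Set.Ioi 0, r ^ (n - 1) * g r) := by
  have : Nonempty (Fin n) := ⟨⟨0, hn⟩⟩
  have h1 : Integrable fun x : EuclideanSpace ℝ (Fin n) => g ‖x‖ := by
    rw [integrable_fun_norm_addHaar]
    simpa using hi
  rw [← ofReal_integral_eq_lintegral_ofReal h1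
    (Filter.Eventually.of_forall fun x => hg _ (norm_nonneg x)), integral_fun_norm_addHaar]
  simp [mul_assoc]

/-- The function `exp (a|x| - τa²) h_τ(x)` of `r = |x|`. It is a Gaussian of variance `2τ` in the
radial variable, centred at `r = 2τa`. -/
noncomputable def shellKernel (n : ℕ) (a τ r : ℝ) : ℝ :=
  (4 * Real.pi * τ) ^ (-((n : ℝ) / 2)) * Real.exp (-((r - 2 * τ * a) ^ 2 / (4 * τ)))

section

variable {n : ℕ} {a ρ τ : ℝ}

theorem shellKernel_pos (hτ : 0 < τ) (r : ℝ) : 0 < shellKernel n a τ r := by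
  unfold shellKernel; positivity

theorem exp_mul_heatKernel_eq (hτ : 0 < τ) (x : EuclideanSpace ℝ (Fin n)) :
    Real.exp (-(τ * a ^ 2)) * heatKernel n τ x =
      shellKernel n a τ ‖x‖ * Real.exp (-(a * ‖x‖)) := by
  unfold heatKernel shellKernel
  rw [mul_left_comm, mul_assoc ((4 * Real.pi * τ) ^ (-((n : ℝ) / 2))), ← Real.exp_add,
    ← Real.exp_add]
  congr 2
  field_simp
  ring

theorem shellKernel_le_one (hτ : 1 ≤ τ) (r : ℝ) : shellKernel n a τ r ≤ 1 := by
  have hτ0 : 0 < τ := by linarith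
  unfold shellKernel
  refine mul_le_one₀ ?_ (Real.exp_pos _).le (Real.exp_le_one_iff.2 ?_)
  · refine Real.rpow_le_one_of_one_le_of_nonpos ?_ (by simp; positivity)
    nlinarith [Real.pi_gt_three]
  · have : 0 ≤ (r - 2 * τ * a) ^ 2 / (4 * τ) := by positivity
    linarith

/-- In polar coordinates, the integrand has height `τ^(-n/2)` and volume factor `r^(n-1)`. Near
`r = 2τa` the denominator leaves `τ^((n-1)/2)`, and the width `√τ` makes the total bounded. -/
theorem exists_lintegral_shellKernel_div_le (hn : 1 ≤ n) (ha : 0 ≤ a) (hρ : 0 < ρ) :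
    ∃ K : ℝ, ∀ τ : ℝ, 1 ≤ τ → ∫⁻ x : EuclideanSpace ℝ (Fin n), ENNReal.ofReal
      (shellKernel n a τ ‖x‖ / (1 + ρ * ‖x‖) ^ (((n : ℝ) - 1) / 2)) ≤ ENNReal.ofReal K := by
  have hn1 : (1 : ℝ) ≤ n := by exact_mod_cast hn
  obtain ⟨K, hK0, hK⟩ := exists_integral_rpow_mul_gaussian_le (k := ((n : ℝ) - 1) / 2)
    (by linarith) ha
  refine ⟨n * volume.real (Metric.ball (0 : EuclideanSpace ℝ (Fin n)) 1) *
    ((4 * Real.pi) ^ (-((n : ℝ) / 2)) * (ρ ^ (((n : ℝ) - 1) / 2))⁻¹ * K), fun τ hτ => ?_⟩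
  have hτ0 : 0 < τ := by linarith
  obtain ⟨hi, hle⟩ := hK τ hτ
  set A : ℝ := (4 * Real.pi * τ) ^ (-((n : ℝ) / 2)) * (ρ ^ (((n : ℝ) - 1) / 2))⁻¹ with hA
  have hA0 : 0 ≤ A := by positivity
  have hbd : ∀ r : ℝ, 0 < r →
      r ^ (n - 1) * (shellKernel n a τ r / (1 + ρ * r) ^ (((n : ℝ) - 1) / 2)) ≤
      A * (r ^ (((n : ℝ) - 1) / 2) * Real.exp (-((r - 2 * τ * a) ^ 2 / (4 * τ)))) := by
    intro r hr
    have h1 : r ^ (n - 1) = r ^ (((n : ℝ) - 1) / 2) * r ^ (((n : ℝ) - 1) / 2) := by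
      rw [← Real.rpow_add hr, ← Real.rpow_natCast, Nat.cast_sub hn]
      congr 1; push_cast; ring
    have h2 : (ρ * r) ^ (((n : ℝ) - 1) / 2) ≤ (1 + ρ * r) ^ (((n : ℝ) - 1) / 2) :=
      Real.rpow_le_rpow (by positivity) (by linarith) (by linarith)
    calc _ ≤ r ^ (n - 1) * (shellKernel n a τ r / (ρ * r) ^ (((n : ℝ) - 1) / 2)) := by
          have := (shellKernel_pos (n := n) (a := a) hτ0 r).le
          gcongr
      _ = _ := by
          rw [h1, Real.mul_rpow hρ.le hr.le, hA, shellKernel]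
          field_simp
  have hi' : IntegrableOn (fun r : ℝ => r ^ (n - 1) *
      (shellKernel n a τ r / (1 + ρ * r) ^ (((n : ℝ) - 1) / 2))) (Set.Ioi 0) := by
    refine Integrable.mono' (hi.const_mul A)
      (Measurable.aestronglyMeasurable (by unfold shellKernel; fun_prop)) ?_
    refine (ae_restrict_iff' measurableSet_Ioi).2 (Filter.Eventually.of_forall fun r hr => ?_)
    have hr' : 0 < r := hr
    have := (shellKernel_pos (n := n) (a := a) hτ0 r).le
    rw [Real.norm_of_nonneg (by positivity)]
    exact hbd r hr
  rw [lintegral_fun_norm hn (g := fun r => shellKernel n a τ r /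
    (1 + ρ * r) ^ (((n : ℝ) - 1) / 2)) (fun r hr => div_nonneg (shellKernel_pos hτ0 r).le
      (by positivity)) hi']
  refine ENNReal.ofReal_le_ofReal (mul_le_mul_of_nonneg_left ?_ (by positivity))
  calc _ ≤ ∫ r in Set.Ioi 0, A * (r ^ (((n : ℝ) - 1) / 2) *
        Real.exp (-((r - 2 * τ * a) ^ 2 / (4 * τ)))) :=
        setIntegral_mono_on hi' (hi.const_mul A) measurableSet_Ioi hbd
    _ ≤ A * (K * τ ^ (((n : ℝ) - 1) / 2 + 1 / 2)) := by
        rw [integral_const_mul]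
        gcongr
    _ = _ := by
        rw [hA, Real.mul_rpow (by positivity) hτ0.le,
          show ((n : ℝ) - 1) / 2 + 1 / 2 = n / 2 by ring, Real.rpow_neg hτ0.le]
        have : τ ^ ((n : ℝ) / 2) ≠ 0 := by positivity
        field_simp

/-- The height `τ^(-n)` of the square compensates for the volume of the shell, which is of order
`τ^(n-1) √τ`. -/
theorem exists_lintegral_shellKernel_sq_le (hn : 1 ≤ n) (ha : 0 ≤ a) :
    ∃ K : ℝ, ∀ τ : ℝ, 1 ≤ τ → ∫⁻ x : EuclideanSpace ℝ (Fin n), ENNReal.ofReal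
      (shellKernel n a τ ‖x‖ ^ 2) ≤ ENNReal.ofReal K := by
  have hn1 : (1 : ℝ) ≤ n := by exact_mod_cast hn
  obtain ⟨K, hK0, hK⟩ := exists_integral_rpow_mul_gaussian_le (k := (n : ℝ) - 1)
    (by linarith) ha
  refine ⟨n * volume.real (Metric.ball (0 : EuclideanSpace ℝ (Fin n)) 1) *
    ((4 * Real.pi) ^ (-(n : ℝ)) * K), fun τ hτ => ?_⟩
  have hτ0 : 0 < τ := by linarith
  obtain ⟨hi, hle⟩ := hK τ hτ
  set A : ℝ := (4 * Real.pi * τ) ^ (-(n : ℝ)) with hA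
  have hA0 : 0 ≤ A := by positivity
  have hbd : ∀ r : ℝ, 0 < r → r ^ (n - 1) * (shellKernel n a τ r ^ 2) ≤
      A * (r ^ ((n : ℝ) - 1) * Real.exp (-((r - 2 * τ * a) ^ 2 / (4 * τ)))) := by
    intro r hr
    have h1 : r ^ (n - 1) = r ^ ((n : ℝ) - 1) := by
      rw [← Real.rpow_natCast, Nat.cast_sub hn, Nat.cast_one]
    have h2 : shellKernel n a τ r ^ 2 ≤ A * Real.exp (-((r - 2 * τ * a) ^ 2 / (4 * τ))) := by
      have h3 : ((4 * Real.pi * τ) ^ (-((n : ℝ) / 2))) ^ 2 = A := by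
        rw [hA, ← Real.rpow_natCast, ← Real.rpow_mul (by positivity)]
        congr 1; push_cast; ring
      have h4 : Real.exp (-((r - 2 * τ * a) ^ 2 / (4 * τ))) ≤ 1 :=
        Real.exp_le_one_iff.2 (by
          have : 0 ≤ (r - 2 * τ * a) ^ 2 / (4 * τ) := by positivity
          linarith)
      rw [shellKernel, mul_pow, h3, sq (Real.exp _)]
      gcongr
      exact mul_le_of_le_one_left (Real.exp_pos _).le h4
    rw [h1, mul_left_comm]
    gcongr
  have hi' : IntegrableOn (fun r : ℝ => r ^ (n - 1) * (shellKernel n a τ r ^ 2)) (Set.Ioi 0) := by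
    refine Integrable.mono' (hi.const_mul A)
      (Measurable.aestronglyMeasurable (by unfold shellKernel; fun_prop)) ?_
    refine (ae_restrict_iff' measurableSet_Ioi).2 (Filter.Eventually.of_forall fun r hr => ?_)
    have hr' : 0 < r := hr
    rw [Real.norm_of_nonneg (by positivity)]
    exact hbd r hr
  rw [lintegral_fun_norm hn (g := fun r => shellKernel n a τ r ^ 2)
    (fun r hr => sq_nonneg _) hi']
  refine ENNReal.ofReal_le_ofReal (mul_le_mul_of_nonneg_left ?_ (by positivity))
  calc _ ≤ ∫ r in Set.Ioi 0, A * (r ^ ((n : ℝ) - 1) *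
        Real.exp (-((r - 2 * τ * a) ^ 2 / (4 * τ)))) :=
        setIntegral_mono_on hi' (hi.const_mul A) measurableSet_Ioi hbd
    _ ≤ A * (K * τ ^ ((n : ℝ) - 1 + 1 / 2)) := by
        rw [integral_const_mul]
        gcongr
    _ ≤ A * (K * τ ^ (n : ℝ)) := by
        gcongr
        linarith
    _ = _ := by
        rw [hA, Real.mul_rpow (by positivity) hτ0.le, Real.rpow_neg hτ0.le]
        have : τ ^ (n : ℝ) ≠ 0 := by positivity
        field_simp

end

/-- For `p ≤ 2` the conjugate exponent `q` is at least `2` and Young's inequality suffices; for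
`p > 2` the function `(G B^(-γ))^q` interpolates between `G/B` and `G²`. -/
theorem mul_rpow_mul_le {p γ G B F : ℝ} (hp : 1 ≤ p) (hγ : γ = |2 / p - 1|) (hG0 : 0 ≤ G)
    (hG1 : G ≤ 1) (hB : 1 ≤ B) (hF : 0 ≤ F) :
    G * B ^ (-γ) * F ≤ G / B + G ^ 2 + F ^ p := by
  have hB0 : 0 < B := by linarith
  have hγ0 : 0 ≤ γ := hγ ▸ abs_nonneg _
  have hBγ : B ^ (-γ) ≤ 1 := Real.rpow_le_one_of_one_le_of_nonpos hB (by linarith)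
  have hBγ0 : 0 < B ^ (-γ) := by positivity
  have hx : G * B ^ (-γ) ≤ G := mul_le_of_le_one_right hG0 hBγ
  rcases hp.eq_or_lt with rfl | hp1
  · have : G * B ^ (-γ) * F ≤ F := mul_le_of_le_one_left hF (hx.trans hG1)
    rw [Real.rpow_one]
    have : 0 ≤ G / B + G ^ 2 := by positivity
    linarith
  have hp0 : 0 < p := by linarith
  have hpq := Real.HolderConjugate.conjExponent hp1
  set q := p.conjExponent with hq
  have hq1 : 1 < q := hpq.symm.lt
  have hqp : q = p / (p - 1) := rfl
  have hY := Real.young_inequality_of_nonneg (mul_nonneg hG0 hBγ0.le) hF hpq.symm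
  have h1 : (G * B ^ (-γ)) ^ q / q ≤ (G * B ^ (-γ)) ^ q :=
    div_le_self (by positivity) hq1.le
  have h2 : F ^ p / p ≤ F ^ p := div_le_self (by positivity) hp
  suffices (G * B ^ (-γ)) ^ q ≤ G / B + G ^ 2 by linarith
  rcases le_or_gt p 2 with hp2 | hp2
  · have hq2 : 2 ≤ q := by
      rw [hqp, le_div_iff₀ (by linarith)]; linarith
    have : (G * B ^ (-γ)) ^ q ≤ G ^ 2 := by
      calc (G * B ^ (-γ)) ^ q ≤ G ^ q := Real.rpow_le_rpow (by positivity) hx (by linarith)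
        _ ≤ G ^ (2 : ℝ) := Real.rpow_le_rpow_of_exponent_ge' hG0 hG1 (by norm_num) hq2
        _ = G ^ 2 := Real.rpow_two G
    have : 0 ≤ G / B := by positivity
    linarith
  · have hq2 : q < 2 := by
      rw [hqp, div_lt_iff₀ (by linarith)]; linarith
    have hγq : γ * q = 2 - q := by
      rw [hγ, abs_of_neg (by rw [sub_neg, div_lt_one hp0]; exact hp2), hqp]
      have : p - 1 ≠ 0 := by linarith
      field_simp
      ring
    have e : (G * B ^ (-γ)) ^ q = (G / B) ^ (2 - q) * (G ^ 2) ^ (q - 1) := by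
      rw [Real.mul_rpow hG0 hBγ0.le, ← Real.rpow_mul hB0.le, neg_mul, hγq,
        Real.div_rpow hG0 hB0.le, Real.rpow_neg hB0.le, ← Real.rpow_natCast G 2,
        ← Real.rpow_mul hG0, div_eq_mul_inv, mul_right_comm, ← Real.rpow_add_of_nonneg hG0
          (by linarith) (by push_cast; linarith)]
      congr 2
      push_cast; ring
    rw [e]
    have h3 := Real.geom_mean_le_arith_mean2_weighted (w₁ := 2 - q) (w₂ := q - 1) (p₁ := G / B)
      (p₂ := G ^ 2) (by linarith) (by linarith) (by positivity) (by positivity) (by ring)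
    have h4 : (2 - q) * (G / B) ≤ G / B := mul_le_of_le_one_left (by positivity) (by linarith)
    have h5 : (q - 1) * G ^ 2 ≤ G ^ 2 := mul_le_of_le_one_left (by positivity) (by linarith)
    linarith

section

variable {n : ℕ} {ρ : ℝ} {p : ℝ≥0∞}

theorem exists_le_besselBase (hn : 1 ≤ n) (hρ : 0 < ρ) :
    ∃ C, 0 < C ∧ ∀ x : EuclideanSpace ℝ (Fin n),
      C * ((1 + ρ * ‖x‖) ^ (((n : ℝ) - 1) / 2) * Real.exp (-(ρ * ‖x‖))) ≤ besselBase n ρ x := by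
  obtain ⟨C, hC0, hC⟩ := exists_le_besselV (ν := (n : ℝ) / 2) (by
    rcases hn.eq_or_lt with rfl | h
    · left; norm_num
    · right
      have : (2 : ℝ) ≤ n := by exact_mod_cast h
      linarith)
  refine ⟨2 ^ ((n : ℝ) / 2 - 1) * C, by positivity, fun x => ?_⟩
  have := hC (ρ * ‖x‖) (by positivity)
  rw [show (n : ℝ) / 2 - 1 / 2 = ((n : ℝ) - 1) / 2 by ring] at this
  rw [besselBase, mul_assoc]
  gcongr

/-- With `a = ρ γ_p`, the quantity `exp (-τa²) |h_τ * f(0)|` stays bounded as `τ → ∞`, for every `f`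
in the weighted `L^p` space. -/
theorem exists_exp_mul_lintegral_heatKernel_le (hn : 1 ≤ n) (hρ : 0 < ρ) [Fact (1 ≤ p)]
    (hp : p ≠ ∞) {f : EuclideanSpace ℝ (Fin n) → ℂ}
    (hf : MemLp f p (weightMeasure (besselWeight n ρ p))) :
    ∃ K : ℝ, ∀ τ : ℝ, 1 ≤ τ → ENNReal.ofReal (Real.exp (-(τ * (ρ * gammaExp p) ^ 2))) *
      ∫⁻ y, ENNReal.ofReal (heatKernel n τ y) * ‖f y‖ₑ ≤ ENNReal.ofReal K := by
  have hq := toReal_one_le (p := p) hp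
  have hp0 : p ≠ 0 := by rintro rfl; simp at hq; linarith
  have hW := isModerateWeight_besselWeight hn hρ p
  set γ := gammaExp p with hγ
  have hγ0 : 0 ≤ γ := gammaExp_nonneg p
  set a := ρ * γ with ha
  have ha0 : 0 ≤ a := by positivity
  obtain ⟨K1, hK1⟩ := exists_lintegral_shellKernel_div_le hn ha0 hρ
  obtain ⟨K2, hK2⟩ := exists_lintegral_shellKernel_sq_le hn ha0
  obtain ⟨C, hC0, hC⟩ := exists_le_besselBase (n := n) hn hρ
  have hfin := lintegral_rpow_enorm_lt_top_of_eLpNorm_lt_top hp0 hp hf.2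
  rw [hW.lintegral] at hfin
  set I := ∫⁻ x, ENNReal.ofReal (besselWeight n ρ p x) * ‖f x‖ₑ ^ p.toReal with hI
  have hn1 : (1 : ℝ) ≤ n := by exact_mod_cast hn
  have hpt : ∀ τ : ℝ, 1 ≤ τ → ∀ y : EuclideanSpace ℝ (Fin n),
      Real.exp (-(τ * a ^ 2)) * heatKernel n τ y * ‖f y‖ ≤ (C ^ γ)⁻¹ *
        (shellKernel n a τ ‖y‖ / (1 + ρ * ‖y‖) ^ (((n : ℝ) - 1) / 2) +
          shellKernel n a τ ‖y‖ ^ 2 + besselWeight n ρ p y * ‖f y‖ ^ p.toReal) := by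
    intro τ hτ y
    have hτ0 : 0 < τ := by linarith
    have hG0 := (shellKernel_pos (n := n) (a := a) hτ0 ‖y‖).le
    set B : ℝ := (1 + ρ * ‖y‖) ^ (((n : ℝ) - 1) / 2) with hB
    have hBone : 1 ≤ B := Real.one_le_rpow (by simp; positivity) (by linarith)
    have hB0 : 0 < B := by linarith
    have hv := besselBase_pos (ρ := ρ) hn y
    have h1 : C ^ γ * (B ^ γ * Real.exp (-(a * ‖y‖))) ≤ besselBase n ρ y ^ γ := by
      calc _ = (C * (B * Real.exp (-(ρ * ‖y‖)))) ^ γ := by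
            rw [Real.mul_rpow hC0.le (by positivity), Real.mul_rpow hB0.le (Real.exp_pos _).le,
              ← Real.exp_mul, ha]
            congr 4; ring
        _ ≤ _ := Real.rpow_le_rpow (by positivity) (hC y) hγ0
    have h2 : Real.exp (-(a * ‖y‖)) ≤ (C ^ γ)⁻¹ * (B ^ (-γ) * besselBase n ρ y ^ γ) := by
      rw [Real.rpow_neg hB0.le]
      calc Real.exp (-(a * ‖y‖)) = (C ^ γ)⁻¹ * ((B ^ γ)⁻¹ *
            (C ^ γ * (B ^ γ * Real.exp (-(a * ‖y‖))))) := by field_simp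
        _ ≤ _ := by gcongr
    have h3 := mul_rpow_mul_le hq (γ := γ) rfl hG0 (shellKernel_le_one hτ ‖y‖) hBone
      (F := ‖f y‖ * besselBase n ρ y ^ γ) (by positivity)
    rw [Real.mul_rpow (norm_nonneg _) (by positivity), ← Real.rpow_mul hv.le, ← besselWeight,
      mul_comm (_ ^ p.toReal)] at h3
    rw [exp_mul_heatKernel_eq hτ0]
    calc _ ≤ shellKernel n a τ ‖y‖ * ((C ^ γ)⁻¹ * (B ^ (-γ) * besselBase n ρ y ^ γ)) * ‖f y‖ := by
          gcongr
      _ = (C ^ γ)⁻¹ * (shellKernel n a τ ‖y‖ * B ^ (-γ) * (‖f y‖ * besselBase n ρ y ^ γ)) := by ring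
      _ ≤ _ := by gcongr
  refine ⟨(ENNReal.ofReal (C ^ γ)⁻¹ * (ENNReal.ofReal K1 + ENNReal.ofReal K2 + I)).toReal,
    fun τ hτ => ?_⟩
  have hτ0 : 0 < τ := by linarith
  rw [ENNReal.ofReal_toReal (ENNReal.mul_ne_top ENNReal.ofReal_ne_top (by simp [hfin.ne])),
    ← lintegral_const_mul' _ _ ENNReal.ofReal_ne_top]
  have hmeas : Measurable fun r : ℝ => shellKernel n a τ r := by unfold shellKernel; fun_prop
  calc _ ≤ ∫⁻ y, ENNReal.ofReal (C ^ γ)⁻¹ * (ENNReal.ofReal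
        (shellKernel n a τ ‖y‖ / (1 + ρ * ‖y‖) ^ (((n : ℝ) - 1) / 2)) +
          ENNReal.ofReal (shellKernel n a τ ‖y‖ ^ 2) +
          ENNReal.ofReal (besselWeight n ρ p y) * ‖f y‖ₑ ^ p.toReal) := by
        refine lintegral_mono fun y => ?_
        have hG0 := (shellKernel_pos (n := n) (a := a) hτ0 ‖y‖).le
        have hWy := (hW.pos y).le
        rw [← ofReal_norm, ENNReal.ofReal_rpow_of_nonneg (norm_nonneg _) (by linarith),
          ← ENNReal.ofReal_mul hWy, ← ENNReal.ofReal_add (by positivity) (by positivity),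
          ← ENNReal.ofReal_add (by positivity) (by positivity),
          ← ENNReal.ofReal_mul (by positivity : 0 ≤ (C ^ γ)⁻¹),
          ← ENNReal.ofReal_mul (heatKernel_pos hτ0 _).le, ← ENNReal.ofReal_mul (Real.exp_pos _).le]
        refine ENNReal.ofReal_le_ofReal ?_
        rw [← mul_assoc]
        exact hpt τ hτ y
    _ ≤ _ := by
        rw [lintegral_const_mul' _ _ ENNReal.ofReal_ne_top, lintegral_add_left (by fun_prop),
          lintegral_add_left (by fun_prop)]
        gcongr
        · exact hK1 τ hτ
        · exact hK2 τ hτ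

/-- If `a² ≤ b` with `a = ρ γ_p`, the continuous linear functional `f ↦ h_1 * f (0)` is bounded on
every orbit, so that no orbit is dense. -/
theorem not_isHypercyclic_heatSemigroup (hn : 1 ≤ n) (hρ : 0 < ρ) [Fact (1 ≤ p)] (hp : p ≠ ∞)
    {b : ℝ} (hb : (ρ * gammaExp p) ^ 2 ≤ b) :
    ¬ (heatSemigroup (isModerateWeight_besselWeight hn hρ p) p b).IsHypercyclic := by
  have hq := toReal_one_le (p := p) hp
  have hp0 : p ≠ 0 := by rintro rfl; simp at hq; linarith
  set hW := isModerateWeight_besselWeight hn hρ p with hW_def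
  rintro ⟨v, hv⟩
  have hT := isHeatSemigroupOn_heatSemigroup (p := p) hW b
  obtain ⟨C, hC⟩ := hW.exists_lintegral_le (p := p) one_pos 0
  let Λ : Lp ℂ p (weightMeasure (besselWeight n ρ p)) →L[ℂ] ℂ := LinearMap.mkContinuous
    { toFun := fun f => heatConv n 1 f 0
      map_add' := fun f g => by
        rw [heatConv_congr_ae (hW.ac.ae_eq (Lp.coeFn_add f g)), heatConv, heatConv, heatConv,
          ← integral_add (hW.integrable_heatKernel_mul one_pos (Lp.memLp f) 0)
            (hW.integrable_heatKernel_mul one_pos (Lp.memLp g) 0)]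
        simp only [Pi.add_apply, mul_add]
      map_smul' := fun c f => by
        rw [RingHom.id_apply, heatConv_congr_ae (hW.ac.ae_eq (Lp.coeFn_smul c f)), heatConv,
          heatConv, ← integral_smul]
        simp only [Pi.smul_apply, smul_eq_mul, mul_left_comm] } C fun f => by
      have h1 := (enorm_heatConv_le one_pos f 0).trans (hC f ((Lp.memLp f).1.mono_ac hW.ac))
      have h2 := ENNReal.toReal_mono (ENNReal.mul_ne_top ENNReal.coe_ne_top (Lp.memLp f).2.ne) h1
      simpa [Lp.norm_def] using h2
  have hΛ : ∀ f, Λ f = heatConv n 1 f 0 := fun f => rfl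
  -- The functional does not vanish on the function `exp (-M|x|)`.
  obtain ⟨f₀, hf₀⟩ : ∃ f, Λ f ≠ 0 := by
    set M : ℝ := ρ * (gammaExp p * p.toReal) + 1 with hM
    have hκ : 0 ≤ ρ * (gammaExp p * p.toReal) := by
      have := gammaExp_nonneg p
      positivity
    have hm : MemLp (fun x : EuclideanSpace ℝ (Fin n) => ((1 * Real.exp (-(M * ‖x‖)) : ℝ) : ℂ)) p
        (weightMeasure (besselWeight n ρ p)) :=
      (memLp_exp_neg hW hp0 hp (M := M) (by nlinarith) 1).ofReal
    refine ⟨hm.toLp _, ?_⟩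
    have hi := hW.integrable_heatKernel_mul one_pos hm 0
    rw [hΛ, heatConv_congr_ae (hW.ac.ae_eq hm.coeFn_toLp), heatConv]
    simp_rw [← Complex.ofReal_mul] at hi ⊢
    rw [integral_complex_ofReal, Complex.ofReal_ne_zero]
    have hpos : ∀ y : EuclideanSpace ℝ (Fin n),
        0 < heatKernel n 1 (0 - y) * (1 * Real.exp (-(M * ‖y‖))) := fun y =>
      mul_pos (heatKernel_pos one_pos _) (by positivity)
    refine ((integral_pos_iff_support_of_nonneg (fun y => (hpos y).le) ?_).2 ?_).ne'
    · simpa only [RCLike.re_to_complex, Complex.ofReal_re] using hi.re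
    · rw [show Function.support _ = Set.univ from Set.eq_univ_of_forall fun y => (hpos y).ne']
      exact Measure.measure_univ_pos.2 (NeZero.ne _)
  obtain ⟨K, hK⟩ := exists_exp_mul_lintegral_heatKernel_le hn hρ hp (Lp.memLp v)
  have hK0 : 0 ≤ max K 0 := le_max_right _ _
  have horb : ∀ t : ℝ≥0, ‖Λ ((heatSemigroup hW p b).op t v)‖ ≤
      Real.exp ((ρ * gammaExp p) ^ 2) * max K 0 := by
    intro t
    have e : Λ ((heatSemigroup hW p b).op t v) =
        (Real.exp (-(t * b)) : ℂ) * heatConv n (1 + t) v 0 := by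
      rcases eq_or_lt_of_le (zero_le (a := t)) with rfl | ht
      · rw [OperatorSemigroup.op_zero]
        simp [hΛ]
      · have ht' : 0 < (t : ℝ) := by exact_mod_cast ht
        rw [hΛ, heatConv_congr_ae (hT t ht v).2, ← heatConv_heatConv one_pos ht'
          ((Lp.memLp v).1.mono_ac hW.ac) fun s hs x => hW.integrable_heatKernel_mul hs (Lp.memLp v) x]
        rw [heatConv, heatConv, ← integral_const_mul]
        refine integral_congr_ae (Filter.Eventually.of_forall fun y => ?_)
        simp only [heatConv]
        ring
    have h1 : (1 : ℝ) ≤ 1 + t := by simp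
    have h2 := hK (1 + t) h1
    have h3 : Real.exp (-((1 + t) * (ρ * gammaExp p) ^ 2)) * ‖heatConv n (1 + t) v 0‖ ≤ max K 0 := by
      rw [← ENNReal.ofReal_le_ofReal_iff hK0, ENNReal.ofReal_mul (Real.exp_pos _).le, ofReal_norm]
      refine (mul_le_mul_right ((enorm_heatConv_le (by positivity) v 0).trans_eq ?_) _).trans
        (h2.trans (ENNReal.ofReal_le_ofReal (le_max_left _ _)))
      simp_rw [zero_sub, heatKernel_neg]
    rw [e, norm_mul, Complex.norm_of_nonneg (Real.exp_pos _).le]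
    calc _ ≤ Real.exp (-(t * (ρ * gammaExp p) ^ 2)) * ‖heatConv n (1 + t) v 0‖ := by
          gcongr
      _ = Real.exp ((ρ * gammaExp p) ^ 2) *
          (Real.exp (-((1 + t) * (ρ * gammaExp p) ^ 2)) * ‖heatConv n (1 + t) v 0‖) := by
          rw [← mul_assoc, ← Real.exp_add]
          congr 2; ring
      _ ≤ _ := by gcongr
  set L := Real.exp ((ρ * gammaExp p) ^ 2) * max K 0 with hL
  have hall : ∀ f, ‖Λ f‖ ≤ L := by
    intro f
    have hcl : IsClosed {f | ‖Λ f‖ ≤ L} := isClosed_le (by fun_prop) continuous_const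
    have : closure (Set.range fun t : ℝ≥0 => (heatSemigroup hW p b).op t v) ⊆ {f | ‖Λ f‖ ≤ L} :=
      closure_minimal (by rintro _ ⟨t, rfl⟩; exact horb t) hcl
    exact this (hv f)
  have h4 := hall (((L + 1 : ℝ) : ℂ) • (Λ f₀)⁻¹ • f₀)
  rw [map_smul, map_smul, smul_eq_mul, smul_eq_mul, inv_mul_cancel₀ hf₀, mul_one,
    Complex.norm_real] at h4
  linarith [Real.le_norm_self (L + 1)]

end

/-! ### Criteria for hypercyclicity and for density -/

namespace OperatorSemigroup

variable {X : Type*} [NormedAddCommGroup X] [NormedSpace ℂ X]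

/-- Birkhoff's transitivity theorem: by Baire's theorem, a topologically transitive semigroup on a
separable Banach space has a dense orbit. -/
theorem isHypercyclic_of_transitive [CompleteSpace X] [SecondCountableTopology X]
    (T : OperatorSemigroup X) (h : ∀ U V : Set X, IsOpen U → U.Nonempty → IsOpen V → V.Nonempty →
      ∃ t, ∃ x ∈ U, T.op t x ∈ V) : T.IsHypercyclic := by
  have hB := TopologicalSpace.isBasis_countableBasis X
  have hd : Dense (⋂ V ∈ TopologicalSpace.countableBasis X, ⋃ t, T.op t ⁻¹' V) := by
    refine dense_biInter_of_isOpen (fun V hV => isOpen_iUnion fun t =>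
      (hB.isOpen hV).preimage (T.op t).continuous) (TopologicalSpace.countable_countableBasis X)
      fun V hV => dense_iff_inter_open.2 fun U hU hUne => ?_
    obtain ⟨t, x, hx, hxV⟩ := h U V hU hUne (hB.isOpen hV)
      (TopologicalSpace.nonempty_of_mem_countableBasis hV)
    exact ⟨x, hx, Set.mem_iUnion.2 ⟨t, hxV⟩⟩
  obtain ⟨v, hv⟩ := hd.nonempty
  refine ⟨v, hB.dense_iff.2 fun V hV _ => ?_⟩
  obtain ⟨t, ht⟩ := Set.mem_iUnion.1 (Set.mem_iInter₂.1 hv V hV)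
  exact ⟨_, ht, t, rfl⟩

/-- The hypercyclicity criterion: the orbits of a dense set of vectors tend to zero, and a dense set
of vectors has preimages under `T_t` that tend to zero. -/
theorem isHypercyclic_of_dense [CompleteSpace X] [SecondCountableTopology X]
    (T : OperatorSemigroup X) {D₁ D₂ : Set X} (hD₁ : Dense D₁) (hD₂ : Dense D₂)
    (h₁ : ∀ v ∈ D₁, Filter.Tendsto (fun t => T.op t v) Filter.atTop (nhds 0))
    (h₂ : ∀ w ∈ D₂, ∃ u : ℝ≥0 → X, Filter.Tendsto u Filter.atTop (nhds 0) ∧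
      ∀ t, T.op t (u t) = w) : T.IsHypercyclic := by
  refine T.isHypercyclic_of_transitive fun U V hU hUne hV hVne => ?_
  obtain ⟨v, hvU, hv⟩ := hD₁.inter_open_nonempty U hU hUne
  obtain ⟨w, hwV, hw⟩ := hD₂.inter_open_nonempty V hV hVne
  obtain ⟨u, hu, huw⟩ := h₂ w hw
  have l1 : Filter.Tendsto (fun t => v + u t) Filter.atTop (nhds v) := by
    simpa using hu.const_add v
  have l2 : Filter.Tendsto (fun t => T.op t (v + u t)) Filter.atTop (nhds w) := by
    simpa [map_add, huw] using (h₁ v hv).add_const w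
  obtain ⟨t, ht1, ht2⟩ := ((l1.eventually (hU.mem_nhds hvU)).and
    (l2.eventually (hV.mem_nhds hwV))).exists
  exact ⟨t, _, ht1, ht2⟩

theorem op_nsmul_eq_self (T : OperatorSemigroup X) {t : ℝ≥0} {v : X} (h : T.op t v = v) (k : ℕ) :
    T.op (k • t) v = v := by
  induction k with
  | zero => rw [zero_smul, T.op_zero]; rfl
  | succ k ih => rw [succ_nsmul, T.op_add, ContinuousLinearMap.comp_apply, h, ih]

/-- The Godefroy–Shapiro criterion for semigroups. -/
theorem isChaotic_of_eigenvectors [CompleteSpace X] [SecondCountableTopology X]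
    (T : OperatorSemigroup X) {S₁ S₂ S₃ : Set X}
    (hS₁ : Dense (Submodule.span ℂ S₁ : Set X)) (hS₂ : Dense (Submodule.span ℂ S₂ : Set X))
    (hS₃ : Dense (Submodule.span ℂ S₃ : Set X))
    (h₁ : ∀ v ∈ S₁, ∃ μ : ℂ, μ.re < 0 ∧ ∀ t, T.op t v = Complex.exp (t * μ) • v)
    (h₂ : ∀ v ∈ S₂, ∃ μ : ℂ, 0 < μ.re ∧ ∀ t, T.op t v = Complex.exp (t * μ) • v)
    (h₃ : ∀ v ∈ S₃, ∃ m : ℕ, 0 < m ∧ T.op m v = v) : T.IsChaotic := by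
  have hexp : ∀ μ : ℂ, μ.re < 0 → ∀ v : X, Filter.Tendsto
      (fun t : ℝ≥0 => Complex.exp (t * μ) • v) Filter.atTop (nhds 0) := by
    intro μ hμ v
    have h : Filter.Tendsto (fun t : ℝ≥0 => Real.exp (t * μ.re)) Filter.atTop (nhds 0) :=
      Real.tendsto_exp_atBot.comp
        ((NNReal.tendsto_coe_atTop.2 Filter.tendsto_id).atTop_mul_const_of_neg hμ)
    rw [tendsto_zero_iff_norm_tendsto_zero]
    have h' := h.mul_const ‖v‖
    rw [zero_mul] at h'
    refine h'.congr fun t => ?_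
    rw [norm_smul, Complex.norm_exp]
    simp
  refine ⟨T.isHypercyclic_of_dense hS₁ hS₂ (fun v hv => ?_) fun w hw => ?_, hS₃.mono fun v hv => ?_⟩
  · induction hv using Submodule.span_induction with
    | mem v hv =>
      obtain ⟨μ, hμ, he⟩ := h₁ v hv
      simp_rw [he]
      exact hexp μ hμ v
    | zero => simp
    | add v w _ _ hv hw => simpa [map_add] using hv.add hw
    | smul c v _ hv => simpa [map_smul] using hv.const_smul c
  · induction hw using Submodule.span_induction with
    | mem v hv =>
      obtain ⟨μ, hμ, he⟩ := h₂ v hv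
      refine ⟨fun t => Complex.exp (t * (-μ)) • v, hexp (-μ) (by simpa using hμ) v, fun t => ?_⟩
      rw [map_smul, he, smul_smul, ← Complex.exp_add]
      simp
    | zero => exact ⟨fun _ => 0, tendsto_const_nhds, fun t => map_zero _⟩
    | add v w _ _ hv hw =>
      obtain ⟨u, hu, hu'⟩ := hv
      obtain ⟨u₂, hu₂, hu₂'⟩ := hw
      exact ⟨fun t => u t + u₂ t, by simpa using hu.add hu₂, fun t => by rw [map_add, hu', hu₂']⟩
    | smul c v _ hv =>
      obtain ⟨u, hu, hu'⟩ := hv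
      exact ⟨fun t => c • u t, by simpa using hu.const_smul c, fun t => by rw [map_smul, hu']⟩
  -- Integer periods have common multiples, so that sums of periodic points are periodic.
  · suffices ∃ m : ℕ, 0 < m ∧ T.op m v = v by
      obtain ⟨m, hm, h⟩ := this
      exact ⟨m, by exact_mod_cast hm, h⟩
    induction hv using Submodule.span_induction with
    | mem v hv => exact h₃ v hv
    | zero => exact ⟨1, one_pos, map_zero _⟩
    | add v w _ _ hv hw =>
      obtain ⟨m, hm, hm'⟩ := hv
      obtain ⟨k, hk, hk'⟩ := hw
      refine ⟨m * k, Nat.mul_pos hm hk, ?_⟩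
      have e1 := T.op_nsmul_eq_self hm' k
      have e2 := T.op_nsmul_eq_self hk' m
      rw [nsmul_eq_mul, ← Nat.cast_mul] at e1 e2
      rw [map_add, e2, mul_comm m k, e1]
    | smul c v _ hv =>
      obtain ⟨m, hm, hm'⟩ := hv
      exact ⟨m, hm, by rw [map_smul, hm']⟩

end OperatorSemigroup

/-- A consequence of the Hahn–Banach theorem. -/
theorem dense_of_forall_dual_eq_zero {X : Type*} [NormedAddCommGroup X] [NormedSpace ℂ X]
    (S : Submodule ℂ X) (h : ∀ φ : X →L[ℂ] ℂ, (∀ x ∈ S, φ x = 0) → φ = 0) :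
    Dense (S : Set X) := by
  by_contra hS
  have hcl : IsClosed (S.topologicalClosure : Set X) := S.isClosed_topologicalClosure
  obtain ⟨x, hx⟩ : ∃ x, x ∉ S.topologicalClosure := by
    by_contra! hall
    exact hS fun x => hall x
  have hx0 : ‖S.topologicalClosure.mkQL x‖ ≠ 0 := by
    rw [norm_ne_zero_iff]
    intro h0
    exact hx ((Submodule.Quotient.mk_eq_zero _).1 h0)
  obtain ⟨g, -, hg⟩ := exists_dual_vector ℂ (S.topologicalClosure.mkQL x) hx0
  have hφ := h (g.comp S.topologicalClosure.mkQL) fun y hy => by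
    rw [ContinuousLinearMap.comp_apply]
    have : S.topologicalClosure.mkQL y = 0 :=
      (Submodule.Quotient.mk_eq_zero _).2 (S.le_topologicalClosure hy)
    rw [this, map_zero]
  have h1 := congrArg (fun ψ => ψ x) hφ
  simp only [ContinuousLinearMap.comp_apply, zero_apply] at h1
  rw [hg] at h1
  exact hx0 (Complex.ofReal_eq_zero.1 h1)

/-! ### Plane waves -/

/-- The exponential `x ↦ exp (i z ⟨ω, x⟩)` with complex frequency `z` in the direction `ω`. -/
noncomputable def planeWave {n : ℕ} (z : ℂ) (ω x : EuclideanSpace ℝ (Fin n)) : ℂ :=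
  Complex.exp (Complex.I * z * (inner ℝ ω x : ℝ))

open Classical in
/-- The plane wave as an element of `L^p(μ)`, or `0` if it does not belong to this space. -/
noncomputable def planeWaveLp {n : ℕ} (p : ℝ≥0∞) (μ : Measure (EuclideanSpace ℝ (Fin n))) (z : ℂ)
    (ω : EuclideanSpace ℝ (Fin n)) : Lp ℂ p μ :=
  if h : MemLp (planeWave z ω) p μ then h.toLp _ else 0

section

variable {n : ℕ}

theorem continuous_planeWave (z : ℂ) (ω : EuclideanSpace ℝ (Fin n)) :
    Continuous (planeWave z ω) := by
  unfold planeWave; fun_prop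

theorem norm_planeWave (z : ℂ) (ω x : EuclideanSpace ℝ (Fin n)) :
    ‖planeWave z ω x‖ = Real.exp (-(z.im * inner ℝ ω x)) := by
  rw [planeWave, Complex.norm_exp]
  congr 1
  simp [Complex.mul_re]

theorem norm_planeWave_le {z : ℂ} {ω : EuclideanSpace ℝ (Fin n)} (hω : ‖ω‖ = 1)
    (x : EuclideanSpace ℝ (Fin n)) : ‖planeWave z ω x‖ ≤ Real.exp (|z.im| * ‖x‖) := by
  rw [norm_planeWave]
  refine Real.exp_le_exp.2 ((neg_le_abs _).trans ?_)
  rw [abs_mul]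
  gcongr
  simpa [hω] using abs_real_inner_le_norm ω x

theorem coeFn_planeWaveLp {p : ℝ≥0∞} {μ : Measure (EuclideanSpace ℝ (Fin n))} {z : ℂ}
    {ω : EuclideanSpace ℝ (Fin n)} (h : MemLp (planeWave z ω) p μ) :
    planeWaveLp p μ z ω =ᵐ[μ] planeWave z ω := by
  rw [planeWaveLp, dif_pos h]
  exact h.coeFn_toLp

/-- Plane waves are eigenfunctions of the heat operators, by the formula for the Fourier transform
of a Gaussian at complex frequencies. -/
theorem heatConv_planeWave {t : ℝ} (ht : 0 < t) (z : ℂ) {ω : EuclideanSpace ℝ (Fin n)}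
    (hω : ‖ω‖ = 1) (x : EuclideanSpace ℝ (Fin n)) :
    heatConv n t (planeWave z ω) x = Complex.exp (-(t * z ^ 2)) * planeWave z ω x := by
  have hb : 0 < ((1 / (4 * t) : ℝ) : ℂ).re := by rw [Complex.ofReal_re]; positivity
  have h := GaussianFourier.integral_cexp_neg_mul_sq_norm_add (V := EuclideanSpace ℝ (Fin n)) hb
    (-(Complex.I * z)) ω
  have hpt : ∀ y : EuclideanSpace ℝ (Fin n), (heatKernel n t y : ℂ) * planeWave z ω (x - y) =
      (((4 * Real.pi * t) ^ (-((n : ℝ) / 2)) : ℝ) : ℂ) * planeWave z ω x *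
      Complex.exp (-((1 / (4 * t) : ℝ) : ℂ) * ‖y‖ ^ 2 + -(Complex.I * z) * (inner ℝ ω y : ℝ)) := by
    intro y
    simp only [heatKernel, planeWave, inner_sub_right]
    have h1 : ∀ A B C D E : ℂ, B * C = D * E → A * B * C = A * D * E := fun A B C D E h => by
      rw [mul_assoc, h, mul_assoc]
    push_cast
    apply h1
    rw [← Complex.exp_add, ← Complex.exp_add]
    congr 1
    field_simp
    ring
  have e : heatConv n t (planeWave z ω) x = ∫ y, (heatKernel n t y : ℂ) * planeWave z ω (x - y) := by
    rw [heatConv, ← integral_sub_left_eq_self _ _ x]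
    simp
  rw [e]
  simp_rw [hpt]
  rw [integral_const_mul, h, hω, finrank_euclideanSpace_fin]
  have h4 : (Real.pi : ℂ) / ((1 / (4 * t) : ℝ) : ℂ) = ((4 * Real.pi * t : ℝ) : ℂ) := by
    push_cast
    field_simp
  have h5 : ((4 * Real.pi * t : ℝ) : ℂ) ^ ((n : ℂ) / 2) =
      (((4 * Real.pi * t) ^ ((n : ℝ) / 2) : ℝ) : ℂ) := by
    rw [Complex.ofReal_cpow (by positivity)]
    push_cast
    rfl
  have h6 : (((4 * Real.pi * t) ^ (-((n : ℝ) / 2)) : ℝ) : ℂ) *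
      (((4 * Real.pi * t) ^ ((n : ℝ) / 2) : ℝ) : ℂ) = 1 := by
    rw [← Complex.ofReal_mul, ← Real.rpow_add (by positivity)]
    simp
  have h7 : (-(Complex.I * z)) ^ 2 * ((1 : ℝ) : ℂ) ^ 2 / (4 * ((1 / (4 * t) : ℝ) : ℂ)) =
      -(t * z ^ 2) := by
    have : (t : ℂ) ≠ 0 := by exact_mod_cast ht.ne'
    push_cast
    field_simp
    rw [Complex.I_sq]
    ring
  rw [h4, h5, h7]
  linear_combination planeWave z ω x * Complex.exp (-(t * z ^ 2)) * h6

end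

/-! ### Density of the characters -/

section

variable {n : ℕ} {p : ℝ≥0∞} {μ : Measure (EuclideanSpace ℝ (Fin n))}

/-- Integration over a set, as a continuous functional on `L^p` of a finite measure. -/
theorem exists_clm_eq_setIntegral [IsFiniteMeasure μ] [Fact (1 ≤ p)]
    (s : Set (EuclideanSpace ℝ (Fin n))) :
    ∃ ψ : Lp ℂ p μ →L[ℂ] ℂ, ∀ f, ψ f = ∫ x in s, f x ∂μ := by
  have hp1 : 1 ≤ p := Fact.out
  have hi : ∀ f : Lp ℂ p μ, Integrable f μ := fun f => (Lp.memLp f).integrable hp1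
  set M := μ Set.univ ^ (1 / (1 : ℝ≥0∞).toReal - 1 / p.toReal) with hM
  have hMtop : M ≠ ∞ := by
    refine ENNReal.rpow_ne_top_of_nonneg ?_ (measure_ne_top μ _)
    rcases ENNReal.dichotomy p with h | h
    · simp [h]
    · rw [ENNReal.toReal_one, sub_nonneg]
      exact one_div_le_one_div_of_le one_pos h
  refine ⟨LinearMap.mkContinuous
    { toFun := fun f => ∫ x in s, f x ∂μ
      map_add' := fun f g => by
        rw [← integral_add (hi f).integrableOn (hi g).integrableOn]
        exact integral_congr_ae (ae_restrict_of_ae (Lp.coeFn_add f g))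
      map_smul' := fun c f => by
        rw [RingHom.id_apply, ← integral_smul]
        exact integral_congr_ae (ae_restrict_of_ae (Lp.coeFn_smul c f)) } M.toReal
    fun f => ?_, fun f => rfl⟩
  have h1 : ‖∫ x in s, f x ∂μ‖ₑ ≤ M * eLpNorm f p μ := by
    calc _ ≤ ∫⁻ x in s, ‖f x‖ₑ ∂μ := enorm_integral_le_lintegral_enorm _
      _ ≤ ∫⁻ x, ‖f x‖ₑ ∂μ := setLIntegral_le_lintegral _ _
      _ = eLpNorm f 1 μ := eLpNorm_one_eq_lintegral_enorm.symm
      _ ≤ _ := (eLpNorm_le_eLpNorm_mul_rpow_measure_univ hp1 (Lp.memLp f).1).trans_eq (mul_comm _ _)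
  have h2 := ENNReal.toReal_mono (ENNReal.mul_ne_top hMtop (Lp.memLp f).2.ne) h1
  simpa [Lp.norm_def] using h2

theorem memLp_character [IsFiniteMeasure μ] (v : EuclideanSpace ℝ (Fin n)) :
    MemLp (fun x => Complex.exp ((2 * Real.pi * inner ℝ v x : ℝ) * Complex.I)) p μ :=
  MemLp.of_bound (Continuous.aestronglyMeasurable (by fun_prop)) 1
    (Filter.Eventually.of_forall fun x => by rw [Complex.norm_exp_ofReal_mul_I])

/-- A functional on `L^p` of a finite measure that vanishes on all characters is zero: by Fourier
inversion, a Schwartz function is an integral of characters, and Schwartz functions are dense. -/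
theorem eq_zero_of_forall_character [IsFiniteMeasure μ] [Fact (1 ≤ p)] (hp : p ≠ ∞)
    (φ : Lp ℂ p μ →L[ℂ] ℂ) (h : ∀ v, φ ((memLp_character v).toLp _) = 0) : φ = 0 := by
  have hp0 : p ≠ 0 := (one_pos.trans_le (Fact.out : 1 ≤ p)).ne'
  set χ : EuclideanSpace ℝ (Fin n) → Lp ℂ p μ := fun v => (memLp_character v).toLp _ with hχ
  have hχc : Continuous χ := by
    refine continuous_iff_continuousAt.2 fun v₀ => ?_
    rw [ContinuousAt, hχ, Lp.tendsto_Lp_iff_tendsto_eLpNorm'']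
    refine tendsto_eLpNorm_sub_of_dominated hp0 hp (bound := fun _ => 2)
      (Filter.Eventually.of_forall fun v => (memLp_character (p := p) v).1)
      (memLp_character (p := p) v₀).1 (memLp_const 2) ?_ ?_
    · refine Filter.Eventually.of_forall fun v => Filter.Eventually.of_forall fun x => ?_
      refine (norm_sub_le _ _).trans ?_
      rw [Complex.norm_exp_ofReal_mul_I, Complex.norm_exp_ofReal_mul_I]
      norm_num
    · refine Filter.Eventually.of_forall fun x => ?_
      have : Continuous fun v : EuclideanSpace ℝ (Fin n) =>
          Complex.exp ((2 * Real.pi * inner ℝ v x : ℝ) * Complex.I) := by fun_prop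
      exact this.tendsto v₀
  have hχb : ∀ v, ‖χ v‖ ≤ (μ Set.univ ^ p.toReal⁻¹).toReal := by
    intro v
    rw [hχ, Lp.norm_toLp]
    refine ENNReal.toReal_mono (ENNReal.rpow_ne_top_of_nonneg (by simp) (measure_ne_top μ _)) ?_
    refine (eLpNorm_le_of_ae_bound (C := 1) (Filter.Eventually.of_forall fun x => ?_)).trans
      (by simp)
    rw [Complex.norm_exp_ofReal_mul_I]
  have hS : ∀ f : SchwartzMap (EuclideanSpace ℝ (Fin n)) ℂ, φ (f.toLp p μ) = 0 := by
    intro f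
    set G : SchwartzMap (EuclideanSpace ℝ (Fin n)) ℂ := FourierTransform.fourier f with hG
    have hGi : Integrable G := G.integrable
    have hf : ∀ x, f x = ∫ v, Complex.exp (↑(2 * Real.pi * inner ℝ v x) * Complex.I) • G v := by
      intro x
      rw [← Real.fourierInv_eq', ← SchwartzMap.fourierInv_coe, hG]
      simp
    have hint : Integrable fun v => G v • χ v := by
      refine (hGi.norm.mul_const (μ Set.univ ^ p.toReal⁻¹).toReal).mono'
        (G.continuous.smul hχc).aestronglyMeasurable (Filter.Eventually.of_forall fun v => ?_)
      rw [norm_smul]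
      gcongr
      exact hχb v
    -- Fourier inversion as an identity of Bochner integrals in `L^p(μ)`, checked on sets.
    have hI : f.toLp p μ = ∫ v, G v • χ v := by
      refine Lp.ext (Lp.ae_eq_of_forall_setIntegral_eq _ _ hp0 hp
        (fun s _ _ => ((Lp.memLp _).integrable Fact.out).integrableOn)
        (fun s _ _ => ((Lp.memLp _).integrable Fact.out).integrableOn) fun s hs _ => ?_)
      obtain ⟨ψ, hψ⟩ := exists_clm_eq_setIntegral (p := p) (μ := μ) s
      rw [← hψ (∫ v, G v • χ v), ← ContinuousLinearMap.integral_comp_comm ψ hint]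
      have e1 : ∫ x in s, f.toLp p μ x ∂μ =
          ∫ x in s, (∫ v, Complex.exp (↑(2 * Real.pi * inner ℝ v x) * Complex.I) • G v) ∂μ := by
        refine integral_congr_ae (ae_restrict_of_ae ?_)
        filter_upwards [f.coeFn_toLp p μ] with x hx
        rw [hx, hf]
      rw [e1, integral_integral_swap]
      · refine integral_congr_ae (Filter.Eventually.of_forall fun v => ?_)
        simp only [smul_eq_mul]
        rw [map_smul, hψ, smul_eq_mul, integral_mul_const, mul_comm]
        congr 1
        exact integral_congr_ae (ae_restrict_of_ae (memLp_character (p := p) v).coeFn_toLp.symm)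
      · have h1 : Integrable (fun z : EuclideanSpace ℝ (Fin n) × EuclideanSpace ℝ (Fin n) =>
            (1 : ℂ) * G z.2) ((μ.restrict s).prod volume) :=
          Integrable.mul_prod (integrable_const _) hGi
        refine h1.norm.mono' ?_ (Filter.Eventually.of_forall fun z => ?_)
        · have := G.continuous
          exact Continuous.aestronglyMeasurable (by
            simp only [Function.uncurry_def]
            fun_prop)
        · simp only [Function.uncurry_def]
          rw [norm_smul, Complex.norm_exp_ofReal_mul_I, one_mul, one_mul]
    rw [hI, ← ContinuousLinearMap.integral_comp_comm φ hint]
    simp only [map_smul, smul_eq_mul]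
    refine integral_eq_zero_of_ae (Filter.Eventually.of_forall fun v => ?_)
    simp only [Pi.zero_apply]
    rw [hχ, h v, mul_zero]
  have hdense : DenseRange fun f : SchwartzMap (EuclideanSpace ℝ (Fin n)) ℂ => f.toLp p μ := by
    have := SchwartzMap.denseRange_toLpCLM (E := EuclideanSpace ℝ (Fin n)) (F := ℂ) (p := p)
      (μ := μ) hp
    exact this
  refine ContinuousLinearMap.ext fun u => ?_
  exact congrFun (hdense.equalizer φ.continuous continuous_zero (funext hS)) u

end

/-! ### Analyticity of the plane waves and density of their spans -/

section

variable {n : ℕ} {p : ℝ≥0∞} {μ : Measure (EuclideanSpace ℝ (Fin n))} {a : ℝ} {z : ℂ}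
  {ω : EuclideanSpace ℝ (Fin n)}

theorem memLp_planeWave
    (hE : ∀ s < a, MemLp (fun x : EuclideanSpace ℝ (Fin n) => Real.exp (s * ‖x‖)) p μ)
    (hz : |z.im| < a) (hω : ‖ω‖ = 1) : MemLp (planeWave z ω) p μ :=
  (hE _ hz).mono (continuous_planeWave z ω).aestronglyMeasurable
    (Filter.Eventually.of_forall fun x => by
      rw [Real.norm_of_nonneg (Real.exp_pos _).le]
      exact norm_planeWave_le hω x)

/-- The second-order Taylor remainder of `z ↦ exp (i z ⟨ω, x⟩)`. The factor `|x|²` is absorbed by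
slightly enlarging the exponential rate. -/
theorem norm_planeWave_remainder_le {δ : ℝ} (hδ : 0 < δ) (hω : ‖ω‖ = 1) {h : ℂ} (hh : ‖h‖ ≤ δ)
    (x : EuclideanSpace ℝ (Fin n)) :
    ‖planeWave (z + h) ω x - planeWave z ω x -
        h * (Complex.I * (inner ℝ ω x : ℝ) * planeWave z ω x)‖ ≤
      ‖h‖ ^ 2 * (2 / δ ^ 2) * Real.exp ((|z.im| + 2 * δ) * ‖x‖) := by
  set r : ℝ := inner ℝ ω x with hr
  have hrx : |r| ≤ ‖x‖ := by simpa [hω] using abs_real_inner_le_norm ω x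
  have e : planeWave (z + h) ω x - planeWave z ω x - h * (Complex.I * r * planeWave z ω x) =
      planeWave z ω x * (Complex.exp (Complex.I * h * r) -
        ∑ m ∈ Finset.range 2, (Complex.I * h * r) ^ m / m.factorial) := by
    have : planeWave (z + h) ω x = planeWave z ω x * Complex.exp (Complex.I * h * r) := by
      rw [planeWave, planeWave, ← Complex.exp_add]
      congr 1
      ring
    rw [this]
    simp [Finset.sum_range_succ]
    ring
  have hw : ‖Complex.I * h * r‖ = ‖h‖ * |r| := by simp
  have h1 := Complex.norm_exp_sub_sum_le_norm_mul_exp (Complex.I * h * r) 2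
  have h2 : (δ * ‖x‖) ^ 2 ≤ 2 * Real.exp (δ * ‖x‖) := by
    have := Real.pow_div_factorial_le_exp (x := δ * ‖x‖) (by positivity) 2
    rw [div_le_iff₀ (by positivity)] at this
    simpa [mul_comm] using this
  rw [e, norm_mul]
  calc _ ≤ Real.exp (|z.im| * ‖x‖) * (‖Complex.I * h * r‖ ^ 2 * Real.exp ‖Complex.I * h * r‖) := by
        gcongr
        exact norm_planeWave_le hω x
    _ ≤ Real.exp (|z.im| * ‖x‖) * ((‖h‖ * ‖x‖) ^ 2 * Real.exp (δ * ‖x‖)) := by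
        rw [hw]
        gcongr
    _ = ‖h‖ ^ 2 / δ ^ 2 * (δ * ‖x‖) ^ 2 * Real.exp ((|z.im| + δ) * ‖x‖) := by
        rw [add_mul, Real.exp_add]
        field_simp
    _ ≤ ‖h‖ ^ 2 / δ ^ 2 * (2 * Real.exp (δ * ‖x‖)) * Real.exp ((|z.im| + δ) * ‖x‖) := by
        gcongr
    _ = _ := by
        rw [show (|z.im| + 2 * δ) * ‖x‖ = δ * ‖x‖ + (|z.im| + δ) * ‖x‖ by ring, Real.exp_add]
        ring

/-- On the strip where the plane waves belong to `L^p(μ)`, they depend holomorphically on the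
frequency. -/
theorem differentiableAt_planeWaveLp [Fact (1 ≤ p)]
    (hE : ∀ s < a, MemLp (fun x : EuclideanSpace ℝ (Fin n) => Real.exp (s * ‖x‖)) p μ)
    (hz : |z.im| < a) (hω : ‖ω‖ = 1) : DifferentiableAt ℂ (fun z => planeWaveLp p μ z ω) z := by
  -- The rate `|Im z| + 2δ` is still less than `a`.
  set δ := (a - |z.im|) / 3 with hδ
  have hδ0 : 0 < δ := by rw [hδ]; linarith
  have hs : |z.im| + 2 * δ < a := by rw [hδ]; linarith
  have hG : MemLp (fun x => Complex.I * (inner ℝ ω x : ℝ) * planeWave z ω x) p μ := by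
    have hc := continuous_planeWave z ω
    refine ((hE _ hs).const_mul (1 / δ)).mono (Continuous.aestronglyMeasurable (by fun_prop))
      (Filter.Eventually.of_forall fun x => ?_)
    have h1 : δ * ‖x‖ ≤ Real.exp (δ * ‖x‖) := by linarith [Real.add_one_le_exp (δ * ‖x‖)]
    have h2 : |inner ℝ ω x| ≤ ‖x‖ := by simpa [hω] using abs_real_inner_le_norm ω x
    rw [norm_mul, norm_mul, Complex.norm_I, one_mul, Complex.norm_real, Real.norm_eq_abs,
      Real.norm_of_nonneg (by positivity)]
    calc _ ≤ ‖x‖ * Real.exp (|z.im| * ‖x‖) := by gcongr; exact norm_planeWave_le hω x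
      _ = 1 / δ * (δ * ‖x‖) * Real.exp (|z.im| * ‖x‖) := by field_simp
      _ ≤ 1 / δ * Real.exp (δ * ‖x‖) * Real.exp ((|z.im| + δ) * ‖x‖) := by gcongr; linarith
      _ = _ := by
        rw [mul_assoc, ← Real.exp_add]
        congr 2
        ring
  suffices h : HasDerivAt (fun z => planeWaveLp p μ z ω) (hG.toLp _) z from h.differentiableAt
  rw [hasDerivAt_iff_isLittleO_nhds_zero]
  set E := (hE _ hs).toLp _ with hEdef
  refine Asymptotics.IsBigO.trans_isLittleO (g := fun h : ℂ => h ^ 2) ?_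
    (Asymptotics.isLittleO_pow_id one_lt_two)
  refine Asymptotics.IsBigO.of_bound (2 / δ ^ 2 * ‖E‖) ?_
  filter_upwards [Metric.ball_mem_nhds (0 : ℂ) hδ0] with h hh
  have hhδ : ‖h‖ ≤ δ := by simpa using (mem_ball_zero_iff.1 hh).le
  have hzh : |(z + h).im| < a := by
    have h1 : |h.im| ≤ δ := (Complex.abs_im_le_norm h).trans hhδ
    rw [Complex.add_im]
    exact (abs_add_le _ _).trans_lt (by linarith)
  have hb : ‖planeWaveLp p μ (z + h) ω - planeWaveLp p μ z ω - h • hG.toLp _‖ ≤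
      ‖((‖h‖ ^ 2 * (2 / δ ^ 2) : ℝ)) • E‖ := by
    refine Lp.norm_le_norm_of_ae_le ?_
    filter_upwards [Lp.coeFn_sub (planeWaveLp p μ (z + h) ω - planeWaveLp p μ z ω) (h • hG.toLp _),
      Lp.coeFn_sub (planeWaveLp p μ (z + h) ω) (planeWaveLp p μ z ω),
      Lp.coeFn_smul h (hG.toLp _), hG.coeFn_toLp,
      coeFn_planeWaveLp (memLp_planeWave hE hzh hω), coeFn_planeWaveLp (memLp_planeWave hE hz hω),
      Lp.coeFn_smul ((‖h‖ ^ 2 * (2 / δ ^ 2) : ℝ)) E, (hE _ hs).coeFn_toLp]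
      with x h1 h2 h3 h4 h5 h6 h7 h8
    rw [h1, Pi.sub_apply, h2, Pi.sub_apply, h3, Pi.smul_apply, h4, h5, h6, h7, Pi.smul_apply, hEdef,
      h8, smul_eq_mul, smul_eq_mul, Real.norm_of_nonneg (by positivity)]
    exact norm_planeWave_remainder_le hδ0 hω hhδ x
  refine hb.trans_eq ?_
  rw [norm_smul, Real.norm_of_nonneg (by positivity), norm_pow]
  ring

/-- The plane waves in `L^p(μ)` with frequencies in `Z`. -/
def planeWaves (p : ℝ≥0∞) (μ : Measure (EuclideanSpace ℝ (Fin n))) (Z : Set ℂ) : Set (Lp ℂ p μ) :=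
  {v | ∃ z ∈ Z, ∃ ω, ‖ω‖ = 1 ∧ planeWaveLp p μ z ω = v}

/-- If `Z` accumulates in the strip of admissible frequencies, then by the identity theorem a
functional vanishing on the plane waves with frequencies in `Z` vanishes on those with real
frequencies, that is, on the characters. -/
theorem dense_span_planeWaves [IsFiniteMeasure μ] [Fact (1 ≤ p)] (hp : p ≠ ∞) (hn : 1 ≤ n)
    (ha : 0 < a)
    (hE : ∀ s < a, MemLp (fun x : EuclideanSpace ℝ (Fin n) => Real.exp (s * ‖x‖)) p μ)
    {Z : Set ℂ} {z₀ : ℂ} (hz₀ : |z₀.im| < a) (hZ : ∃ᶠ z in nhdsWithin z₀ {z₀}ᶜ, z ∈ Z) :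
    Dense (Submodule.span ℂ (planeWaves p μ Z) : Set (Lp ℂ p μ)) := by
  refine dense_of_forall_dual_eq_zero _ fun φ hφ => eq_zero_of_forall_character hp φ fun v => ?_
  have key : ∀ ω : EuclideanSpace ℝ (Fin n), ‖ω‖ = 1 → ∀ z : ℂ, |z.im| < a →
      φ (planeWaveLp p μ z ω) = 0 := by
    intro ω hω z hz
    have hS : {z : ℂ | |z.im| < a} = Complex.imCLM ⁻¹' Set.Ioo (-a) a := by
      ext z; simp [abs_lt]
    have hSo : IsOpen {z : ℂ | |z.im| < a} := by
      rw [hS]; exact isOpen_Ioo.preimage Complex.imCLM.continuous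
    have hSc : Convex ℝ {z : ℂ | |z.im| < a} := by
      rw [hS]
      exact (convex_Ioo _ _).is_linear_preimage Complex.imCLM.isBoundedLinearMap.toIsLinearMap
    have hd : DifferentiableOn ℂ (fun z => φ (planeWaveLp p μ z ω)) {z : ℂ | |z.im| < a} :=
      fun z hz => (φ.differentiableAt.comp z
        (differentiableAt_planeWaveLp hE hz hω)).differentiableWithinAt
    refine (hd.analyticOnNhd hSo).eqOn_of_preconnected_of_frequently_eq
      (g := fun _ => (0 : ℂ)) analyticOnNhd_const hSc.isPreconnected hz₀
      (hZ.mono fun z hzZ => ?_) hz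
    exact hφ _ (Submodule.subset_span ⟨z, hzZ, ω, hω, rfl⟩)
  -- The character with frequency `v = r ω` is the plane wave with `z = 2π r`.
  obtain ⟨ω, r, hω, hv⟩ : ∃ (ω : EuclideanSpace ℝ (Fin n)) (r : ℝ), ‖ω‖ = 1 ∧ v = r • ω := by
    by_cases hv : v = 0
    · exact ⟨EuclideanSpace.single ⟨0, hn⟩ 1, 0, by simp, by simp [hv]⟩
    · exact ⟨‖v‖⁻¹ • v, ‖v‖, norm_smul_inv_norm (𝕜 := ℝ) hv, by
        rw [smul_inv_smul₀ (norm_ne_zero_iff.2 hv)]⟩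
  have hz : |((2 * Real.pi * r : ℝ) : ℂ).im| < a := by rw [Complex.ofReal_im]; simpa using ha
  rw [← key ω hω (2 * Real.pi * r : ℝ) hz]
  congr 1
  refine Lp.ext ((memLp_character v).coeFn_toLp.trans
    ((coeFn_planeWaveLp (memLp_planeWave hE hz hω)).trans
      (Filter.Eventually.of_forall fun x => ?_)).symm)
  simp only [planeWave, hv, inner_smul_left]
  congr 1
  push_cast
  simp
  ring

end

/-! ### Chaos for `c > c_p` -/

section

variable {n : ℕ} {W : EuclideanSpace ℝ (Fin n) → ℝ} {κ : ℝ} {b : ℝ} {p : ℝ≥0∞}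

theorem heatSemigroup_planeWaveLp [Fact (1 ≤ p)] (hW : IsModerateWeight W κ) {z : ℂ}
    {ω : EuclideanSpace ℝ (Fin n)} (h : MemLp (planeWave z ω) p (weightMeasure W)) (hω : ‖ω‖ = 1)
    (t : ℝ≥0) : (heatSemigroup hW p b).op t (planeWaveLp p (weightMeasure W) z ω) =
      Complex.exp (t * -(z ^ 2 + b)) • planeWaveLp p (weightMeasure W) z ω := by
  rcases eq_or_lt_of_le (zero_le (a := t)) with rfl | ht
  · simp [OperatorSemigroup.op_zero]
  have ht' : 0 < (t : ℝ) := by exact_mod_cast ht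
  refine Lp.ext ?_
  filter_upwards [weightMeasure_ac.ae_le ((isHeatSemigroupOn_heatSemigroup hW b t ht
    (planeWaveLp p (weightMeasure W) z ω)).2), Lp.coeFn_smul (Complex.exp (t * -(z ^ 2 + b)))
    (planeWaveLp p (weightMeasure W) z ω), coeFn_planeWaveLp h] with x h1 h2 h3
  have h4 : ∫ y, (heatKernel n t (x - y) : ℂ) * planeWaveLp p (weightMeasure W) z ω y =
      Complex.exp (-(t * z ^ 2)) * planeWave z ω x := by
    have := congrFun (heatConv_congr_ae (hW.ac.ae_eq (coeFn_planeWaveLp h)) t) x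
    rw [heatConv_planeWave ht' z hω] at this
    exact this
  rw [h1, h4, h2, Pi.smul_apply, h3, smul_eq_mul, ← mul_assoc, Complex.ofReal_exp,
    ← Complex.exp_add]
  congr 2
  push_cast
  ring

/-- Near a square root `z₀` of `-b` there are `z ≠ z₀` for which `z ^ 2 + b` is a rational multiple
of `2πi`, because `z ↦ z ^ 2 + b` is an open map. -/
theorem frequently_sq_add_eq {z₀ : ℂ} (h₀ : z₀ ^ 2 + b = 0) :
    ∃ᶠ z in nhdsWithin z₀ {z₀}ᶜ, ∃ k : ℕ, 0 < k ∧ k * (z ^ 2 + b) = 2 * Real.pi * Complex.I := by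
  have hπ : (2 * Real.pi * Complex.I : ℂ) ≠ 0 := Complex.two_pi_I_ne_zero
  have hd : Differentiable ℂ fun z : ℂ => z ^ 2 + b := by fun_prop
  have hmap : nhds (0 : ℂ) ≤ Filter.map (fun z : ℂ => z ^ 2 + b) (nhds z₀) := by
    rcases (hd.analyticAt z₀).eventually_constant_or_nhds_le_map_nhds with h | h
    · exfalso
      have h' := AnalyticOnNhd.eq_of_eventuallyEq (𝕜 := ℂ) (fun z _ => hd.analyticAt z)
        (analyticOnNhd_const (v := z₀ ^ 2 + b)) h
      have h1 := congrFun h' (z₀ + 1)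
      have h2 := congrFun h' (z₀ - 1)
      have : (2 : ℂ) = 0 := by linear_combination h1 + h2
      norm_num at this
    · simpa only [h₀] using h
  have hlim : Filter.Tendsto (fun k : ℕ => 2 * Real.pi * Complex.I / ((k + 1 : ℕ) : ℂ))
      Filter.atTop (nhds 0) :=
    (tendsto_const_div_atTop_nhds_zero_nat _).comp (Filter.tendsto_add_atTop_nat 1)
  rw [Filter.frequently_iff]
  intro U hU
  obtain ⟨V, hV, hVU⟩ := mem_nhdsWithin_iff_exists_mem_nhds_inter.1 hU
  obtain ⟨k, z, hzV, hz⟩ := (hlim.eventually (hmap (Filter.image_mem_map hV))).exists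
  have hk : ((k + 1 : ℕ) : ℂ) ≠ 0 := by exact_mod_cast k.succ_ne_zero
  simp only at hz
  refine ⟨z, hVU ⟨hzV, ?_⟩, k + 1, k.succ_pos, by rw [hz]; field_simp⟩
  rintro rfl
  rw [h₀] at hz
  exact div_ne_zero hπ hk hz.symm

/-- If `L^p(W dx)` contains the functions growing more slowly than `exp (a |x|)`, then plane waves are
eigenvectors of the generator, with eigenvalues `-(z ^ 2 + b)`, `|Im z| < a`. When `b < a ^ 2`
these values lie on both sides of the imaginary axis, and the criterion of Godefroy and Shapiro
applies. -/
theorem isChaotic_heatSemigroup [Fact (1 ≤ p)] (hW : IsModerateWeight W κ) (hp : p ≠ ∞)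
    (hn : 1 ≤ n) {a : ℝ} (ha : 0 < a) (hE : ∀ s < a,
      MemLp (fun x : EuclideanSpace ℝ (Fin n) => Real.exp (s * ‖x‖)) p (weightMeasure W))
    (hb : b < a ^ 2) : (heatSemigroup hW p b).IsChaotic := by
  have hp0 : p ≠ 0 := (one_pos.trans_le (Fact.out : 1 ≤ p)).ne'
  have : IsFiniteMeasure (weightMeasure W) := by
    have h := hE 0 ha
    simp only [zero_mul, Real.exp_zero] at h
    exact ⟨((memLp_const_iff hp0 hp).1 h).resolve_left one_ne_zero⟩
  have : Fact (p ≠ ∞) := ⟨hp⟩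
  have : SecondCountableTopology (Lp ℂ p (weightMeasure W)) := by
    unfold weightMeasure; infer_instance
  have hSo : IsOpen {z : ℂ | |z.im| < a} :=
    isOpen_lt (by fun_prop) continuous_const
  have hop : ∀ {Z : Set ℂ} {z₀ : ℂ}, IsOpen Z → z₀ ∈ Z → ∃ᶠ z in nhdsWithin z₀ {z₀}ᶜ, z ∈ Z :=
    fun hZ hz => ((hZ.eventually_mem hz).filter_mono nhdsWithin_le_nhds).frequently
  have hre : Continuous fun z : ℂ => (z ^ 2 + b).re := by fun_prop
  set S₁ : Set ℂ := {z | |z.im| < a} ∩ {z | 0 < (z ^ 2 + b).re} with hS₁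
  set S₂ : Set ℂ := {z | |z.im| < a} ∩ {z | (z ^ 2 + b).re < 0} with hS₂
  set S₃ : Set ℂ := {z | |z.im| < a} ∩
    {z | ∃ k : ℕ, 0 < k ∧ k * (z ^ 2 + b) = 2 * Real.pi * Complex.I} with hS₃
  obtain ⟨z₁, hz₁⟩ : ∃ z, z ∈ S₁ := by
    refine ⟨((|b| + 1 : ℝ) : ℂ), by simpa using ha, ?_⟩
    have : ((((|b| + 1 : ℝ) : ℂ) ^ 2 + b)).re = (|b| + 1) ^ 2 + b := by
      rw [← Complex.ofReal_pow, ← Complex.ofReal_add, Complex.ofReal_re]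
    rw [Set.mem_ofPred_eq, this]
    nlinarith [neg_abs_le b, abs_nonneg b]
  obtain ⟨z₂, hz₂⟩ : ∃ z, z ∈ S₂ := by
    have hm : max b 0 < a ^ 2 := max_lt hb (by positivity)
    have hm0 : 0 ≤ max b 0 := le_max_right _ _
    have hbm : b ≤ max b 0 := le_max_left _ _
    set y := √((max b 0 + a ^ 2) / 2) with hy
    have hy2 : y ^ 2 = (max b 0 + a ^ 2) / 2 := Real.sq_sqrt (by positivity)
    refine ⟨y * Complex.I, ?_, ?_⟩
    · have : (y * Complex.I : ℂ).im = y := by simp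
      rw [Set.mem_ofPred_eq, this]
      exact abs_lt_of_sq_lt_sq (by rw [hy2]; linarith) ha.le
    · have : ((y * Complex.I) ^ 2 + b : ℂ).re = -y ^ 2 + b := by
        rw [mul_pow, Complex.I_sq, ← Complex.ofReal_pow, mul_neg_one, Complex.add_re, Complex.neg_re,
          Complex.ofReal_re, Complex.ofReal_re]
      rw [Set.mem_ofPred_eq, this, hy2]
      linarith
  obtain ⟨z₃, hz₃, hz₃b⟩ : ∃ z : ℂ, |z.im| < a ∧ z ^ 2 + b = 0 := by
    rcases le_total b 0 with hb0 | hb0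
    · refine ⟨((√(-b) : ℝ) : ℂ), by simpa using ha, ?_⟩
      rw [← Complex.ofReal_pow, Real.sq_sqrt (by linarith)]
      simp
    · refine ⟨(√b : ℝ) * Complex.I, ?_, ?_⟩
      · have : ((√b : ℝ) * Complex.I : ℂ).im = √b := by simp
        rw [this]
        exact abs_lt_of_sq_lt_sq (by rwa [Real.sq_sqrt hb0]) ha.le
      · rw [mul_pow, Complex.I_sq, ← Complex.ofReal_pow, Real.sq_sqrt hb0]
        simp
  refine OperatorSemigroup.isChaotic_of_eigenvectors _ (S₁ := planeWaves p _ S₁)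
    (S₂ := planeWaves p _ S₂) (S₃ := planeWaves p _ S₃)
    (dense_span_planeWaves hp hn ha hE hz₁.1
      (hop (hSo.inter (isOpen_lt continuous_const hre)) hz₁))
    (dense_span_planeWaves hp hn ha hE hz₂.1
      (hop (hSo.inter (isOpen_lt hre continuous_const)) hz₂))
    (dense_span_planeWaves hp hn ha hE hz₃ ((frequently_sq_add_eq hz₃b).and_eventually
      ((hSo.eventually_mem hz₃).filter_mono nhdsWithin_le_nhds) |>.mono fun z hz => ⟨hz.2, hz.1⟩))
    ?_ ?_ ?_
  · rintro _ ⟨z, hz, ω, hω, rfl⟩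
    refine ⟨-(z ^ 2 + b), ?_, heatSemigroup_planeWaveLp hW (memLp_planeWave hE hz.1 hω) hω⟩
    rw [Complex.neg_re]
    exact neg_lt_zero.2 hz.2
  · rintro _ ⟨z, hz, ω, hω, rfl⟩
    refine ⟨-(z ^ 2 + b), ?_, heatSemigroup_planeWaveLp hW (memLp_planeWave hE hz.1 hω) hω⟩
    rw [Complex.neg_re]
    exact neg_pos.2 hz.2
  · rintro _ ⟨z, ⟨hz, k, hk, hzk⟩, ω, hω, rfl⟩
    refine ⟨k, hk, ?_⟩
    rw [heatSemigroup_planeWaveLp hW (memLp_planeWave hE hz hω) hω]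
    have : (((k : ℝ≥0) : ℝ) : ℂ) * -(z ^ 2 + b) = -(2 * Real.pi * Complex.I) := by
      rw [← hzk, NNReal.coe_natCast, Complex.ofReal_natCast, mul_neg]
    rw [this, Complex.exp_neg, Complex.exp_two_pi_mul_I, inv_one, one_smul]

/-- The weight decays faster than `exp (-θ ρ γ_p p |x|)` for every `θ < 1`, so that the space contains
`exp (s|x|)` for `s < ρ γ_p`. -/
theorem memLp_exp_besselWeight (hn : 1 ≤ n) {ρ : ℝ} (hρ : 0 < ρ) [Fact (1 ≤ p)] (hp : p ≠ ∞)
    (hγ : 0 < gammaExp p) {s : ℝ} (hs : s < ρ * gammaExp p) :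
    MemLp (fun x : EuclideanSpace ℝ (Fin n) => Real.exp (s * ‖x‖)) p
      (weightMeasure (besselWeight n ρ p)) := by
  have hW := isModerateWeight_besselWeight hn hρ p
  have hp0 : p ≠ 0 := (one_pos.trans_le (Fact.out : 1 ≤ p)).ne'
  have hq := toReal_one_le (p := p) hp
  set γ := gammaExp p with hγd
  have ha : 0 < ρ * γ := mul_pos hρ hγ
  have hm : max s 0 < ρ * γ := max_lt hs ha
  -- The rate `θργ` lies halfway between `max s 0` and `ργ`.
  set θ := (max s 0 + ρ * γ) / 2 / (ρ * γ) with hθ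
  have hm0 := le_max_right s 0
  have hms := le_max_left s 0
  have hθa : θ * (ρ * γ) = (max s 0 + ρ * γ) / 2 := by rw [hθ]; field_simp
  obtain ⟨C, hC, hV⟩ := exists_besselV_le (ν := (n : ℝ) / 2) (θ := θ) (by positivity)
    (by positivity) (by rw [hθ, div_lt_one ha]; linarith)
  refine ⟨Continuous.aestronglyMeasurable (by fun_prop), ?_⟩
  rw [eLpNorm_lt_top_iff_lintegral_rpow_enorm_lt_top hp0 hp, hW.lintegral]
  have hδ : 0 < (θ * (ρ * γ) - s) * p.toReal := mul_pos (by rw [hθa]; linarith) (by linarith)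
  have h := ((integrable_exp_neg_mul_norm n hδ).const_mul
    ((2 ^ ((n : ℝ) / 2 - 1) * C) ^ (γ * p.toReal))).lintegral_lt_top
  refine lt_of_le_of_lt (lintegral_mono fun x => ?_) h
  rw [← ofReal_norm, Real.norm_of_nonneg (Real.exp_pos _).le,
    ENNReal.ofReal_rpow_of_nonneg (Real.exp_pos _).le ENNReal.toReal_nonneg,
    ← ENNReal.ofReal_mul (hW.pos x).le]
  refine ENNReal.ofReal_le_ofReal ?_
  have h1 : besselWeight n ρ p x ≤
      (2 ^ ((n : ℝ) / 2 - 1) * (C * Real.exp (-(θ * (ρ * ‖x‖))))) ^ (γ * p.toReal) := by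
    refine Real.rpow_le_rpow (besselBase_pos hn x).le ?_ (by positivity)
    unfold besselBase
    gcongr
    exact hV _
  calc _ ≤ (2 ^ ((n : ℝ) / 2 - 1) * (C * Real.exp (-(θ * (ρ * ‖x‖))))) ^ (γ * p.toReal) *
        Real.exp (s * ‖x‖) ^ p.toReal := by gcongr
    _ = _ := by
        rw [← mul_assoc, Real.mul_rpow (by positivity) (Real.exp_pos _).le, ← Real.exp_mul,
          ← Real.exp_mul, mul_assoc, ← Real.exp_add]
        congr 2; ring

end

/-! ### The critical constant -/

theorem gammaExp_pos {p : ℝ≥0∞} [Fact (1 ≤ p)] (hp : p ≠ ∞) (hp2 : p ≠ 2) : 0 < gammaExp p := by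
  have hq := toReal_one_le (p := p) hp
  refine abs_pos.2 fun h => hp2 ?_
  have h2 : p.toReal = 2 := by
    have : (2 : ℝ) / p.toReal = 1 := by linarith
    rw [div_eq_one_iff_eq (by linarith)] at this
    exact this.symm
  rw [← ENNReal.ofReal_toReal hp, h2]
  simp

theorem heatSemigroup_dichotomy {n : ℕ} (hn : 1 ≤ n) {ρ : ℝ} (hρ : 0 < ρ) {p : ℝ≥0∞} [Fact (1 ≤ p)]
    {c : ℝ} {T : OperatorSemigroup (Lp ℂ p (weightMeasure (besselWeight n ρ p)))}
    (hT : IsHeatSemigroupOn (weightMeasure (besselWeight n ρ p)) (ρ ^ 2 - c) T) :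
    (p ≠ ∞ → T.IsStronglyContinuous) ∧
    (p ≠ ∞ → p ≠ 2 → criticalConst ρ p < c → T.IsChaotic) ∧
    (p = ∞ → ¬ T.IsHypercyclic) ∧
    (p ≠ ∞ → c ≤ criticalConst ρ p → ¬ T.IsHypercyclic) := by
  have hW := isModerateWeight_besselWeight hn hρ p
  obtain rfl := hT.unique weightMeasure_ac (isHeatSemigroupOn_heatSemigroup hW _)
  have hc : criticalConst ρ p = ρ ^ 2 - (ρ * gammaExp p) ^ 2 := by unfold criticalConst; ring
  refine ⟨fun hp => isStronglyContinuous_heatSemigroup hW hp _, fun hp hp2 h => ?_, ?_,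
    fun hp h => not_isHypercyclic_heatSemigroup hn hρ hp (by rw [hc] at h; linarith)⟩
  · have hγ := gammaExp_pos hp hp2
    exact isChaotic_heatSemigroup hW hp hn (mul_pos hρ hγ)
      (fun s hs => memLp_exp_besselWeight hn hρ hp hγ hs) (by rw [hc] at h; linarith)
  · rintro rfl
    exact not_isHypercyclic_heatSemigroup_top hn hW

theorem theorem1p4 (n : ℕ) (hn : 1 ≤ n) (ρ : ℝ) (hρ : 0 < ρ)
    (p : ℝ≥0∞) [Fact (1 ≤ p)] (c : ℝ) :
    (∃! T : OperatorSemigroup (WeightedLp n ρ p), IsHeatSemigroup n ρ p c T) ∧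
    ∀ T : OperatorSemigroup (WeightedLp n ρ p), IsHeatSemigroup n ρ p c T →
      (p ≠ ∞ → T.IsStronglyContinuous) ∧
      (p ≠ ∞ → p ≠ 2 → criticalConst ρ p < c → T.IsChaotic) ∧
      (p = ∞ → ¬ T.IsChaotic) ∧
      (p ≠ ∞ → (c ≤ criticalConst ρ p → ¬ T.IsChaotic) ∧
        (c < criticalConst ρ p → ¬ T.IsHypercyclic)) := by
  -- `weightedMeasure` is the same measure with another density, which differs at the origin.
  have key : ∀ μ : Measure (EuclideanSpace ℝ (Fin n)), μ = weightMeasure (besselWeight n ρ p) →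
      (∃! T : OperatorSemigroup (Lp ℂ p μ), IsHeatSemigroupOn μ (ρ ^ 2 - c) T) ∧
      ∀ T : OperatorSemigroup (Lp ℂ p μ), IsHeatSemigroupOn μ (ρ ^ 2 - c) T →
        (p ≠ ∞ → T.IsStronglyContinuous) ∧
        (p ≠ ∞ → p ≠ 2 → criticalConst ρ p < c → T.IsChaotic) ∧
        (p = ∞ → ¬ T.IsHypercyclic) ∧
        (p ≠ ∞ → c ≤ criticalConst ρ p → ¬ T.IsHypercyclic) := by
    rintro _ rfl
    have hW := isModerateWeight_besselWeight hn hρ p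
    exact ⟨⟨_, isHeatSemigroupOn_heatSemigroup hW _,
      fun T hT => hT.unique weightMeasure_ac (isHeatSemigroupOn_heatSemigroup hW _)⟩,
      fun T hT => heatSemigroup_dichotomy hn hρ hT⟩
  obtain ⟨h1, h2⟩ := key _ (weightedMeasure_eq hn hρ p)
  refine ⟨h1, fun T hT => ?_⟩
  obtain ⟨h3, h4, h5, h6⟩ := h2 T hT
  exact ⟨h3, h4, fun hp h => h5 hp h.1,
    fun hp => ⟨fun hc h => h6 hp hc h.1, fun hc => h6 hp hc.le⟩⟩
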